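/- Let $N\ge 1$, $c>0$, $\Box_c=\Delta-c^{-2}\partial_t^2$, and let $S^-\subset\mathbb R^N$ be a bounded open set lying locally on one side of its boundary $S$, where $S$ is a Lyapunov surface (a $C^1$ hypersurface whose outer unit normal $n=(n_1,\dots,n_N)$ is Hölder continuous). Let $D^-=S^-\times[0,\infty)$, let $H$ be the Heaviside function and $H_S^-$ the characteristic function of $S^-$ (equal to $\tfrac12$ at $0$ and on $S$, respectively), and let $G$ be a function on $\mathbb R^{N+1}$ such that $\hat G=G\,H_S^-(x)H(t)$ is locally integrable. Let $u$ be a classical solution (possibly with shock waves) of $\Box_c u=G$ in $D^-$ with $u(x,0)=u_0(x)$ on $S^-\cup S$ and $\dot u(x,0)=\dot u_0(x)$ on $S^-$; that is, $u$ is continuous on $(S^-\cup S)\times[0,\infty)$, and there are at most countably many wave fronts $F_k\subset S^-\times(0,\infty)$ and a closed set $Z$ of zero $N$-dimensional Hausdorff measure (containing the points where fronts start, end, meet each other or reach the boundary of $D^-$), with $\mathcal W=Z\cup\bigcup_kF_k$ closed, such that: * off $\mathcal W$, $u$ is $C^2$ and satisfies $\Box_cu=G$ in $S^-\times(0,\infty)$,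 $\nabla u$ extends continuously to $S\times(0,\infty)$ and $\dot u$ extends continuously to $S\times[0,\infty)$ and to $t=0$, with $\dot u(x,0)=\dot u_0(x)$ for $x\in S^-$, $(x,0)\notin\mathcal W$; and $\nabla u$, $\dot u$ are bounded on $(S^-\times(0,T])\setminus\mathcal W$ for each $T$; * each $F_k$ is a $C^1$ hypersurface with normal $(\nu_x,\nu_t)$, $\nu_t=-c\|\nu_x\|<0$, at each point of which $\nabla u$ and $\dot u$ have limits from both sides (taken off $\mathcal W$), satisfying the Hadamard condition $[\dot u+c\,m\cdot\nabla u]=0$ with $m=\nu_x/\|\nu_x\|$. (The boundary values of $u$ or of $\frac{\partial u}{\partial n}=n\cdot\nabla u$ on $S$ may be those prescribed in a Dirichlet or Neumann problem.) Let $\hat U\in D'(\mathbb R^{N+1})$ be the Green function: $\Box_c\hat U=\delta(x)\delta(t)$, and $\hat U=0$ for $t<0$ and for $\|x\|>ct$. Then $\hat u=u\,H_S^-(x)H(t)$ and the densities below are locally integrable, the convolution $\hat W=\hat U*\delta(x)H(t)$ and all convolutions below exist, and in $D'(\mathbb R^{N+1})$ $$\hat u=-\hat U*\frac{\partial u}{\partial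 n}\delta_S(x)H(t)-\sum_{j=1}^N\hat W,_j*\,\dot u\,n_j\,\delta_S(x)H(t)-\sum_{j=1}^N\hat W,_j\mathop{*}_x u_0n_j\,\delta_S(x)-c^{-2}\,\hat U\mathop{*}_x H_S^-\dot u_0-c^{-2}\Bigl(\hat U\mathop{*}_x H_S^-u_0\Bigr)_{,t}+\hat U*\hat G .$$ Here $,_j=\partial/\partial x_j$, ${}_{,t}=\partial/\partial t$, $\beta\,\delta_S(x)H(t)$ is the simple layer $\varphi\mapsto\int_0^\infty\!\int_S\beta\varphi\,dS\,dt$, and $f\mathop{*}_x g=f*\bigl(g(x)\delta(t)\bigr)$. -/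

import Mathlib

open MeasureTheory Filter Set Topology TopologicalSpace
open scoped Distributions LineDeriv Laplacian

noncomputable section

/-- The Euclidean space `ℝ^N`. -/
abbrev Space (N : ℕ) : Type := EuclideanSpace ℝ (Fin N)

/-- Space-time `ℝ^(N+1)`, with points `(x, t)`. -/
abbrev SpaceTime (N : ℕ) : Type := Space N × ℝ

/-- The test functions `D(ℝ^(N+1))`. -/
abbrev TestFn (N : ℕ) : Type := 𝓓((⊤ : Opens (SpaceTime N)), ℝ)

/-- The generalized functions `D'(ℝ^(N+1))`. -/
abbrev GenFn (N : ℕ) : Type := 𝓓'((⊤ : Opens (SpaceTime N)), ℝ)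

/-- The unit vector of the `x_j` axis of space-time. -/
def spaceDir {N : ℕ} (j : Fin N) : SpaceTime N := (EuclideanSpace.single j 1, 0)

/-- The unit vector of the time axis of space-time. -/
def timeDir (N : ℕ) : SpaceTime N := (0, 1)

/-- The wave operator `Δ - c⁻² ∂²/∂t²` on generalized functions. -/
def waveOp {N : ℕ} (c : ℝ) (f : GenFn N) : GenFn N :=
  (∑ j : Fin N, ∂_{spaceDir j} (∂_{spaceDir j} f)) - (c ^ 2)⁻¹ • ∂_{timeDir N} (∂_{timeDir N} f)

/-- `U` is the Green function of the wave operator: `□ U = δ(x) δ(t)`, and `U` vanishes for `t < 0`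
and for `‖x‖ > c t`. -/
structure IsGreenFunction {N : ℕ} (c : ℝ) (U : GenFn N) : Prop where
  equation : waveOp c U = Distribution.delta 0
  radiation : Distribution.IsVanishingOn U {p : SpaceTime N | p.2 < 0 ∨ c * p.2 < ‖p.1‖}

/-- The generalized function `φ ↦ ∫ φ β dμ`, for `β` locally integrable with respect to `μ`.
For `μ` the Lebesgue measure this is the regular generalized function `β`; for a measure `μ` carried
by a surface it is the simple layer of density `β`. -/
def layer {N : ℕ} (μ : Measure (SpaceTime N)) (β : SpaceTime N → ℝ) : GenFn N :=
  (TestFunction.integralAgainstBilinCLM (ContinuousLinearMap.mul ℝ ℝ) μ β :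
    TestFn N →L[ℝ] ℝ)

section Convolution

variable {N : ℕ}

/-- A sequence of test functions in `D(ℝ^(2(N+1)))` converging to `1`: on each compact set the
functions are eventually equal to `1`, and each derivative is bounded uniformly in `k`. -/
def TendsToOne (η : ℕ → 𝓓((⊤ : Opens (SpaceTime N × SpaceTime N)), ℝ)) : Prop :=
  (∀ K : Set (SpaceTime N × SpaceTime N), IsCompact K → ∀ᶠ k in atTop, ∀ z ∈ K, η k z = 1) ∧
  ∀ m : ℕ, ∃ C : ℝ, ∀ k z, ‖iteratedFDeriv ℝ m (η k) z‖ ≤ C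

/-- The test function `y ↦ η(x, y) φ(x + y)`. -/
def sumSlice (η : 𝓓((⊤ : Opens (SpaceTime N × SpaceTime N)), ℝ)) (φ : TestFn N)
    (x : SpaceTime N) : TestFn N where
  toFun y := η (x, y) * φ (x + y)
  contDiff' := by
    have h1 := η.contDiff
    have h2 := φ.contDiff
    exact (h1.comp (contDiff_const.prodMk contDiff_id)).mul
      (h2.comp (contDiff_const.add contDiff_id))
  hasCompactSupport' := by
    have h : HasCompactSupport fun y : SpaceTime N => φ (x + y) :=
      φ.hasCompactSupport.comp_homeomorph (Homeomorph.addLeft x)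
    exact h.mul_left
  tsupport_subset' := fun _ _ => trivial

/-- `h` is the convolution `f * g`, i.e. the convolution exists and equals `h`: for every test
function `φ` and every sequence `η_k` converging to `1`, the direct product `f(x) · g(y)` applied to
`η_k(x, y) φ(x + y)` tends to `h(φ)`. The direct product acts by
`(f(x) · g(y), Φ(x, y)) = (f(x), (g(y), Φ(x, y)))`; `ψ k` is the inner test function. -/
def HasConvolution (f g h : GenFn N) : Prop :=
  ∀ (φ : TestFn N) (η : ℕ → 𝓓((⊤ : Opens (SpaceTime N × SpaceTime N)), ℝ)), TendsToOne η →
    ∃ ψ : ℕ → TestFn N, (∀ k x, ψ k x = g (sumSlice (η k) φ x)) ∧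
      Tendsto (fun k => f (ψ k)) atTop (𝓝 (h φ))

end Convolution

/-- `Ω` is a bounded open set, lying locally on one side of its boundary `S = frontier Ω`, which is a
Lyapunov surface: a `C¹` hypersurface whose outer unit normal `n` is Hölder continuous. -/
structure IsLyapunovDomain {N : ℕ} (Ω : Set (Space N)) (n : Space N → Space N) : Prop where
  isOpen : IsOpen Ω
  isBounded : Bornology.IsBounded Ω
  smooth : ∀ p ∈ frontier Ω, ∃ (V : Set (Space N)) (ρ : Space N → ℝ), IsOpen V ∧ p ∈ V ∧
    ContDiffOn ℝ 1 ρ V ∧ ∀ q ∈ V, (q ∈ Ω ↔ ρ q < 0) ∧ gradient ρ q ≠ 0 ∧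
      (q ∈ frontier Ω → n q = ‖gradient ρ q‖⁻¹ • gradient ρ q)
  holder : ∃ C α : NNReal, 0 < α ∧ α ≤ 1 ∧ HolderOnWith C α n (frontier Ω)

/-- The surface measure of `S = frontier Ω`: the `(N-1)`-dimensional Hausdorff measure (normalized to
agree with the Lebesgue measure on hyperplanes), restricted to `S`. -/
def surfaceMeasure {N : ℕ} (Ω : Set (Space N)) : Measure (Space N) :=
  (μHE[N - 1] : Measure (Space N)).restrict (frontier Ω)

/-- `p` is a point of the wave front `F`, and the Hadamard conditions hold there for the
one-sided limits of the spatial gradient `v` and the velocity `w`. Near `p` the front is the `C¹`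
hypersurface `g = 0` with normal `ν = (ν_x, ν_t)` at `p`, `ν_t = - c ‖ν_x‖ < 0`, so that it moves with
speed `c` in the direction `ν_x / ‖ν_x‖`. The limits are taken off `W`, the union of all wave fronts.
(The condition `[u] = 0` is the continuity of `u`, required in `IsClassicalSolution`.) -/
def IsHadamardPoint {N : ℕ} (c : ℝ) (v : SpaceTime N → Space N) (w : SpaceTime N → ℝ)
    (W F : Set (SpaceTime N)) (p : SpaceTime N) : Prop :=
  ∃ (V : Set (SpaceTime N)) (g : SpaceTime N → ℝ) (νx : Space N) (νt : ℝ)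
    (vp vm : Space N) (wp wm : ℝ),
    IsOpen V ∧ p ∈ V ∧ ContDiffOn ℝ 1 g V ∧ (∀ q ∈ V, q ∈ F ↔ g q = 0) ∧
    νx = gradient (fun y => g (y, p.2)) p.1 ∧ νt = deriv (fun s => g (p.1, s)) p.2 ∧
    νt < 0 ∧ νt = -(c * ‖νx‖) ∧
    Tendsto v (𝓝[{q | 0 < g q} \ W] p) (𝓝 vp) ∧ Tendsto v (𝓝[{q | g q < 0} \ W] p) (𝓝 vm) ∧
    Tendsto w (𝓝[{q | 0 < g q} \ W] p) (𝓝 wp) ∧ Tendsto w (𝓝[{q | g q < 0} \ W] p) (𝓝 wm) ∧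
    wp + c * inner ℝ (‖νx‖⁻¹ • νx) vp = wm + c * inner ℝ (‖νx‖⁻¹ • νx) vm

/-- `u` is a classical solution, possibly with shock waves, of the wave equation `□ u = G` in the
semicylinder `Ω × [0, ∞)` with initial data `u₀`, `u₁`. Its spatial gradient and velocity are `v` and
`w`. The wave fronts are the hypersurfaces `F k` (finitely many, if all but finitely many are empty).
The closed set `Z`, of zero `N`-dimensional measure, takes up the points where fronts start, end, meet
each other or reach the boundary of the semicylinder. Off `W = Z ∪ ⋃ k, F k` the function `u` is `C²`
inside the semicylinder, and its first derivatives extend continuously to the boundary. -/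
structure IsClassicalSolution {N : ℕ} (c : ℝ) (Ω : Set (Space N)) (G : SpaceTime N → ℝ)
    (u₀ u₁ : Space N → ℝ) (u : SpaceTime N → ℝ) (v : SpaceTime N → Space N)
    (w : SpaceTime N → ℝ) (F : ℕ → Set (SpaceTime N)) (Z : Set (SpaceTime N)) : Prop where
  continuousOn : ContinuousOn u (closure Ω ×ˢ Ici 0)
  isClosed_exceptional : IsClosed Z
  exceptional_null : (μH[(N : ℝ)] : Measure (SpaceTime N)) Z = 0
  front_subset : ∀ k, F k ⊆ Ω ×ˢ Ioi 0
  isClosed_fronts : IsClosed (Z ∪ ⋃ k, F k)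
  hadamard : ∀ k, ∀ p ∈ F k, IsHadamardPoint c v w (Z ∪ ⋃ k, F k) (F k) p
  contDiffOn : ContDiffOn ℝ 2 u ((Ω ×ˢ Ioi 0) \ (Z ∪ ⋃ k, F k))
  gradient_eq : ∀ p ∈ (Ω ×ˢ Ioi 0) \ (Z ∪ ⋃ k, F k),
    HasGradientAt (fun y => u (y, p.2)) (v p) p.1
  velocity_eq : ∀ p ∈ (Ω ×ˢ Ioi 0) \ (Z ∪ ⋃ k, F k),
    HasDerivAt (fun s => u (p.1, s)) (w p) p.2
  wave_equation : ∀ p ∈ (Ω ×ˢ Ioi 0) \ (Z ∪ ⋃ k, F k),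
    Δ (fun y => u (y, p.2)) p.1 - (c ^ 2)⁻¹ * iteratedDeriv 2 (fun s => u (p.1, s)) p.2 = G p
  /- the one-sided values of the first derivatives are finite -/
  bounded : ∀ T : ℝ, ∃ M : ℝ, ∀ p ∈ (Ω ×ˢ Ioc 0 T) \ (Z ∪ ⋃ k, F k), ‖v p‖ ≤ M ∧ |w p| ≤ M
  gradient_continuousOn : ContinuousOn v ((closure Ω ×ˢ Ioi 0) \ (Z ∪ ⋃ k, F k))
  velocity_continuousOn : ContinuousOn w ((closure Ω ×ˢ Ici 0) \ (Z ∪ ⋃ k, F k))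
  initial_value : ∀ x ∈ closure Ω, u (x, 0) = u₀ x
  initial_velocity : ∀ x ∈ Ω, (x, (0 : ℝ)) ∉ Z ∪ ⋃ k, F k → w (x, 0) = u₁ x

/-- The Heaviside function, equal to `1/2` at `0`. -/
def heaviside (t : ℝ) : ℝ := if 0 < t then 1 else if t = 0 then 1 / 2 else 0

open Classical in
/-- The characteristic function of `Ω`, equal to `1/2` on the boundary. -/
def charFn {N : ℕ} (Ω : Set (Space N)) (x : Space N) : ℝ :=
  if x ∈ Ω then 1 else if x ∈ frontier Ω then 1 / 2 else 0

/-- The extension by zero `f(x, t) H_Ω(x) H(t)` of `f` outside the semicylinder. -/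
def zeroExt {N : ℕ} (Ω : Set (Space N)) (f : SpaceTime N → ℝ) (p : SpaceTime N) : ℝ :=
  f p * (charFn Ω p.1 * heaviside p.2)

/-- The measure `δ(x) H(t)`. -/
def pointTimes (N : ℕ) : Measure (SpaceTime N) :=
  (Measure.dirac (0 : Space N)).prod (volume.restrict (Ici (0 : ℝ)))

/-- The measure `δ_S(x) H(t)` on the lateral boundary of the semicylinder. -/
def lateral {N : ℕ} (Ω : Set (Space N)) : Measure (SpaceTime N) :=
  (surfaceMeasure Ω).prod (volume.restrict (Ici (0 : ℝ)))

/-- The measure `δ_S(x) δ(t)`. -/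
def lateralInit {N : ℕ} (Ω : Set (Space N)) : Measure (SpaceTime N) :=
  (surfaceMeasure Ω).prod (Measure.dirac (0 : ℝ))

/-- The measure `1(x) δ(t)` on the hyperplane `t = 0`. -/
def initPlane (N : ℕ) : Measure (SpaceTime N) :=
  (volume : Measure (Space N)).prod (Measure.dirac (0 : ℝ))

end

/-!
The formula is the convolution of the Green function with a Green identity: the wave operator, applied
to the extension by zero `û` of the solution, is a sum of layers on the lateral boundary, layers on the
bottom, and `Ĝ` (`IsClassicalSolution.layer_waveTest`). The layer of `u n_j` and its derivative
`∂/∂x_j` are traded for the layers of `∂u/∂t n_j` and `u₀ n_j` by means of `Ŵ`, which undoes a time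
derivative.

*Convolutions.* A generalized function that vanishes off the forward cone can be convolved with a layer
carried by a half-cylinder `‖x‖ ≤ R`, `t ≥ 0`: the integral of the layer against the translate
`φ(x + ·)` is a smooth function of `x`, whose restriction to a neighbourhood of the cone extends to a
test function, and the convolution is evaluated by pairing the causal factor with that test function
(`exists_causalConvolution`). Together with `translationIntegral_pointTimes_timeDir` this turns the
representation formula into two identities for each test function, the Green identity and the time
derivative of the layer of `u n_j` (`representation_of_green`).

*Green identity.* It is the divergence theorem (`IsShockField.integral_divergence`) for the fields
`(∇u, -c⁻² ∂u/∂t)`, `u e_j` and `u e_t`. The Hadamard condition, at a front of speed `c`, and the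
continuity of `u` say that the fluxes of these fields through the fronts are continuous
(`IsClassicalSolution.isShockField_wave`, `IsClassicalSolution.isShockField_smul`).

*Divergence theorem.* The amount `fluxDefect` by which the theorem fails is additive in the test
function, so it may be studied locally; across a graph it is the jump of the flux
(`fluxDefect_eq_of_graph`). The fronts are countably many and may accumulate, but by Baire's theorem
the set of the points near which the theorem fails, if it were not empty, would locally lie in a single
front, where the flux does not jump (`fluxDefect_eq_zero_of_fronts`). The exceptional set `Z` has
dimension too small to matter: it has zero capacity, and the field is bounded
(`fluxDefect_eq_zero_of_removable`). At the lateral boundary no area formula is needed. A chart of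
slope at most `ε` compares the surface measure with the Lebesgue measure of the tangent hyperplane up
to a factor `(1 + ε) ^ (N - 1)`; the defect is thus bounded by an arbitrarily small multiple of the
lateral mass of the test function (`IsShockField.abs_shockDefect_le_of_chart`), and such bounds add up
over a partition of unity (`IsShockField.shockDefect_eq_zero`).

*Time derivative on the lateral boundary.* Almost every vertical line inside the domain avoids `Z` and
meets the fronts in a countable set of times, so the solution is Lipschitz in time
(`IsClassicalSolution.abs_sub_le`). On the lateral boundary, off `Z`, its time derivative is the
boundary value of `∂u/∂t` (`IsClassicalSolution.hasDerivAt_lateral`), and integration by parts on the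
vertical lines of the boundary gives the identity (`IsClassicalSolution.layer_velocity_add_lateralInit`).
-/

noncomputable section

/-! ### Integrals of translates -/

section TranslationIntegral

variable {E F : Type*} [NormedAddCommGroup E] [NormedSpace ℝ E] [FiniteDimensional ℝ E]
  [MeasurableSpace E] [BorelSpace E] [NormedAddCommGroup F] [NormedSpace ℝ F]
  {μ : Measure E} {β : E → ℝ}

lemma integrable_smul_translate (hβ : Integrable β μ) {ψ : E → F} (hψ : Continuous ψ) {C : ℝ}
    (hC : ∀ x, ‖ψ x‖ ≤ C) (x : E) : Integrable (fun y => β y • ψ (x + y)) μ := by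
  exact Integrable.smul_bdd (C := C) hβ
    (hψ.comp (continuous_const.add continuous_id)).aestronglyMeasurable
    (Eventually.of_forall fun y => hC _)

lemma hasFDerivAt_integral_smul_translate (hβ : Integrable β μ) {ψ : E → F} (hψ : ContDiff ℝ 1 ψ)
    {C C' : ℝ} (hC : ∀ x, ‖ψ x‖ ≤ C) (hC' : ∀ x, ‖fderiv ℝ ψ x‖ ≤ C') (x : E) :
    HasFDerivAt (fun x => ∫ y, β y • ψ (x + y) ∂μ) (∫ y, β y • fderiv ℝ ψ (x + y) ∂μ) x := by
  refine hasFDerivAt_integral_of_dominated_of_fderiv_le (s := univ)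
    (F' := fun x y => β y • fderiv ℝ ψ (x + y)) (bound := fun y => ‖β y‖ * C')
    univ_mem ?_ ?_ ?_ ?_ ?_ ?_
  · exact Eventually.of_forall fun z =>
      (integrable_smul_translate hβ hψ.continuous hC z).aestronglyMeasurable
  · exact integrable_smul_translate hβ hψ.continuous hC x
  · exact (integrable_smul_translate hβ (hψ.continuous_fderiv one_ne_zero) hC' x).aestronglyMeasurable
  · refine Eventually.of_forall fun y z _ => ?_
    rw [norm_smul]
    exact mul_le_mul_of_nonneg_left (hC' _) (norm_nonneg _)
  · exact hβ.norm.mul_const _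
  · refine Eventually.of_forall fun y z _ => ?_
    have h1 : HasFDerivAt ψ (fderiv ℝ ψ (z + y)) (z + y) :=
      (hψ.differentiable one_ne_zero _).hasFDerivAt
    have h2 : HasFDerivAt (fun z => ψ (z + y)) (fderiv ℝ ψ (z + y)) z := by
      have := h1.comp z ((hasFDerivAt_id z).add_const y)
      rwa [ContinuousLinearMap.comp_id] at this
    exact h2.const_smul (β y)

/-- Derivatives of every order fall on the translated function, so that the translation integral is as
smooth as that function, however rough the measure is. -/
lemma iteratedFDeriv_integral_smul_translate [CompleteSpace F] (hβ : Integrable β μ) {φ : E → F}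
    (hφ : ContDiff ℝ (⊤ : ℕ∞) φ) (hc : HasCompactSupport φ) (m : ℕ) :
    iteratedFDeriv ℝ m (fun x => ∫ y, β y • φ (x + y) ∂μ) =
      fun x => ∫ y, β y • iteratedFDeriv ℝ m φ (x + y) ∂μ := by
  have hsm : ∀ m : ℕ, ContDiff ℝ 1 (iteratedFDeriv ℝ m φ) := fun m =>
    hφ.iteratedFDeriv_right (m := 1) (i := m) (by exact_mod_cast le_top)
  have hb : ∀ m : ℕ, ∃ C, ∀ x, ‖iteratedFDeriv ℝ m φ x‖ ≤ C := fun m =>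
    (hsm m).continuous.bounded_above_of_compact_support (hc.iteratedFDeriv m)
  have hb' : ∀ m : ℕ, ∃ C, ∀ x, ‖fderiv ℝ (iteratedFDeriv ℝ m φ) x‖ ≤ C := fun m =>
    ((hsm m).continuous_fderiv one_ne_zero).bounded_above_of_compact_support
      ((hc.iteratedFDeriv m).fderiv ℝ)
  induction m with
  | zero =>
    ext x v
    simp only [iteratedFDeriv_zero_apply]
    obtain ⟨C, hC⟩ := hb 0
    rw [ContinuousMultilinearMap.integral_apply]
    · simp
    · exact integrable_smul_translate hβ (hsm 0).continuous hC x
  | succ m ih =>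
    obtain ⟨C, hC⟩ := hb m
    obtain ⟨C', hC'⟩ := hb' m
    ext x v
    have hi := integrable_smul_translate hβ ((hsm m).continuous_fderiv one_ne_zero) hC' x
    obtain ⟨C₁, hC₁⟩ := hb (m + 1)
    have hi' := integrable_smul_translate hβ (hsm (m + 1)).continuous hC₁ x
    rw [iteratedFDeriv_succ_apply_left, ih,
      (hasFDerivAt_integral_smul_translate hβ (hsm m) hC hC' x).fderiv,
      ContinuousLinearMap.integral_apply hi, ContinuousMultilinearMap.integral_apply hi',
      ContinuousMultilinearMap.integral_apply]
    · simp [iteratedFDeriv_succ_apply_left]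
    · exact hi.apply_continuousLinearMap (v 0)

lemma contDiff_integral_smul_translate [CompleteSpace F] (hβ : Integrable β μ) {φ : E → F}
    (hφ : ContDiff ℝ (⊤ : ℕ∞) φ) (hc : HasCompactSupport φ) :
    ContDiff ℝ (⊤ : ℕ∞) (fun x => ∫ y, β y • φ (x + y) ∂μ) := by
  refine contDiff_of_differentiable_iteratedFDeriv fun m _ => ?_
  rw [iteratedFDeriv_integral_smul_translate hβ hφ hc m]
  have hsm : ContDiff ℝ 1 (iteratedFDeriv ℝ m φ) :=
    hφ.iteratedFDeriv_right (m := 1) (i := m) (by exact_mod_cast le_top)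
  obtain ⟨C, hC⟩ := hsm.continuous.bounded_above_of_compact_support (hc.iteratedFDeriv m)
  obtain ⟨C', hC'⟩ := (hsm.continuous_fderiv one_ne_zero).bounded_above_of_compact_support
      ((hc.iteratedFDeriv m).fderiv ℝ)
  exact fun x => (hasFDerivAt_integral_smul_translate hβ hsm hC hC' x).differentiableAt

end TranslationIntegral

/-! ### Convolution of causal generalized functions with forward layers -/

section CausalConvolution

variable {N : ℕ}

/-- A generalized function that vanishes off the forward cone `‖x‖ ≤ c t`. -/
def IsCausal (c : ℝ) (T : GenFn N) : Prop :=
  Distribution.IsVanishingOn T {p : SpaceTime N | c * p.2 < ‖p.1‖}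

/-- The cone `‖x‖ < c (t + 1)`, an open neighbourhood of the forward cone that is stable under
forward shifts in time. -/
def coneNhd (N : ℕ) (c : ℝ) : Set (SpaceTime N) := {p | ‖p.1‖ < c * (p.2 + 1)}

lemma isOpen_coneNhd (c : ℝ) : IsOpen (coneNhd N c) :=
  isOpen_lt (by fun_prop) (by fun_prop)

lemma IsCausal.apply_congr {c : ℝ} (hc : 0 < c) {T : GenFn N} (hT : IsCausal c T) {θ θ' : TestFn N}
    (h : EqOn θ θ' (coneNhd N c)) : T θ = T θ' := by
  rw [← sub_eq_zero, ← map_sub]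
  refine hT _ ?_
  intro p hp
  by_contra hcon
  simp only [mem_ofPred_eq, not_lt] at hcon
  have hmem : p ∈ coneNhd N c := by
    change ‖p.1‖ < _
    nlinarith
  refine (notMem_tsupport_iff_eventuallyEq.2 ?_) hp
  filter_upwards [(isOpen_coneNhd c).mem_nhds hmem] with q hq
  simp [h hq]

/-- The function `x ↦ (β μ)(φ(x + ·))`, which pairs the layer of density `β` with the translates
of `φ`. -/
def translationIntegral (μ : Measure (SpaceTime N)) (β : SpaceTime N → ℝ)
    (φ : SpaceTime N → ℝ) (x : SpaceTime N) : ℝ := ∫ y, φ (x + y) * β y ∂μ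

/-- A locally integrable density carried by a half-cylinder `‖x‖ ≤ R`, `t ≥ 0`. -/
structure IsForwardDensity (μ : Measure (SpaceTime N)) (β : SpaceTime N → ℝ) : Prop where
  locallyIntegrable : LocallyIntegrable β μ
  support : ∃ R : ℝ, 0 ≤ R ∧ ∀ᵐ y ∂μ, β y ≠ 0 → ‖y.1‖ ≤ R ∧ 0 ≤ y.2

variable {μ : Measure (SpaceTime N)} {β : SpaceTime N → ℝ}

lemma layer_apply (hβ : LocallyIntegrable β μ) (φ : TestFn N) :
    layer μ β φ = ∫ y, φ y * β y ∂μ :=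
  TestFunction.integralAgainstBilinCLM_eq_integral (hβ.locallyIntegrableOn _)

lemma exists_support_bound (φ : TestFn N) : ∃ r : ℝ, 0 < r ∧ ∀ x, φ x ≠ 0 → ‖x‖ ≤ r := by
  obtain ⟨r, hr, h⟩ := φ.hasCompactSupport.isBounded.exists_pos_norm_le
  exact ⟨r, hr, fun x hx => h x (subset_tsupport _ hx)⟩

lemma integrable_indicator_closedBall (hβ : LocallyIntegrable β μ) (r : ℝ) :
    Integrable ((Metric.closedBall (0 : SpaceTime N) r).indicator β) μ :=
  (integrable_indicator_iff measurableSet_closedBall).2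
    (hβ.integrableOn_isCompact (isCompact_closedBall _ _))

lemma translationIntegral_eq_smul (β : SpaceTime N → ℝ) (φ : SpaceTime N → ℝ) :
    translationIntegral μ β φ = fun x => ∫ y, β y • φ (x + y) ∂μ := by
  funext x
  exact integral_congr_ae (Eventually.of_forall fun y => mul_comm _ _)

lemma translationIntegral_indicator {φ : SpaceTime N → ℝ} {r : ℝ} (hr : ∀ x, φ x ≠ 0 → ‖x‖ ≤ r)
    {x : SpaceTime N} {s : ℝ} (hx : ‖x‖ ≤ s) :
    translationIntegral μ β φ x =
      translationIntegral μ ((Metric.closedBall (0 : SpaceTime N) (r + s)).indicator β) φ x := by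
  refine integral_congr_ae (Eventually.of_forall fun y => ?_)
  by_cases hy : φ (x + y) = 0
  · simp [hy]
  · have : y ∈ Metric.closedBall (0 : SpaceTime N) (r + s) := by
      rw [mem_closedBall_zero_iff]
      calc ‖y‖ = ‖(x + y) - x‖ := by congr 1; abel
        _ ≤ ‖x + y‖ + ‖x‖ := norm_sub_le _ _
        _ ≤ r + s := add_le_add (hr _ hy) hx
    simp [this]

lemma translationIntegral_eventuallyEq {φ : SpaceTime N → ℝ} {r : ℝ}
    (hr : ∀ x, φ x ≠ 0 → ‖x‖ ≤ r) (x₀ : SpaceTime N) :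
    translationIntegral μ β φ =ᶠ[𝓝 x₀] fun x => ∫ y,
      ((Metric.closedBall (0 : SpaceTime N) (r + (‖x₀‖ + 1))).indicator β) y • φ (x + y) ∂μ := by
  filter_upwards [Metric.ball_mem_nhds x₀ one_pos] with z hz
  have hz' : ‖z‖ ≤ ‖x₀‖ + 1 := by
    have := norm_le_norm_add_norm_sub x₀ z
    rw [Metric.mem_ball, dist_eq_norm] at hz
    linarith [norm_sub_rev z x₀]
  rw [translationIntegral_indicator hr hz', translationIntegral_eq_smul]

lemma contDiff_translationIntegral (hβ : LocallyIntegrable β μ) (φ : TestFn N) :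
    ContDiff ℝ (⊤ : ℕ∞) (translationIntegral μ β φ) := by
  obtain ⟨r, -, hr⟩ := exists_support_bound φ
  rw [contDiff_iff_contDiffAt]
  intro x₀
  have h := contDiff_integral_smul_translate
    (integrable_indicator_closedBall hβ (r + (‖x₀‖ + 1))) φ.contDiff φ.hasCompactSupport
  exact h.contDiffAt.congr_of_eventuallyEq (translationIntegral_eventuallyEq hr x₀)

lemma testFn_lineDeriv_apply (φ : TestFn N) (v x : SpaceTime N) :
    (∂_{v} φ) x = fderiv ℝ φ x v := by
  change (TestFunction.lineDerivCLM ℝ v φ : TestFn N) x = _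
  rw [TestFunction.lineDerivCLM_eq_fderivCLM, TestFunction.fderivCLM_apply, if_pos (by simp)]

lemma fderiv_translationIntegral (hβ : LocallyIntegrable β μ) (φ : TestFn N)
    (v x₀ : SpaceTime N) :
    fderiv ℝ (translationIntegral μ β φ) x₀ v = translationIntegral μ β (∂_{v} φ : TestFn N) x₀ := by
  obtain ⟨r, -, hr⟩ := exists_support_bound φ
  set β' := (Metric.closedBall (0 : SpaceTime N) (r + (‖x₀‖ + 1))).indicator β
  have hβ' : Integrable β' μ := integrable_indicator_closedBall hβ _
  have hφ1 : ContDiff ℝ 1 φ := φ.contDiff.of_le (by exact_mod_cast le_top)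
  obtain ⟨C, hC⟩ := hφ1.continuous.bounded_above_of_compact_support φ.hasCompactSupport
  obtain ⟨C', hC'⟩ := (hφ1.continuous_fderiv one_ne_zero).bounded_above_of_compact_support
      (φ.hasCompactSupport.fderiv ℝ)
  have h := hasFDerivAt_integral_smul_translate hβ' hφ1 hC hC' x₀
  rw [(h.congr_of_eventuallyEq (translationIntegral_eventuallyEq hr x₀)).fderiv, ContinuousLinearMap.integral_apply
    (integrable_smul_translate hβ' (hφ1.continuous_fderiv one_ne_zero) hC' x₀)]
  refine integral_congr_ae (Eventually.of_forall fun y => ?_)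
  simp only [_root_.smul_apply, smul_eq_mul, testFn_lineDeriv_apply]
  by_cases hy : fderiv ℝ φ (x₀ + y) v = 0
  · simp [hy]
  · have hmem : ‖x₀ + y‖ ≤ r := by
      by_contra hcon
      push Not at hcon
      refine hy ?_
      have : φ =ᶠ[𝓝 (x₀ + y)] fun _ => (0 : ℝ) := by
        have hopen : IsOpen {z : SpaceTime N | r < ‖z‖} := isOpen_lt continuous_const continuous_norm
        filter_upwards [hopen.mem_nhds hcon] with z hz
        by_contra hne
        exact absurd (hr z hne) (not_le.2 hz)
      rw [this.fderiv_eq]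
      simp
    have : y ∈ Metric.closedBall (0 : SpaceTime N) (r + (‖x₀‖ + 1)) := by
      rw [mem_closedBall_zero_iff]
      calc ‖y‖ = ‖(x₀ + y) - x₀‖ := by congr 1; abel
        _ ≤ ‖x₀ + y‖ + ‖x₀‖ := norm_sub_le _ _
        _ ≤ _ := by linarith
    simp only [β', indicator_of_mem this]
    ring

/-- The product of a translation integral with `χ` agrees with it on `coneNhd N c`, and is compactly
supported when the density is carried by a half-cylinder: `χ` bounds time from below and `‖x.1‖` in
terms of time, the density bounds time from above. -/
lemma exists_cone_cutoff (c : ℝ) (hc : 0 < c) : ∃ χ : SpaceTime N → ℝ, ContDiff ℝ (⊤ : ℕ∞) χ ∧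
    (∀ x ∈ coneNhd N c, χ x = 1) ∧ ∀ x, χ x ≠ 0 → ‖x.1‖ < c * (x.2 + 2) := by
  have hs : IsClosed {x : SpaceTime N | c * (x.2 + 2) ≤ ‖x.1‖} :=
    isClosed_le (by fun_prop) (by fun_prop)
  have ht : IsClosed {x : SpaceTime N | ‖x.1‖ ≤ c * (x.2 + 1)} :=
    isClosed_le (by fun_prop) (by fun_prop)
  obtain ⟨f, h0, h1, -⟩ := exists_contMDiffMap_zero_one_of_isClosed
    (n := (⊤ : ℕ∞)) (modelWithCornersSelf ℝ (SpaceTime N)) hs ht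
    (Set.disjoint_left.2 fun x hx hx' => by
      simp only [mem_ofPred_eq] at hx hx'
      nlinarith)
  refine ⟨f, f.contMDiff.contDiff, fun x hx => h1 (show ‖x.1‖ ≤ _ from le_of_lt hx), fun x hx => ?_⟩
  by_contra hcon
  exact hx (h0 (not_lt.1 hcon))

/-- Cut-off translation integrals `Θ φ` of test functions are test functions, and they depend
continuously on `φ`, in the sense that `T ∘ Θ` is a generalized function for each `T`. -/
lemma exists_causalConvolution_aux {c : ℝ} (hc : 0 < c) {χ : SpaceTime N → ℝ}
    (hχ : ContDiff ℝ (⊤ : ℕ∞) χ) (hχs : ∀ x, χ x ≠ 0 → ‖x.1‖ < c * (x.2 + 2))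
    (hβ : IsForwardDensity μ β) : ∃ Θ : TestFn N → TestFn N,
      (∀ φ x, Θ φ x = translationIntegral μ β φ x * χ x) ∧
      ∀ T : GenFn N, ∃ h : GenFn N, ∀ φ, h φ = T (Θ φ) := by
  obtain ⟨R, hR0, hR⟩ := hβ.support
  -- on the support of `χ` time is at least `-2`
  have htime : ∀ x, χ x ≠ 0 → -2 < x.2 := fun x hx => by
    have := (norm_nonneg _).trans_lt (hχs x hx)
    nlinarith
  have hbig : ∀ (φ : SpaceTime N → ℝ) (r : ℝ), (∀ x, φ x ≠ 0 → ‖x‖ ≤ r) → ∀ x, χ x ≠ 0 →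
      translationIntegral μ β φ x ≠ 0 → x.2 ≤ r := by
    intro φ r hr x hx hne
    by_contra hcon
    refine hne (integral_eq_zero_of_ae ?_)
    filter_upwards [hR] with y hy
    by_contra hne'
    have h1 := hr (x + y) (left_ne_zero_of_mul hne')
    have h2 := (hy (right_ne_zero_of_mul hne')).2
    have h3 : |(x + y).2| ≤ r := (norm_snd_le _).trans h1
    have h4 := (abs_le.1 h3).2
    simp only [Prod.snd_add] at h4
    linarith
  have hsupp : ∀ φ : TestFn N, HasCompactSupport
      (fun x => translationIntegral μ β φ x * χ x) := by
    intro φ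
    obtain ⟨r, hr0, hr⟩ := exists_support_bound φ
    refine HasCompactSupport.of_support_subset_isCompact
      (isCompact_closedBall (0 : SpaceTime N) (max (c * (r + 2)) (r + 2))) ?_
    intro x hx
    have hx1 := right_ne_zero_of_mul hx
    have hx2 := hbig φ r hr x hx1 (left_ne_zero_of_mul hx)
    have hx3 := hχs x hx1
    have hx4 := htime x hx1
    rw [mem_closedBall_zero_iff, Prod.norm_def]
    refine max_le_max ?_ ?_
    · nlinarith
    · rw [Real.norm_eq_abs, abs_le]
      constructor <;> linarith
  let Θ : TestFn N → TestFn N := fun φ =>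
    ⟨fun x => translationIntegral μ β φ x * χ x,
      (contDiff_translationIntegral hβ.locallyIntegrable φ).mul hχ, hsupp φ, fun _ _ => trivial⟩
  refine ⟨Θ, fun φ x => rfl, fun T => ?_⟩
  have hint : ∀ (φ : TestFn N) (x : SpaceTime N), Integrable (fun y => φ (x + y) * β y) μ := by
    intro φ x
    have hcomp : HasCompactSupport fun y => φ (x + y) :=
      φ.hasCompactSupport.comp_homeomorph (Homeomorph.addLeft x)
    have := hβ.locallyIntegrable.integrable_smul_left_of_hasCompactSupport
      (φ.continuous.comp (continuous_const.add continuous_id)) hcomp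
    exact this
  have hadd : ∀ φ ψ, Θ (φ + ψ) = Θ φ + Θ ψ := by
    intro φ ψ
    ext x
    change translationIntegral μ β (φ + ψ : TestFn N) x * χ x =
      translationIntegral μ β φ x * χ x + translationIntegral μ β ψ x * χ x
    rw [← add_mul]
    congr 1
    unfold translationIntegral
    rw [← integral_add (hint φ x) (hint ψ x)]
    refine integral_congr_ae (Eventually.of_forall fun y => ?_)
    change (φ (x + y) + ψ (x + y)) * β y = _
    ring
  have hsmul : ∀ (a : ℝ) φ, Θ (a • φ) = a • Θ φ := by
    intro a φ
    ext x
    change translationIntegral μ β (a • φ : TestFn N) x * χ x =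
      a * (translationIntegral μ β φ x * χ x)
    rw [← mul_assoc]
    congr 1
    unfold translationIntegral
    rw [← integral_const_mul]
    refine integral_congr_ae (Eventually.of_forall fun y => ?_)
    change (a * φ (x + y)) * β y = _
    ring
  refine ⟨TestFunction.mkCLM ℝ (fun φ => T (Θ φ)) (fun φ ψ => by rw [hadd, map_add])
    (fun a φ => by rw [hsmul, map_smul]) ?_, fun φ => rfl⟩
  intro K hK
  obtain ⟨r, hr0, hr⟩ := K.isCompact.isBounded.exists_pos_norm_le
  -- for test functions carried by `K` only a bounded part of the density matters
  set ρ : ℝ := max R (r + 2)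
  set β' := (Metric.closedBall (0 : SpaceTime N) ρ).indicator β
  have hβ' : Integrable β' μ := integrable_indicator_closedBall hβ.locallyIntegrable ρ
  let K' : Compacts (SpaceTime N) :=
    ⟨Metric.closedBall 0 (r + ρ), isCompact_closedBall _ _⟩
  have hval : ∀ (f : ContDiffMapSupportedIn (SpaceTime N) ℝ ⊤ K) x, ‖f x‖ ≠ 0 → ‖x‖ ≤ r :=
    fun f x hx => hr x (f.support_subset (norm_ne_zero_iff.1 hx))
  let A : ContDiffMapSupportedIn (SpaceTime N) ℝ ⊤ K →L[ℝ]
      ContDiffMapSupportedIn (SpaceTime N) ℝ ⊤ K' :=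
    ContDiffMapSupportedIn.mkCLM ℝ (fun f x => ∫ y, β' y • f (x + y) ∂μ)
      (by
        intro f g x
        have hf := integrable_smul_translate hβ' f.continuous
          (f.continuous.bounded_above_of_compact_support f.hasCompactSupport).choose_spec x
        have hg := integrable_smul_translate hβ' g.continuous
          (g.continuous.bounded_above_of_compact_support g.hasCompactSupport).choose_spec x
        rw [← integral_add hf hg]
        exact integral_congr_ae (Eventually.of_forall fun y => smul_add _ _ _))
      (by
        intro a f x
        rw [← integral_smul]
        exact integral_congr_ae (Eventually.of_forall fun y => smul_comm (β' y) a (f (x + y))))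
      (fun f => contDiff_integral_smul_translate hβ' f.contDiff f.hasCompactSupport)
      (by
        intro f x hx
        refine integral_eq_zero_of_ae (Eventually.of_forall fun y => ?_)
        by_contra hne
        have h1 : y ∈ Metric.closedBall (0 : SpaceTime N) ρ := by
          by_contra hy
          exact hne (by simp [β', indicator_of_notMem hy])
        have h2 := hval f (x + y) (norm_ne_zero_iff.2 (right_ne_zero_of_smul hne))
        refine hx ?_
        change x ∈ Metric.closedBall (0 : SpaceTime N) (r + ρ)
        rw [mem_closedBall_zero_iff] at h1 ⊢
        calc ‖x‖ = ‖(x + y) - y‖ := by congr 1; abel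
          _ ≤ ‖x + y‖ + ‖y‖ := norm_sub_le _ _
          _ ≤ r + ρ := add_le_add h2 h1)
      (by
        intro i hi
        refine ⟨{i}, ∫ y, ‖β' y‖ ∂μ, integral_nonneg fun _ => norm_nonneg _, fun f x hx => ?_⟩
        rw [iteratedFDeriv_integral_smul_translate hβ' f.contDiff f.hasCompactSupport,
          Finset.sup_singleton, ← integral_mul_const]
        refine norm_integral_le_of_norm_le (hβ'.norm.mul_const _)
          (Eventually.of_forall fun y => ?_)
        rw [norm_smul]
        exact mul_le_mul_of_nonneg_left
          (ContDiffMapSupportedIn.norm_iteratedFDeriv_apply_le_seminorm_top ℝ) (norm_nonneg _))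
  have hcomp : (fun φ => T (Θ φ)) ∘ TestFunction.ofSupportedIn hK =
      fun f => T (TestFunction.ofSupportedIn (Ω := (⊤ : Opens (SpaceTime N))) (K := K')
        (fun _ _ => trivial)
        (ContDiffMapSupportedIn.bilinLeftCLM (ContinuousLinearMap.mul ℝ ℝ) hχ (A f))) := by
    funext f
    simp only [Function.comp]
    congr 1
    ext x
    change translationIntegral μ β f x * χ x = (∫ y, β' y • f (x + y) ∂μ) * χ x
    by_cases hx : χ x = 0
    · simp [hx]
    congr 1
    refine integral_congr_ae ?_
    filter_upwards [hR] with y hy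
    by_cases h0 : f (x + y) * β y = 0
    · rcases mul_eq_zero.1 h0 with h | h
      · simp [h]
      · simp [h, β']
    · have h1 := hy (right_ne_zero_of_mul h0)
      have h2 := hval f (x + y) (norm_ne_zero_iff.2 (left_ne_zero_of_mul h0))
      have h3 : |(x + y).2| ≤ r := (norm_snd_le _).trans h2
      have h4 := (abs_le.1 h3).2
      have h5 := htime x hx
      simp only [Prod.snd_add] at h4
      have : y ∈ Metric.closedBall (0 : SpaceTime N) ρ := by
        rw [mem_closedBall_zero_iff, Prod.norm_def]
        refine max_le_max h1.1 ?_
        rw [Real.norm_eq_abs, abs_of_nonneg h1.2]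
        linarith
      simp [β', indicator_of_mem this, mul_comm]
  rw [hcomp]
  exact T.continuous.comp ((TestFunction.continuous_ofSupportedIn _).comp
    ((ContinuousLinearMap.continuous _).comp A.continuous))

/-- Near the forward cone, a translation integral agrees with a test function. -/
lemma exists_testFn_translationIntegral {c : ℝ} (hc : 0 < c) (hβ : IsForwardDensity μ β)
    (φ : TestFn N) : ∃ θ : TestFn N, EqOn θ (translationIntegral μ β φ) (coneNhd N c) := by
  obtain ⟨χ, hχ, hχ1, hχs⟩ := exists_cone_cutoff (N := N) c hc
  obtain ⟨Θ, hΘ, -⟩ := exists_causalConvolution_aux hc hχ hχs hβ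
  exact ⟨Θ φ, fun x hx => by rw [hΘ, hχ1 x hx, mul_one]⟩

/-- A test function of a pair of points yields, by integration against a layer in the second point,
a test function of the first. -/
lemma exists_testFn_layer_sumSlice (hβ : LocallyIntegrable β μ)
    (η : 𝓓((⊤ : Opens (SpaceTime N × SpaceTime N)), ℝ)) (φ : TestFn N) :
    ∃ ψ : TestFn N, ∀ x, ψ x = layer μ β (sumSlice η φ x) := by
  have hval : ∀ x, layer μ β (sumSlice η φ x) = ∫ y, (η (x, y) * φ (x + y)) * β y ∂μ :=
    fun x => layer_apply hβ _
  have hK1 : IsCompact (Prod.fst '' tsupport η) := η.hasCompactSupport.isCompact.image continuous_fst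
  have hK2 : IsCompact (Prod.snd '' tsupport η) := η.hasCompactSupport.isCompact.image continuous_snd
  have hzero : ∀ x y, η (x, y) ≠ 0 → x ∈ Prod.fst '' tsupport η ∧ y ∈ Prod.snd '' tsupport η :=
    fun x y h => ⟨⟨_, subset_tsupport _ h, rfl⟩, ⟨_, subset_tsupport _ h, rfl⟩⟩
  let g : SpaceTime N → SpaceTime N → ℝ := fun x z => η (x, -z) * φ (x + -z)
  have hg : ContDiff ℝ (⊤ : ℕ∞) (Function.uncurry g) := by
    have h1 : ContDiff ℝ (⊤ : ℕ∞) η := η.contDiff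
    have h2 : ContDiff ℝ (⊤ : ℕ∞) φ := φ.contDiff
    have e1 : ContDiff ℝ (⊤ : ℕ∞) fun q : SpaceTime N × SpaceTime N => (q.1, -q.2) := by fun_prop
    have e2 : ContDiff ℝ (⊤ : ℕ∞) fun q : SpaceTime N × SpaceTime N => q.1 + -q.2 := by fun_prop
    exact (h1.comp e1).mul (h2.comp e2)
  have hsm := contDiffOn_convolution_right_with_param_comp (μ := μ) (n := ⊤)
    (ContinuousLinearMap.mul ℝ ℝ) (s := univ) (v := fun _ => (0 : SpaceTime N))
    contDiffOn_const (f := β) (g := g) isOpen_univ (hK2.neg)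
    (by
      intro p x _ hx
      by_contra hne
      exact hx (Set.mem_neg.2 (hzero _ _ (left_ne_zero_of_mul hne)).2)) hβ hg.contDiffOn
  rw [contDiffOn_univ] at hsm
  have heq : (fun x => ∫ y, (η (x, y) * φ (x + y)) * β y ∂μ) =
      fun x => convolution β (g x) (ContinuousLinearMap.mul ℝ ℝ) μ 0 := by
    funext x
    refine integral_congr_ae (Eventually.of_forall fun y => ?_)
    simp [g, mul_comm]
  refine ⟨⟨fun x => ∫ y, (η (x, y) * φ (x + y)) * β y ∂μ, heq ▸ hsm, ?_, fun _ _ => trivial⟩,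
    fun x => (hval x).symm⟩
  refine HasCompactSupport.of_support_subset_isCompact hK1 fun x hx => ?_
  by_contra hcon
  refine hx (integral_eq_zero_of_ae (Eventually.of_forall fun y => ?_))
  by_contra hne
  exact hcon (hzero _ _ (left_ne_zero_of_mul (left_ne_zero_of_mul hne))).1

/-- The convolution of a causal generalized function with a forward layer exists, and may be computed
with any test function that agrees with the translation integral near the forward cone. -/
theorem exists_causalConvolution {c : ℝ} (hc : 0 < c) {T : GenFn N} (hT : IsCausal c T)
    (hβ : IsForwardDensity μ β) : ∃ h : GenFn N, HasConvolution T (layer μ β) h ∧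
      ∀ φ θ : TestFn N, EqOn θ (translationIntegral μ β φ) (coneNhd N c) → h φ = T θ := by
  obtain ⟨χ, hχ, hχ1, hχs⟩ := exists_cone_cutoff (N := N) c hc
  obtain ⟨Θ, hΘ, hΘT⟩ := exists_causalConvolution_aux hc hχ hχs hβ
  obtain ⟨h, hh⟩ := hΘT T
  have hΘ1 : ∀ φ, EqOn (Θ φ) (translationIntegral μ β φ) (coneNhd N c) :=
    fun φ x hx => by rw [hΘ, hχ1 x hx, mul_one]
  refine ⟨h, fun φ η hη => ?_, fun φ θ hθ => ?_⟩
  · choose ψ hψ using fun k => exists_testFn_layer_sumSlice hβ.locallyIntegrable (η k) φ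
    refine ⟨ψ, hψ, ?_⟩
    obtain ⟨R, hR0, hR⟩ := hβ.support
    obtain ⟨r, hr0, hr⟩ := exists_support_bound φ
    -- a bounded set containing all relevant pairs of points
    set K : Set (SpaceTime N × SpaceTime N) :=
      Metric.closedBall 0 (max (c * (r + 1)) (r + 1)) ×ˢ Metric.closedBall 0 (max R (r + 1))
    have hK : IsCompact K := (isCompact_closedBall _ _).prod (isCompact_closedBall _ _)
    refine tendsto_const_nhds.congr' ?_
    filter_upwards [hη.1 K hK] with k hk
    rw [hh]
    refine hT.apply_congr hc fun x hx => ?_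
    rw [hΘ1 φ hx, hψ, layer_apply hβ.locallyIntegrable]
    refine integral_congr_ae ?_
    filter_upwards [hR] with y hy
    change φ (x + y) * β y = (η k (x, y) * φ (x + y)) * β y
    by_cases h0 : φ (x + y) * β y = 0
    · rw [mul_assoc, h0, mul_zero]
    · have h1 := hy (right_ne_zero_of_mul h0)
      have h3 : |(x + y).2| ≤ r := (norm_snd_le _).trans (hr _ (left_ne_zero_of_mul h0))
      have h4 := (abs_le.1 h3).2
      simp only [Prod.snd_add] at h4
      have hx' : ‖x.1‖ < c * (x.2 + 1) := hx
      have hx2 : -1 < x.2 := by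
        have := (norm_nonneg _).trans_lt hx'
        nlinarith
      rw [hk (x, y) ⟨?_, ?_⟩, one_mul]
      · rw [mem_closedBall_zero_iff, Prod.norm_def]
        refine max_le_max (by nlinarith) ?_
        rw [Real.norm_eq_abs, abs_le]
        constructor <;> linarith
      · rw [mem_closedBall_zero_iff, Prod.norm_def]
        refine max_le_max h1.1 ?_
        rw [Real.norm_eq_abs, abs_of_nonneg h1.2]
        linarith
  · rw [hh]
    exact hT.apply_congr hc ((hΘ1 φ).trans hθ.symm)

end CausalConvolution

/-! ### From the Green identity to the representation formula -/

section Representation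

variable {N : ℕ}

/-- The wave operator on test functions. -/
def waveTest (c : ℝ) (φ : TestFn N) : TestFn N :=
  (∑ j : Fin N, ∂_{spaceDir j} (∂_{spaceDir j} φ)) - (c ^ 2)⁻¹ • ∂_{timeDir N} (∂_{timeDir N} φ)

lemma genFn_lineDeriv_apply (T : GenFn N) (φ : TestFn N) (v : SpaceTime N) :
    (∂_{v} T) φ = -T (∂_{v} φ) := by
  rw [Distribution.lineDerivOp_apply_apply, map_neg]

lemma genFn_sum_apply {ι : Type*} (s : Finset ι) (T : ι → GenFn N) (φ : TestFn N) :
    (∑ j ∈ s, T j) φ = ∑ j ∈ s, T j φ := by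
  classical
  induction s using Finset.induction_on with
  | empty => simp
  | insert a s ha ih => rw [Finset.sum_insert ha, Finset.sum_insert ha, ← ih]; rfl

lemma testFn_sum_apply {ι : Type*} (s : Finset ι) (φ : ι → TestFn N) (x : SpaceTime N) :
    (∑ j ∈ s, φ j) x = ∑ j ∈ s, φ j x := by
  classical
  induction s using Finset.induction_on with
  | empty => rfl
  | insert a s ha ih => rw [Finset.sum_insert ha, Finset.sum_insert ha, ← ih]; rfl

lemma waveOp_apply (c : ℝ) (T : GenFn N) (φ : TestFn N) : waveOp c T φ = T (waveTest c φ) := by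
  unfold waveOp waveTest
  rw [map_sub, map_sum, map_smul]
  change (∑ j : Fin N, ∂_{spaceDir j} (∂_{spaceDir j} T)) φ -
    (c ^ 2)⁻¹ • (∂_{timeDir N} (∂_{timeDir N} T)) φ = _
  rw [genFn_sum_apply]
  simp only [genFn_lineDeriv_apply, neg_neg]

/-- The translate `y ↦ φ(x + y)`. -/
def testShift (φ : TestFn N) (x : SpaceTime N) : TestFn N where
  toFun y := φ (x + y)
  contDiff' := φ.contDiff.comp (contDiff_const.add contDiff_id)
  hasCompactSupport' := φ.hasCompactSupport.comp_homeomorph (Homeomorph.addLeft x)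
  tsupport_subset' := fun _ _ => trivial

lemma testShift_apply (φ : TestFn N) (x y : SpaceTime N) : testShift φ x y = φ (x + y) := rfl

lemma lineDeriv_testShift (φ : TestFn N) (x v : SpaceTime N) :
    ∂_{v} (testShift φ x) = testShift (∂_{v} φ) x := by
  ext y
  rw [testShift_apply, testFn_lineDeriv_apply, testFn_lineDeriv_apply]
  change fderiv ℝ (fun y => φ (x + y)) y v = _
  rw [fderiv_comp_add_left]

lemma waveTest_apply (c : ℝ) (φ : TestFn N) (x : SpaceTime N) :
    waveTest c φ x = (∑ j : Fin N, (∂_{spaceDir j} (∂_{spaceDir j} φ)) x) -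
      (c ^ 2)⁻¹ * (∂_{timeDir N} (∂_{timeDir N} φ)) x := by
  unfold waveTest
  change (∑ j : Fin N, ∂_{spaceDir j} (∂_{spaceDir j} φ)) x - (c ^ 2)⁻¹ * _ = _
  rw [testFn_sum_apply]

lemma IsGreenFunction.isCausal {c : ℝ} {U : GenFn N} (hU : IsGreenFunction c U) : IsCausal c U :=
  fun φ hφ => hU.radiation φ fun _ hp => Or.inr (hφ hp)

lemma IsCausal.lineDeriv {c : ℝ} {T : GenFn N} (hT : IsCausal c T) (v : SpaceTime N) :
    IsCausal c (∂_{v} T) := by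
  intro φ hφ
  rw [genFn_lineDeriv_apply, hT _ (subset_trans ?_ hφ), neg_zero]
  refine closure_minimal (fun p hp => ?_) (isClosed_tsupport _)
  by_contra hcon
  refine hp ?_
  rw [testFn_lineDeriv_apply, (notMem_tsupport_iff_eventuallyEq.1 hcon).fderiv_eq]
  simp

section

variable {μ : Measure (SpaceTime N)} {β : SpaceTime N → ℝ}

/-- Translation commutes with differentiation, on the open set where `θ` represents the translation
integral. -/
lemma translationIntegral_lineDeriv_eqOn (hβ : LocallyIntegrable β μ) {φ θ : TestFn N} {c : ℝ}
    (h : EqOn θ (translationIntegral μ β φ) (coneNhd N c)) (v : SpaceTime N) :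
    EqOn (∂_{v} θ : TestFn N) (translationIntegral μ β (∂_{v} φ : TestFn N)) (coneNhd N c) := by
  intro x hx
  rw [testFn_lineDeriv_apply, ← fderiv_translationIntegral hβ]
  have : θ =ᶠ[𝓝 x] translationIntegral μ β φ := by
    filter_upwards [(isOpen_coneNhd c).mem_nhds hx] with y hy using h hy
  rw [this.fderiv_eq]

end

lemma integral_pointTimes (f : SpaceTime N → ℝ) (hf : Continuous f) :
    ∫ p, f p ∂(pointTimes N) = ∫ s in Ici (0 : ℝ), f (0, s) := by
  unfold pointTimes
  rw [Measure.dirac_prod, integral_map (by fun_prop) hf.aestronglyMeasurable]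

lemma locallyIntegrable_pointTimes : LocallyIntegrable (fun _ => (1 : ℝ)) (pointTimes N) := by
  unfold pointTimes
  exact locallyIntegrable_const 1

lemma isForwardDensity_pointTimes : IsForwardDensity (pointTimes N) (fun _ => (1 : ℝ)) := by
  refine ⟨locallyIntegrable_pointTimes, 0, le_rfl, ?_⟩
  unfold pointTimes
  rw [Measure.dirac_prod]
  refine (ae_map_iff (by fun_prop) ?_).2 ?_
  · have h1 : IsClosed {x : SpaceTime N | ‖x.1‖ ≤ 0} := isClosed_le (by fun_prop) (by fun_prop)
    have h2 : IsClosed {x : SpaceTime N | 0 ≤ x.2} := isClosed_le (by fun_prop) (by fun_prop)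
    have h3 := (h1.inter h2).measurableSet
    simp only [ne_eq, one_ne_zero, not_false_eq_true, forall_const]
    exact h3
  · filter_upwards [ae_restrict_mem measurableSet_Ici] with s hs
    intro _
    simpa using hs

/-- Integration over forward time inverts the time derivative of a test function. -/
lemma translationIntegral_pointTimes_timeDir (φ : TestFn N) (x : SpaceTime N) :
    translationIntegral (pointTimes N) (fun _ => 1) (∂_{timeDir N} φ : TestFn N) x = -φ x := by
  unfold translationIntegral
  rw [integral_pointTimes _ (by fun_prop)]
  simp only [mul_one]
  rw [integral_Ici_eq_integral_Ioi]
  have hd : ∀ s : ℝ, HasDerivAt (fun s : ℝ => φ (x + (0, s)))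
      ((∂_{timeDir N} φ : TestFn N) (x + (0, s))) s := by
    intro s
    rw [testFn_lineDeriv_apply]
    have h1 : HasFDerivAt φ (fderiv ℝ φ (x + (0, s))) (x + (0, s)) :=
      ((φ.contDiff.differentiable (by simp)) _).hasFDerivAt
    have h2 : HasDerivAt (fun s : ℝ => x + ((0 : Space N), s)) (timeDir N) s :=
      ((hasDerivAt_const s (0 : Space N)).prodMk (hasDerivAt_id s)).const_add x
    exact h1.comp_hasDerivAt s h2
  have hcs : HasCompactSupport fun s : ℝ => φ (x + (0, s)) := by
    refine φ.hasCompactSupport.comp_isClosedEmbedding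
      (g := fun s : ℝ => x + ((0 : Space N), s)) ?_
    exact (Homeomorph.addLeft x).isClosedEmbedding.comp
      (Isometry.isClosedEmbedding (f := fun s : ℝ => ((0 : Space N), s))
        (Isometry.of_dist_eq fun a b => by simp [Prod.dist_eq]))
  have hc1 : ContDiff ℝ 1 fun s : ℝ => φ (x + (0, s)) := by
    have h1 : ContDiff ℝ 1 φ := φ.contDiff.of_le (by exact_mod_cast le_top)
    have e : ContDiff ℝ 1 fun s : ℝ => x + ((0 : Space N), s) := by fun_prop
    exact h1.comp e
  have := hcs.integral_Ioi_deriv_eq hc1 0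
  rw [← Prod.zero_eq_mk, add_zero] at this
  rw [← this]
  exact integral_congr_ae (Eventually.of_forall fun s => (hd s).deriv.symm)

lemma two_le_infty : (1 + 1 : WithTop ℕ∞) ≤ ((⊤ : ℕ∞) : WithTop ℕ∞) := by
  have h : ((1 + 1 : ℕ∞) : WithTop ℕ∞) ≤ ((⊤ : ℕ∞) : WithTop ℕ∞) := WithTop.coe_le_coe.2 le_top
  exact h

lemma lineDeriv_comm (φ : TestFn N) (v w : SpaceTime N) :
    ∂_{v} (∂_{w} φ) = ∂_{w} (∂_{v} φ) := by
  have key : ∀ (v w x : SpaceTime N), (∂_{v} (∂_{w} φ) : TestFn N) x =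
      fderiv ℝ (fderiv ℝ φ) x v w := by
    intro v w x
    rw [testFn_lineDeriv_apply]
    have h1 : ((∂_{w} φ : TestFn N) : SpaceTime N → ℝ) = fun y => fderiv ℝ φ y w :=
      funext fun y => testFn_lineDeriv_apply φ w y
    have h2 : DifferentiableAt ℝ (fderiv ℝ φ) x :=
      ((φ.contDiff.fderiv_right (m := 1) two_le_infty).differentiable one_ne_zero) x
    rw [h1]
    rw [(h2.hasFDerivAt.clm_apply (hasFDerivAt_const w x)).fderiv]
    simp
  ext x
  rw [key, key]
  exact (φ.contDiff.contDiffAt.isSymmSndFDerivAt (by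
    rw [minSmoothness_of_isRCLikeNormedField]
    rw [← one_add_one_eq_two]
    exact two_le_infty)) v w

/-- The convolution of a causal generalized function with `δ(x) H(t)` is causal. -/
lemma isCausal_of_pointTimes {c : ℝ} (hc : 0 < c) {U W : GenFn N} (hU : IsCausal c U)
    (hW : ∀ φ θ : TestFn N, EqOn θ (translationIntegral (pointTimes N) (fun _ => 1) φ)
      (coneNhd N c) → W φ = U θ) : IsCausal c W := by
  intro φ hφ
  obtain ⟨θ, hθ⟩ := exists_testFn_translationIntegral hc (isForwardDensity_pointTimes (N := N)) φ
  rw [hW φ θ hθ]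
  have hcone : IsClosed {p : SpaceTime N | ‖p.1‖ ≤ c * p.2} :=
    isClosed_le (by fun_prop) (by fun_prop)
  obtain ⟨δ, hδ, hdis⟩ := (Set.disjoint_left.2 fun p hp hp' => by
      exact absurd (show c * p.2 < ‖p.1‖ from hφ hp) (not_lt.2 hp') : Disjoint (tsupport φ)
        {p : SpaceTime N | ‖p.1‖ ≤ c * p.2}).exists_thickenings φ.hasCompactSupport.isCompact hcone
  refine hU θ fun p hp => ?_
  by_contra hcon
  have hcon' : ‖p.1‖ ≤ c * p.2 := not_lt.1 hcon
  refine notMem_tsupport_iff_eventuallyEq.2 ?_ hp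
  have hmem : p ∈ coneNhd N c := by
    change ‖p.1‖ < _
    nlinarith
  filter_upwards [(isOpen_coneNhd c).mem_nhds hmem, Metric.ball_mem_nhds p hδ] with q hq hq'
  rw [hθ hq]
  unfold translationIntegral
  rw [integral_pointTimes _ (by fun_prop)]
  refine (setIntegral_congr_fun measurableSet_Ici fun s hs => ?_).trans (integral_zero _ _)
  -- forward shifts of the cone stay in the cone, hence away from the support of `φ`
  have h1 : q + (0, s) ∈ Metric.thickening δ {p : SpaceTime N | ‖p.1‖ ≤ c * p.2} := by
    refine Metric.mem_thickening_iff.2 ⟨p + (0, s), ?_, ?_⟩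
    · have hs' : (0 : ℝ) ≤ s := hs
      change ‖(p + (0, s)).1‖ ≤ c * (p + (0, s)).2
      simp only [Prod.fst_add, add_zero, Prod.snd_add]
      nlinarith
    · simpa using hq'
  have h2 : φ (q + (0, s)) = 0 := by
    by_contra hne
    exact Set.disjoint_left.1 hdis
      (Metric.self_subset_thickening hδ _ (subset_tsupport _ hne)) h1
  simp [h2]

/-- The algebraic half of the representation formula. If the wave operator applied to the layer of
density `û` is a sum of layers, tested in `green`, and the layers of densities `d j` have the time
derivatives tested in `parts`, then convolution with the Green function recovers `û`. -/
theorem representation_of_green {c : ℝ} (hc : 0 < c) {U : GenFn N} (hU : IsGreenFunction c U)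
    {μ μ₀ μi μv : Measure (SpaceTime N)} {f g a q₀ q₁ : SpaceTime N → ℝ}
    {b d e : Fin N → SpaceTime N → ℝ}
    (hf : IsForwardDensity μv f) (hg : IsForwardDensity μv g) (ha : IsForwardDensity μ a)
    (hb : ∀ j, IsForwardDensity μ (b j)) (hd : ∀ j, IsForwardDensity μ (d j))
    (he : ∀ j, IsForwardDensity μ₀ (e j)) (hq₀ : IsForwardDensity μi q₀)
    (hq₁ : IsForwardDensity μi q₁)
    (green : ∀ φ : TestFn N, layer μv f (waveTest c φ) = layer μv g φ - layer μ a φ +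
      (∑ j, layer μ (d j) (∂_{spaceDir j} φ)) + (c ^ 2)⁻¹ * layer μi q₀ (∂_{timeDir N} φ) -
      (c ^ 2)⁻¹ * layer μi q₁ φ)
    (parts : ∀ j, ∀ φ : TestFn N, layer μ (b j) φ + layer μ₀ (e j) φ =
      -layer μ (d j) (∂_{timeDir N} φ)) :
    ∃ (W A : GenFn N) (B C : Fin N → GenFn N) (D E K : GenFn N),
      HasConvolution U (layer (pointTimes N) fun _ => 1) W ∧
      HasConvolution U (layer μ a) A ∧
      (∀ j, HasConvolution (∂_{spaceDir j} W) (layer μ (b j)) (B j)) ∧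
      (∀ j, HasConvolution (∂_{spaceDir j} W) (layer μ₀ (e j)) (C j)) ∧
      HasConvolution U (layer μi q₁) D ∧
      HasConvolution U (layer μi q₀) E ∧
      HasConvolution U (layer μv g) K ∧
      layer μv f =
        -A - (∑ j, B j) - (∑ j, C j) - (c ^ 2)⁻¹ • D - (c ^ 2)⁻¹ • ∂_{timeDir N} E + K := by
  have hUc := hU.isCausal
  obtain ⟨W, hW, hW'⟩ := exists_causalConvolution hc hUc (isForwardDensity_pointTimes (N := N))
  have hWc : IsCausal c W := isCausal_of_pointTimes hc hUc hW'
  obtain ⟨A, hA, hA'⟩ := exists_causalConvolution hc hUc ha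
  choose B hB hB' using fun j => exists_causalConvolution hc (hWc.lineDeriv (spaceDir j)) (hb j)
  choose C hC hC' using fun j => exists_causalConvolution hc (hWc.lineDeriv (spaceDir j)) (he j)
  obtain ⟨D, hD, hD'⟩ := exists_causalConvolution hc hUc hq₁
  obtain ⟨E, hE, hE'⟩ := exists_causalConvolution hc hUc hq₀
  obtain ⟨K, hK, hK'⟩ := exists_causalConvolution hc hUc hg
  refine ⟨W, A, B, C, D, E, K, hW, hA, hB, hC, hD, hE, hK, ?_⟩
  ext φ
  have htrans : ∀ {ν : Measure (SpaceTime N)} {β : SpaceTime N → ℝ}, IsForwardDensity ν β →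
      ∀ (ψ : TestFn N) x, translationIntegral ν β ψ x = layer ν β (testShift ψ x) :=
    fun hβ ψ x => (layer_apply hβ.locallyIntegrable (testShift ψ x)).symm
  obtain ⟨θA, hθA⟩ := exists_testFn_translationIntegral hc ha φ
  choose θB hθB using fun j => exists_testFn_translationIntegral hc (hb j) φ
  choose θC hθC using fun j => exists_testFn_translationIntegral hc (he j) φ
  choose θd hθd using fun j => exists_testFn_translationIntegral hc (hd j) φ
  obtain ⟨θD, hθD⟩ := exists_testFn_translationIntegral hc hq₁ φ
  obtain ⟨θE, hθE⟩ := exists_testFn_translationIntegral hc hq₀ (∂_{timeDir N} φ)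
  obtain ⟨θK, hθK⟩ := exists_testFn_translationIntegral hc hg φ
  obtain ⟨θf, hθf⟩ := exists_testFn_translationIntegral hc hf φ
  -- the two lateral layers add up to a time derivative, which integration over forward time, and
  -- thus the convolution with `W`, turns into a convolution with `U`
  have hBC : ∀ j, B j φ + C j φ = -U (∂_{spaceDir j} (θd j)) := by
    intro j
    rw [hB' j φ _ (hθB j), hC' j φ _ (hθC j), ← map_add, genFn_lineDeriv_apply]
    have h1 : EqOn (θB j + θC j : TestFn N) (-∂_{timeDir N} (θd j) : TestFn N) (coneNhd N c) := by
      intro x hx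
      change θB j x + θC j x = -(∂_{timeDir N} (θd j) : TestFn N) x
      rw [hθB j hx, hθC j hx, htrans (hb j), htrans (he j), parts,
        translationIntegral_lineDeriv_eqOn (hd j).locallyIntegrable (hθd j) _ hx, htrans (hd j),
        lineDeriv_testShift]
    have h2 : EqOn (∂_{spaceDir j} (θB j + θC j) : TestFn N)
        (-∂_{timeDir N} (∂_{spaceDir j} (θd j)) : TestFn N) (coneNhd N c) := by
      intro x hx
      rw [testFn_lineDeriv_apply]
      have : (θB j + θC j : TestFn N) =ᶠ[𝓝 x] (-∂_{timeDir N} (θd j) : TestFn N) := by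
        filter_upwards [(isOpen_coneNhd c).mem_nhds hx] with y hy using h1 hy
      rw [this.fderiv_eq, ← testFn_lineDeriv_apply]
      rw [LineDeriv.lineDerivOp_neg, lineDeriv_comm]
    rw [hWc.apply_congr hc h2, map_neg, neg_neg]
    rw [hW' _ (-∂_{spaceDir j} (θd j)) fun x _ => ?_, map_neg]
    rw [translationIntegral_pointTimes_timeDir]
    rfl
  have hEt : (∂_{timeDir N} E) φ = -U θE := by
    rw [genFn_lineDeriv_apply, hE' _ _ hθE]
  -- the Green identity for all translates of `φ` near the forward cone
  have hmain : U (waveTest c θf) = U (θK - θA + (∑ j, ∂_{spaceDir j} (θd j)) +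
      (c ^ 2)⁻¹ • θE - (c ^ 2)⁻¹ • θD) := by
    refine hUc.apply_congr hc fun x hx => ?_
    have e1 : ∀ v : SpaceTime N, EqOn (∂_{v} (∂_{v} θf) : TestFn N)
        (translationIntegral μv f (∂_{v} (∂_{v} φ) : TestFn N)) (coneNhd N c) := fun v =>
      translationIntegral_lineDeriv_eqOn hf.locallyIntegrable
        (translationIntegral_lineDeriv_eqOn hf.locallyIntegrable hθf v) v
    have e2 : waveTest c θf x = layer μv f (waveTest c (testShift φ x)) := by
      rw [waveTest_apply, e1 _ hx]
      unfold waveTest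
      rw [map_sub, map_sum, map_smul, smul_eq_mul]
      simp only [lineDeriv_testShift]
      rw [htrans hf]
      congr 1
      refine Finset.sum_congr rfl fun j _ => ?_
      rw [e1 _ hx, htrans hf]
    rw [e2, green]
    change _ = θK x - θA x + (∑ j, ∂_{spaceDir j} (θd j) : TestFn N) x + (c ^ 2)⁻¹ * θE x -
      (c ^ 2)⁻¹ * θD x
    rw [testFn_sum_apply, hθK hx, hθA hx, hθE hx, hθD hx, htrans hg, htrans ha, htrans hq₀,
      htrans hq₁]
    simp only [lineDeriv_testShift]
    congr 3
    refine Finset.sum_congr rfl fun j _ => ?_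
    rw [translationIntegral_lineDeriv_eqOn (hd j).locallyIntegrable (hθd j) _ hx, htrans (hd j)]
  -- `□ U = δ` evaluates the translation integral at the origin
  have h0 : U (waveTest c θf) = layer μv f φ := by
    have h00 : (0 : SpaceTime N) ∈ coneNhd N c := by
      change ‖(0 : Space N)‖ < c * ((0 : ℝ) + 1)
      rw [norm_zero, zero_add, mul_one]
      exact hc
    have h01 : waveOp c U θf = θf 0 := by rw [hU.equation]; rfl
    rw [← waveOp_apply, h01, hθf h00, htrans hf]
    congr 1
    ext y
    rw [testShift_apply, zero_add]
  change layer μv f φ = -A φ - (∑ j, B j) φ - (∑ j, C j) φ - (c ^ 2)⁻¹ * D φ -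
    (c ^ 2)⁻¹ * (∂_{timeDir N} E) φ + K φ
  have hlin : U (θK - θA + (∑ j, ∂_{spaceDir j} (θd j)) + (c ^ 2)⁻¹ • θE - (c ^ 2)⁻¹ • θD) =
      U θK - U θA + (∑ j, U (∂_{spaceDir j} (θd j))) + (c ^ 2)⁻¹ * U θE - (c ^ 2)⁻¹ * U θD := by
    rw [map_sub, map_add, map_add, map_sub, map_sum, map_smul, map_smul]
    rfl
  rw [← h0, hmain, hlin, genFn_sum_apply, genFn_sum_apply, hEt, hA' φ _ hθA, hD' φ _ hθD,
    hK' φ _ hθK]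
  have : ∑ j, U (∂_{spaceDir j} (θd j)) = -(∑ j, B j φ) - ∑ j, C j φ := by
    rw [← Finset.sum_neg_distrib, ← Finset.sum_sub_distrib]
    refine Finset.sum_congr rfl fun j _ => ?_
    linarith [hBC j]
  rw [this]
  ring

end Representation

/-! ### Cutoffs that concentrate on a graph -/

section GraphLayer

variable {H : Type*} [MeasurableSpace H]

lemma exists_cutoff : ∃ κ : ℝ → ℝ, ContDiff ℝ 1 κ ∧ κ 0 = 1 ∧ (∀ s, 0 ≤ κ s ∧ κ s ≤ 1) ∧
    (∀ s, 1 ≤ |s| → κ s = 0) ∧ ∀ᶠ s in 𝓝 0, κ s = 1 := by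
  let b : ContDiffBump (0 : ℝ) := ⟨1 / 2, 1, by norm_num, by norm_num⟩
  refine ⟨b, b.contDiff, b.one_of_mem_closedBall (by simp [b]),
    fun s => ⟨b.nonneg, b.le_one⟩, fun s hs => b.zero_of_le_dist (by simpa [b] using hs), ?_⟩
  filter_upwards [Metric.closedBall_mem_nhds (0 : ℝ) (show (0 : ℝ) < 1 / 2 by norm_num)] with s hs
  exact b.one_of_mem_closedBall hs

/-- The rescaled shear `(y, σ) ↦ (y, γ y + σ / a)`. -/
def graphScaling (γ : H → ℝ) (hγ : Measurable γ) (a : ℝ) (ha : a ≠ 0) : H × ℝ ≃ᵐ H × ℝ where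
  toFun q := (q.1, γ q.1 + a⁻¹ * q.2)
  invFun q := (q.1, a * (q.2 - γ q.1))
  left_inv q := by ext <;> simp [ha]
  right_inv q := by ext <;> simp [ha]
  measurable_toFun := by
    change Measurable fun q : H × ℝ => (q.1, γ q.1 + a⁻¹ * q.2)
    fun_prop
  measurable_invFun := by
    change Measurable fun q : H × ℝ => (q.1, a * (q.2 - γ q.1))
    fun_prop

lemma map_graphScaling (μ : Measure H) [SFinite μ] {γ : H → ℝ} (hγ : Measurable γ) {a : ℝ}
    (ha : 0 < a) : (μ.prod volume).map (graphScaling γ hγ a ha.ne') =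
      ENNReal.ofReal a • μ.prod (volume : Measure ℝ) := by
  have h1 : (μ.prod volume).map (Prod.map id (a⁻¹ * ·)) =
      ENNReal.ofReal a • μ.prod (volume : Measure ℝ) := by
    rw [← Measure.map_prod_map _ _ measurable_id (measurable_const_mul _), Measure.map_id,
      Real.map_volume_mul_left (inv_ne_zero ha.ne'), Measure.prod_smul_right, inv_inv,
      abs_of_pos ha]
  have h2 : MeasurePreserving (fun q : H × ℝ => (q.1, γ q.1 + q.2)) (μ.prod volume)
      (μ.prod volume) :=
    (MeasurePreserving.id μ).skew_product (g := fun y t => γ y + t) (by fun_prop)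
      (Eventually.of_forall fun y => map_add_left_eq_self volume (γ y))
  have h3 : (graphScaling γ hγ a ha.ne' : H × ℝ → H × ℝ) =
      (fun q : H × ℝ => (q.1, γ q.1 + q.2)) ∘ Prod.map id (a⁻¹ * ·) := rfl
  rw [h3, ← Measure.map_map h2.measurable (by fun_prop), h1, Measure.map_smul, h2.map_eq]

lemma quasiMeasurePreserving_graphScaling (μ : Measure H) [SFinite μ] {γ : H → ℝ}
    (hγ : Measurable γ) {a : ℝ} (ha : 0 < a) :
    Measure.QuasiMeasurePreserving (graphScaling γ hγ a ha.ne') (μ.prod volume)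
      (μ.prod volume) := by
  refine ⟨(graphScaling γ hγ a ha.ne').measurable, ?_⟩
  rw [map_graphScaling μ hγ ha]
  exact Measure.smul_absolutelyContinuous

lemma integral_graphScaling (μ : Measure H) [SFinite μ] {γ : H → ℝ} (hγ : Measurable γ) {a : ℝ}
    (ha : 0 < a) (f : H × ℝ → ℝ) :
    ∫ p, f p * a ∂(μ.prod volume) = ∫ q, f (q.1, γ q.1 + a⁻¹ * q.2) ∂(μ.prod volume) := by
  have h := integral_map_equiv (μ := μ.prod volume) (graphScaling γ hγ a ha.ne') f
  rw [map_graphScaling μ hγ ha, integral_smul_measure, ENNReal.toReal_ofReal ha.le, smul_eq_mul] at h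
  rw [integral_mul_const, mul_comm, h]
  rfl

lemma measure_graph_eq_zero (μ : Measure H) [SFinite μ] {γ : H → ℝ} (hγ : Measurable γ) :
    (μ.prod volume) {q : H × ℝ | q.2 = γ q.1} = 0 := by
  have hs : MeasurableSet {q : H × ℝ | q.2 = γ q.1} :=
    measurableSet_eq_fun measurable_snd (hγ.comp measurable_fst)
  rw [Measure.measure_prod_null hs]
  refine Eventually.of_forall fun y => ?_
  change volume ({γ y} : Set ℝ) = 0
  simp

/-- A bounded function integrated against the derivative of a cutoff that concentrates on the graph
of `γ` yields in the limit the integral of its jump across the graph. The one-sided limits are only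
taken off a null set `W`. -/
theorem tendsto_integral_graph_cutoff {μ : Measure H} [SFinite μ] {γ : H → ℝ} (hγ : Measurable γ)
    {F : H × ℝ → ℝ} (hF : AEStronglyMeasurable F (μ.prod volume)) {M : ℝ}
    (hM : ∀ᵐ p ∂(μ.prod volume), |F p| ≤ M) {B : Set H} (hB : MeasurableSet B) (hμB : μ B ≠ ⊤)
    (hFB : ∀ p : H × ℝ, p.1 ∉ B → F p = 0) {W : Set (H × ℝ)} (hW : (μ.prod volume) W = 0)
    {Fp Fm : H → ℝ}
    (hp : ∀ᵐ y ∂μ, Tendsto (fun s => F (y, γ y + s)) (𝓝[{s | 0 < s ∧ (y, γ y + s) ∉ W}] 0)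
      (𝓝 (Fp y)))
    (hm : ∀ᵐ y ∂μ, Tendsto (fun s => F (y, γ y + s)) (𝓝[{s | s < 0 ∧ (y, γ y + s) ∉ W}] 0)
      (𝓝 (Fm y)))
    {κ : ℝ → ℝ} (hκ : ContDiff ℝ 1 κ) (hκ0 : κ 0 = 1) (hκs : ∀ s, 1 ≤ |s| → κ s = 0) :
    Tendsto (fun k : ℕ => ∫ p, F p * (deriv κ (((k : ℝ) + 1) * (p.2 - γ p.1)) * ((k : ℝ) + 1))
      ∂(μ.prod volume)) atTop (𝓝 (∫ y, (Fm y - Fp y) ∂μ)) := by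
  have hκc : HasCompactSupport κ := by
    refine HasCompactSupport.of_support_subset_isCompact (isCompact_Icc (a := (-1 : ℝ)) (b := 1)) ?_
    intro s hs
    by_contra hcon
    refine hs (hκs s ?_)
    rw [mem_Icc, ← abs_le, not_le] at hcon
    exact hcon.le
  have hdc : Continuous (deriv κ) := hκ.continuous_deriv le_rfl
  have hdi : Integrable (deriv κ) := hdc.integrable_of_hasCompactSupport hκc.deriv
  have hIoi : ∫ s in Ioi (0 : ℝ), deriv κ s = -1 := by
    rw [hκc.integral_Ioi_deriv_eq hκ, hκ0]
  have hIio : ∫ s in Iio (0 : ℝ), deriv κ s = 1 := by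
    rw [← integral_Iic_eq_integral_Iio, hκc.integral_Iic_deriv_eq hκ, hκ0]
  have hk : ∀ k : ℕ, (0 : ℝ) < (k : ℝ) + 1 := fun k => by positivity
  set P := μ.prod (volume : Measure ℝ)
  let f : ℕ → H × ℝ → ℝ := fun k q => F (q.1, γ q.1 + ((k : ℝ) + 1)⁻¹ * q.2) * deriv κ q.2
  have hint : ∀ k : ℕ, ∫ p, F p * (deriv κ (((k : ℝ) + 1) * (p.2 - γ p.1)) * ((k : ℝ) + 1)) ∂P =
      ∫ q, f k q ∂P := by
    intro k
    have h := integral_graphScaling μ hγ (hk k)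
      (fun p => F p * deriv κ (((k : ℝ) + 1) * (p.2 - γ p.1)))
    simp only [mul_assoc] at h
    rw [h]
    refine integral_congr_ae (Eventually.of_forall fun q => ?_)
    have : ((k : ℝ) + 1) * (γ q.1 + ((k : ℝ) + 1)⁻¹ * q.2 - γ q.1) = q.2 := by
      rw [add_sub_cancel_left, ← mul_assoc, mul_inv_cancel₀ (hk k).ne', one_mul]
    simp only [this, f]
  simp only [hint]
  let g : H × ℝ → ℝ := fun q => (if 0 < q.2 then Fp q.1 else Fm q.1) * deriv κ q.2
  have hfm : ∀ k, AEStronglyMeasurable (f k) P := fun k =>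
    (hF.comp_quasiMeasurePreserving (quasiMeasurePreserving_graphScaling μ hγ (hk k))).mul
      (hdc.measurable.comp measurable_snd).aestronglyMeasurable
  let bound : H × ℝ → ℝ := fun q => (B.indicator (fun _ => M) q.1) * |deriv κ q.2|
  have hbi : Integrable bound P :=
    Integrable.mul_prod (f := B.indicator fun _ => M) (g := fun s => |deriv κ s|)
      ((integrable_indicator_iff hB).2 (integrableOn_const hμB)) hdi.abs
  have hfb : ∀ k, ∀ᵐ q ∂P, ‖f k q‖ ≤ bound q := by
    intro k
    filter_upwards [(quasiMeasurePreserving_graphScaling μ hγ (hk k)).ae hM] with q hq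
    rw [Real.norm_eq_abs, abs_mul]
    refine mul_le_mul_of_nonneg_right ?_ (abs_nonneg _)
    by_cases hqB : q.1 ∈ B
    · rw [indicator_of_mem hqB]
      exact hq
    · have h0 := hFB (q.1, γ q.1 + ((k : ℝ) + 1)⁻¹ * q.2) hqB
      rw [indicator_of_notMem hqB]
      change |F (q.1, γ q.1 + ((k : ℝ) + 1)⁻¹ * q.2)| ≤ 0
      rw [h0, abs_zero]
  have hlim : ∀ᵐ q ∂P, Tendsto (fun k => f k q) atTop (𝓝 (g q)) := by
    have hoff : ∀ᵐ q ∂P, ∀ k : ℕ, (q.1, γ q.1 + ((k : ℝ) + 1)⁻¹ * q.2) ∉ W := by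
      rw [ae_all_iff]
      intro k
      exact (quasiMeasurePreserving_graphScaling μ hγ (hk k)).ae (measure_eq_zero_iff_ae_notMem.1 hW)
    have hne : ∀ᵐ q ∂P, q.2 ≠ 0 :=
      Measure.quasiMeasurePreserving_snd.ae (Measure.ae_ne volume (0 : ℝ))
    have hp' : ∀ᵐ q ∂P, _ := Measure.quasiMeasurePreserving_fst.ae hp
    have hm' : ∀ᵐ q ∂P, _ := Measure.quasiMeasurePreserving_fst.ae hm
    filter_upwards [hoff, hne, hp', hm'] with q h1 h2 h3 h4
    refine Tendsto.mul_const _ ?_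
    have hz : Tendsto (fun k : ℕ => ((k : ℝ) + 1)⁻¹ * q.2) atTop (𝓝 0) := by
      have := (tendsto_one_div_add_atTop_nhds_zero_nat (𝕜 := ℝ)).mul_const q.2
      simpa [one_div] using this
    rcases lt_or_gt_of_ne h2 with hneg | hpos
    · rw [if_neg (not_lt.2 hneg.le)]
      refine h4.comp (tendsto_nhdsWithin_iff.2 ⟨hz, Eventually.of_forall fun k => ⟨?_, h1 k⟩⟩)
      exact mul_neg_of_pos_of_neg (inv_pos.2 (hk k)) hneg
    · rw [if_pos hpos]
      refine h3.comp (tendsto_nhdsWithin_iff.2 ⟨hz, Eventually.of_forall fun k => ⟨?_, h1 k⟩⟩)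
      exact mul_pos (inv_pos.2 (hk k)) hpos
  have hDCT := tendsto_integral_of_dominated_convergence bound hfm hbi hfb hlim
  have hgm : AEStronglyMeasurable g P := aestronglyMeasurable_of_tendsto_ae atTop hfm hlim
  have hgi : Integrable g P := by
    refine hbi.mono' hgm ?_
    have hall : ∀ᵐ q ∂P, ∀ k, ‖f k q‖ ≤ bound q := ae_all_iff.2 hfb
    filter_upwards [hall, hlim] with q h1 h2
    exact le_of_tendsto h2.norm (Eventually.of_forall h1)
  have hval : ∫ q, g q ∂P = ∫ y, (Fm y - Fp y) ∂μ := by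
    rw [integral_prod g hgi]
    refine integral_congr_ae (Eventually.of_forall fun y => ?_)
    change ∫ s, (if 0 < s then Fp y else Fm y) * deriv κ s = _
    have hi : Integrable fun s => (if 0 < s then Fp y else Fm y) * deriv κ s := by
      refine (hdi.norm.const_mul (max |Fp y| |Fm y|)).mono' ?_ (Eventually.of_forall fun s => ?_)
      · exact ((Measurable.ite measurableSet_Ioi measurable_const measurable_const).mul
          hdc.measurable).aestronglyMeasurable
      · rw [norm_mul]
        refine mul_le_mul_of_nonneg_right ?_ (norm_nonneg _)
        split_ifs
        · exact le_max_left _ _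
        · exact le_max_right _ _
    rw [← integral_add_compl measurableSet_Ioi hi (s := Ioi (0 : ℝ)), compl_Ioi,
      integral_Iic_eq_integral_Iio,
      setIntegral_congr_fun (g := fun s => Fp y * deriv κ s) measurableSet_Ioi
        (fun s hs => by simp [mem_Ioi.1 hs]),
      setIntegral_congr_fun (g := fun s => Fm y * deriv κ s) measurableSet_Iio
        (fun s hs => by simp [(mem_Iio.1 hs).le]),
      integral_const_mul, integral_const_mul, hIoi, hIio]
    ring
  rw [← hval]
  exact hDCT

end GraphLayer

/-! ### Hypersurfaces as graphs -/

section ImplicitGraph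

variable {H : Type*} [NormedAddCommGroup H] [NormedSpace ℝ H]

/-- Near a point at which `g` increases along the last axis, the zero set of `g` is a `C¹` graph, with
`g` negative below and positive above it. -/
theorem exists_implicit_graph [CompleteSpace H] {g : H × ℝ → ℝ} {V : Set (H × ℝ)} (hV : IsOpen V)
    (hg : ContDiffOn ℝ 1 g V) {u : H × ℝ} (hu : u ∈ V) (h0 : g u = 0)
    (hd : 0 < fderiv ℝ g u (0, 1)) :
    ∃ (γ : H → ℝ) (ρ r : ℝ), 0 < ρ ∧ 0 < r ∧ ContDiffOn ℝ 1 γ (Metric.ball u.1 ρ) ∧ γ u.1 = u.2 ∧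
      (∀ y ∈ Metric.ball u.1 ρ, γ y ∈ Metric.ball u.2 r) ∧
      Metric.ball u.1 ρ ×ˢ Metric.ball u.2 r ⊆ V ∧
      ∀ y ∈ Metric.ball u.1 ρ, ∀ t ∈ Metric.ball u.2 r,
        (g (y, t) < 0 ↔ t < γ y) ∧ (0 < g (y, t) ↔ γ y < t) := by
  have hgu : ContDiffAt ℝ 1 g u := hg.contDiffAt (hV.mem_nhds hu)
  have hinv : (fderiv ℝ g u ∘L .inr ℝ H ℝ).IsInvertible := by
    refine ⟨ContinuousLinearEquiv.unitsEquivAut ℝ (Units.mk0 _ hd.ne'), ?_⟩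
    ext
    simp
  set γ := hgu.implicitFunction one_ne_zero hinv
  have hγ0 : γ u.1 = u.2 := hgu.implicitFunction_apply_self one_ne_zero hinv
  have hγc : ContDiffAt ℝ 1 γ u.1 := hgu.contDiffAt_implicitFunction one_ne_zero hinv
  have hγg : ∀ᶠ y in 𝓝 u.1, g (y, γ y) = 0 := by
    simpa only [h0] using hgu.eventually_apply_implicitFunction one_ne_zero hinv
  have hcont : ContinuousOn (fun p => fderiv ℝ g p (0, 1)) V :=
    (hg.continuousOn_fderiv_of_isOpen hV le_rfl).clm_apply continuousOn_const
  have hnear : ∀ᶠ p in 𝓝 u, p ∈ V ∧ 0 < fderiv ℝ g p (0, 1) :=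
    (hV.eventually_mem hu).and ((hcont.continuousAt (hV.mem_nhds hu)).eventually (lt_mem_nhds hd))
  obtain ⟨r, hr, hbox⟩ := Metric.eventually_nhds_iff_ball.1 hnear
  obtain ⟨s, hs, hγs⟩ := hγc.contDiffOn le_rfl (by simp)
  have hall : ∀ᶠ y in 𝓝 u.1, y ∈ s ∧ g (y, γ y) = 0 ∧ γ y ∈ Metric.ball u.2 r ∧
      y ∈ Metric.ball u.1 r := by
    have h1 : ∀ᶠ y in 𝓝 u.1, γ y ∈ Metric.ball u.2 r :=
      hγc.continuousAt.eventually (by rw [hγ0]; exact Metric.ball_mem_nhds _ hr)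
    have h2 : ∀ᶠ y in 𝓝 u.1, y ∈ s := by simpa using hs
    filter_upwards [h2, hγg, h1, Metric.ball_mem_nhds _ hr] with y a b c d using ⟨a, b, c, d⟩
  obtain ⟨ρ, hρ, hρs⟩ := Metric.eventually_nhds_iff_ball.1 hall
  have hin : ∀ y ∈ Metric.ball u.1 ρ, ∀ t ∈ Metric.ball u.2 r, (y, t) ∈ Metric.ball u r :=
    fun y hy t ht => by
      rw [← ball_prod_same]
      exact ⟨(hρs y hy).2.2.2, ht⟩
  refine ⟨γ, ρ, r, hρ, hr, ?_, hγ0, fun y hy => (hρs y hy).2.2.1, ?_, ?_⟩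
  · exact hγs.mono fun y hy => (hρs y hy).1
  · rintro ⟨y, t⟩ ⟨hy, ht⟩
    exact (hbox _ (hin y hy t ht)).1
  · intro y hy t ht
    have hder : ∀ t ∈ Metric.ball u.2 r,
        HasDerivAt (fun t => g (y, t)) (fderiv ℝ g (y, t) (0, 1)) t := by
      intro t ht
      have h1 : HasFDerivAt g (fderiv ℝ g (y, t)) (y, t) :=
        ((hg.differentiableOn one_ne_zero).differentiableAt
          (hV.mem_nhds (hbox _ (hin y hy t ht)).1)).hasFDerivAt
      exact h1.comp_hasDerivAt t ((hasDerivAt_const t y).prodMk (hasDerivAt_id t))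
    have hmono : StrictMonoOn (fun t => g (y, t)) (Metric.ball u.2 r) := by
      refine strictMonoOn_of_deriv_pos (convex_ball _ _)
        (fun t ht => (hder t ht).continuousAt.continuousWithinAt) fun t ht => ?_
      rw [Metric.isOpen_ball.interior_eq] at ht
      rw [(hder t ht).deriv]
      exact (hbox _ (hin y hy t ht)).2
    have hz : g (y, γ y) = 0 := (hρs y hy).2.1
    have hγm := (hρs y hy).2.2.1
    have e1 := hmono.lt_iff_lt ht hγm
    have e2 := hmono.lt_iff_lt hγm ht
    simp only [hz] at e1 e2
    exact ⟨e1, e2⟩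

/-- The derivative of `g` vanishes on the tangent space to a graph on which `g` vanishes. -/
lemma fderiv_apply_tangent {g : H × ℝ → ℝ} {γ : H → ℝ} {y : H}
    (hg : DifferentiableAt ℝ g (y, γ y)) (hγ : DifferentiableAt ℝ γ y)
    (h : ∀ᶠ z in 𝓝 y, g (z, γ z) = 0) (v : H) : fderiv ℝ g (y, γ y) (v, fderiv ℝ γ y v) = 0 := by
  have h1 : HasFDerivAt (fun z => (z, γ z)) ((ContinuousLinearMap.id ℝ H).prod (fderiv ℝ γ y)) y :=
    (hasFDerivAt_id y).prodMk hγ.hasFDerivAt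
  have h2 := hg.hasFDerivAt.comp y h1
  have h3 : HasFDerivAt (g ∘ fun z => (z, γ z)) (0 : H →L[ℝ] ℝ) y :=
    (hasFDerivAt_const (0 : ℝ) y).congr_of_eventuallyEq h
  have := congrArg (fun L => L v) (h2.unique h3)
  simpa using this

end ImplicitGraph

/-! ### Localization of additive functionals of test functions -/

section Localization

variable {E : Type*} [NormedAddCommGroup E] [NormedSpace ℝ E]

/-- Compactly supported functions of class `C¹`. -/
structure IsC1Test (φ : E → ℝ) : Prop where
  contDiff : ContDiff ℝ 1 φ
  hasCompactSupport : HasCompactSupport φ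

lemma IsC1Test.mul {φ χ : E → ℝ} (hφ : IsC1Test φ) (hχ : ContDiff ℝ 1 χ) :
    IsC1Test fun x => χ x * φ x :=
  ⟨hχ.mul hφ.contDiff, hφ.hasCompactSupport.mul_left⟩

/-- An additive functional of `C¹` test functions satisfies a bound by a functional that is
superadditive under partitions of unity as soon as it does so locally. -/
theorem abs_le_of_locally [FiniteDimensional ℝ E] {T b : (E → ℝ) → ℝ}
    (hT : ∀ φ ψ, IsC1Test φ → IsC1Test ψ → T (fun x => φ x + ψ x) = T φ + T ψ)
    (hb0 : 0 ≤ b fun _ => 0)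
    (hb : ∀ φ χ, IsC1Test φ → ContDiff ℝ 1 χ → (∀ x, 0 ≤ χ x ∧ χ x ≤ 1) →
      b (fun x => χ x * φ x) + b (fun x => (1 - χ x) * φ x) ≤ b φ)
    {φ : E → ℝ} (hφ : IsC1Test φ)
    (hloc : ∀ p ∈ tsupport φ, ∃ V ∈ 𝓝 p, ∀ ψ, IsC1Test ψ → tsupport ψ ⊆ V → |T ψ| ≤ b ψ) :
    |T φ| ≤ b φ := by
  suffices h : ∃ V : Set E, IsOpen V ∧ tsupport φ ⊆ V ∧
      ∀ ψ, IsC1Test ψ → tsupport ψ ⊆ V → |T ψ| ≤ b ψ by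
    obtain ⟨V, -, hV, h⟩ := h
    exact h φ hφ hV
  refine hφ.hasCompactSupport.isCompact.induction_on
    (p := fun s => ∃ V : Set E, IsOpen V ∧ s ⊆ V ∧
      ∀ ψ, IsC1Test ψ → tsupport ψ ⊆ V → |T ψ| ≤ b ψ) ?_ ?_ ?_ ?_
  · refine ⟨∅, isOpen_empty, Subset.rfl, fun ψ hψ hs => ?_⟩
    have h0 : ψ = fun _ => 0 := by
      funext x
      by_contra hx
      exact hs (subset_tsupport _ hx)
    have h1 : IsC1Test fun _ : E => (0 : ℝ) := h0 ▸ hψ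
    have h2 := hT _ _ h1 h1
    simp only [add_zero] at h2
    have h3 : T (fun _ => 0) = 0 := by linarith
    rw [h0, h3, abs_zero]
    exact hb0
  · rintro s t hst ⟨V, hV, htV, h⟩
    exact ⟨V, hV, hst.trans htV, h⟩
  · rintro s t ⟨V₁, hV₁, hs, h₁⟩ ⟨V₂, hV₂, ht, h₂⟩
    refine ⟨V₁ ∪ V₂, hV₁.union hV₂, union_subset_union hs ht, fun ψ hψ hsupp => ?_⟩
    have hcl : IsClosed (tsupport ψ \ V₂) := (isClosed_tsupport ψ).sdiff hV₂
    have hsub : tsupport ψ \ V₂ ⊆ V₁ := fun x hx => (hsupp hx.1).resolve_right hx.2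
    obtain ⟨O, hO, hO1, hO2⟩ := normal_exists_closure_subset hcl hV₁ hsub
    obtain ⟨χ, hχ1, hχ0, hχb⟩ := exists_contMDiffMap_one_nhds_of_subset_interior
      (n := (⊤ : ℕ∞)) (modelWithCornersSelf ℝ E) hcl (hO1.trans hO.subset_interior_closure)
    have hχ : ContDiff ℝ 1 χ := χ.contMDiff.contDiff.of_le (by exact_mod_cast le_top)
    have e : ψ = fun x => χ x * ψ x + (1 - χ x) * ψ x := by
      funext x
      ring
    have hχ' : ContDiff ℝ 1 fun x => 1 - χ x := contDiff_const.sub hχ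
    have t1 : tsupport (fun x => χ x * ψ x) ⊆ V₁ := by
      refine (closure_minimal (fun x hx => ?_) isClosed_closure).trans hO2
      by_contra hcon
      exact left_ne_zero_of_mul hx (hχ0 x hcon)
    have t2 : tsupport (fun x => (1 - χ x) * ψ x) ⊆ V₂ := by
      intro x hx
      by_contra hcon
      have hx' : x ∈ tsupport ψ \ V₂ :=
        ⟨closure_mono (fun y hy => right_ne_zero_of_mul hy) hx, hcon⟩
      refine notMem_tsupport_iff_eventuallyEq.2 ?_ hx
      filter_upwards [(eventually_nhdsSet_iff_forall.1 hχ1) x hx'] with y hy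
      simp [hy]
    have hadd := hT _ _ (hψ.mul hχ) (hψ.mul hχ')
    rw [← e] at hadd
    calc |T ψ| ≤ |T fun x => χ x * ψ x| + |T fun x => (1 - χ x) * ψ x| := by
          rw [hadd]
          exact abs_add_le _ _
      _ ≤ _ := add_le_add (h₁ _ (hψ.mul hχ) t1) (h₂ _ (hψ.mul hχ') t2)
      _ ≤ b ψ := hb ψ χ hψ hχ hχb
  · intro p hp
    obtain ⟨V, hV, h⟩ := hloc p hp
    obtain ⟨O, hOV, hO, hpO⟩ := mem_nhds_iff.1 hV
    exact ⟨O, mem_nhdsWithin_of_mem_nhds (hO.mem_nhds hpO), O, hO, Subset.rfl,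
      fun ψ hψ hs => h ψ hψ (hs.trans hOV)⟩

/-- An additive functional of `C¹` test functions that vanishes locally vanishes. -/
theorem eq_zero_of_locally [FiniteDimensional ℝ E] {T : (E → ℝ) → ℝ}
    (hT : ∀ φ ψ, IsC1Test φ → IsC1Test ψ → T (fun x => φ x + ψ x) = T φ + T ψ)
    {φ : E → ℝ} (hφ : IsC1Test φ)
    (hloc : ∀ p ∈ tsupport φ, ∃ V ∈ 𝓝 p, ∀ ψ, IsC1Test ψ → tsupport ψ ⊆ V → T ψ = 0) :
    T φ = 0 := by
  refine abs_eq_zero.1 (le_antisymm (abs_le_of_locally (b := fun _ => 0) hT le_rfl ?_ hφ ?_)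
    (abs_nonneg _))
  · intros
    simp
  · intro p hp
    obtain ⟨V, hV, h⟩ := hloc p hp
    exact ⟨V, hV, fun ψ hψ hs => by simp [h ψ hψ hs]⟩

end Localization

/-! ### The defect in the divergence theorem -/

section FluxDefect

variable {E : Type*} [NormedAddCommGroup E] [NormedSpace ℝ E]

lemma contDiff_mul_of_tsupport_subset {φ χ : E → ℝ} (hφ : ContDiff ℝ 1 φ) {V : Set E}
    (hV : IsOpen V) (hφV : tsupport φ ⊆ V) (hχ : ContDiffOn ℝ 1 χ V) :
    ContDiff ℝ 1 fun x => χ x * φ x := by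
  refine contDiff_iff_contDiffAt.2 fun x => ?_
  by_cases hx : x ∈ V
  · exact (hχ.contDiffAt (hV.mem_nhds hx)).mul hφ.contDiffAt
  · have h0 : (fun x => χ x * φ x) =ᶠ[𝓝 x] fun _ => 0 := by
      filter_upwards [notMem_tsupport_iff_eventuallyEq.1 fun h => hx (hφV h)] with y hy
      simp [hy]
    exact contDiffAt_const.congr_of_eventuallyEq h0

lemma IsC1Test.differentiable {φ : E → ℝ} (hφ : IsC1Test φ) : Differentiable ℝ φ :=
  hφ.contDiff.differentiable one_ne_zero

variable [MeasurableSpace E]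

/-- The amount by which the field `X` violates, when tested against `φ`, the divergence theorem with
divergence `f` and with boundary flux of density `-β` with respect to the measure `ν`. -/
def fluxDefect (μ ν : Measure E) (X : E → E) (f β : E → ℝ) (φ : E → ℝ) : ℝ :=
  ∫ p, (fderiv ℝ φ p (X p) + φ p * f p) ∂μ + ∫ p, φ p * β p ∂ν

variable [BorelSpace E] {μ ν : Measure E} {X : E → E} {f β : E → ℝ}

lemma IsC1Test.integrable_fderiv_apply [FiniteDimensional ℝ E] {φ : E → ℝ} (hφ : IsC1Test φ)
    (hX : LocallyIntegrable X μ) : Integrable (fun p => fderiv ℝ φ p (X p)) μ := by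
  have hd : Continuous (fderiv ℝ φ) := hφ.contDiff.continuous_fderiv one_ne_zero
  have h1 : Integrable (fun p => ‖fderiv ℝ φ p‖ • ‖X p‖) μ :=
    (show LocallyIntegrable (fun p => ‖X p‖) μ from fun x => (hX x).norm).integrable_smul_left_of_hasCompactSupport hd.norm
      (hφ.hasCompactSupport.fderiv ℝ).norm
  refine h1.mono' ?_ (Eventually.of_forall fun p => (fderiv ℝ φ p).le_opNorm _)
  exact (ContinuousLinearMap.id ℝ (E →L[ℝ] ℝ)).aestronglyMeasurable_comp₂
    hd.aestronglyMeasurable hX.aestronglyMeasurable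

lemma IsC1Test.integrable_mul {φ : E → ℝ} (hφ : IsC1Test φ) (hf : LocallyIntegrable f μ) :
    Integrable (fun p => φ p * f p) μ :=
  hf.integrable_smul_left_of_hasCompactSupport hφ.contDiff.continuous hφ.hasCompactSupport

lemma fluxDefect_add [FiniteDimensional ℝ E] (hX : LocallyIntegrable X μ) (hf : LocallyIntegrable f μ)
    (hβ : LocallyIntegrable β ν) (φ ψ : E → ℝ) (hφ : IsC1Test φ) (hψ : IsC1Test ψ) :
    fluxDefect μ ν X f β (fun x => φ x + ψ x) =
      fluxDefect μ ν X f β φ + fluxDefect μ ν X f β ψ := by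
  have h1 : ∀ p, fderiv ℝ (fun x => φ x + ψ x) p = fderiv ℝ φ p + fderiv ℝ ψ p := fun p =>
    fderiv_fun_add (hφ.differentiable p) (hψ.differentiable p)
  have e1 : ∀ p, fderiv ℝ (fun x => φ x + ψ x) p (X p) + (φ p + ψ p) * f p =
      (fderiv ℝ φ p (X p) + φ p * f p) + (fderiv ℝ ψ p (X p) + ψ p * f p) := fun p => by
    rw [h1, add_apply]
    ring
  have e2 : ∀ p, (φ p + ψ p) * β p = φ p * β p + ψ p * β p := fun p => by ring
  simp only [fluxDefect, e1, e2]
  have i1 : Integrable (fun p => fderiv ℝ φ p (X p) + φ p * f p) μ :=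
    (hφ.integrable_fderiv_apply hX).add (hφ.integrable_mul hf)
  have i2 : Integrable (fun p => fderiv ℝ ψ p (X p) + ψ p * f p) μ :=
    (hψ.integrable_fderiv_apply hX).add (hψ.integrable_mul hf)
  rw [integral_add i1 i2, integral_add (hφ.integrable_mul hβ) (hψ.integrable_mul hβ)]
  ring

/-- Multiplication of the test function by cutoffs `χ k` that converge to an indicator function. -/
theorem tendsto_fluxDefect_cutoff [FiniteDimensional ℝ E] (hX : LocallyIntegrable X μ)
    (hf : LocallyIntegrable f μ) (hβ : LocallyIntegrable β ν) {φ : E → ℝ} (hφ : IsC1Test φ) {χ : ℕ → E → ℝ}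
    (hχφ : ∀ k, IsC1Test fun x => χ k x * φ x)
    (hχd : ∀ k, ∀ p ∈ tsupport φ, DifferentiableAt ℝ (χ k) p)
    (hχm : ∀ k, Measurable (χ k)) (hχb : ∀ k x, 0 ≤ χ k x ∧ χ k x ≤ 1) {S S' : Set E}
    (hS : ∀ᵐ p ∂μ, Tendsto (fun k => χ k p) atTop (𝓝 (S.indicator 1 p)))
    (hS' : ∀ᵐ p ∂ν, Tendsto (fun k => χ k p) atTop (𝓝 (S'.indicator 1 p))) {J : ℝ}
    (hJ : Tendsto (fun k => ∫ p, φ p * fderiv ℝ (χ k) p (X p) ∂μ) atTop (𝓝 J)) :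
    Tendsto (fun k => fluxDefect μ ν X f β fun x => χ k x * φ x) atTop
      (𝓝 (∫ p, S.indicator 1 p * (fderiv ℝ φ p (X p) + φ p * f p) ∂μ + J +
        ∫ p, S'.indicator 1 p * (φ p * β p) ∂ν)) := by
  have hd : ∀ k, (fun p => fderiv ℝ (fun x => χ k x * φ x) p (X p)) =
      fun p => φ p * fderiv ℝ (χ k) p (X p) + χ k p * fderiv ℝ φ p (X p) := by
    intro k
    funext p
    by_cases hp : p ∈ tsupport φ
    · have h := (hχd k p hp).hasFDerivAt.mul (hφ.differentiable p).hasFDerivAt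
      have h' : fderiv ℝ (fun x => χ k x * φ x) p = _ := h.fderiv
      rw [h']
      simp only [add_apply, _root_.smul_apply, smul_eq_mul]
      ring
    · have h1 : p ∉ tsupport fun x => χ k x * φ x := fun h =>
        hp (closure_mono (fun y hy => right_ne_zero_of_mul hy) h)
      have h2 : fderiv ℝ (fun x => χ k x * φ x) p = 0 :=
        image_eq_zero_of_notMem_tsupport fun h => h1 (tsupport_fderiv_subset ℝ h)
      have h3 : fderiv ℝ φ p = 0 :=
        image_eq_zero_of_notMem_tsupport fun h => hp (tsupport_fderiv_subset ℝ h)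
      rw [h2, h3, image_eq_zero_of_notMem_tsupport hp]
      simp
  have hg : Integrable (fun p => fderiv ℝ φ p (X p) + φ p * f p) μ :=
    (hφ.integrable_fderiv_apply hX).add (hφ.integrable_mul hf)
  have hn : ∀ k p, ‖χ k p‖ ≤ 1 := fun k p => by
    rw [Real.norm_eq_abs, abs_of_nonneg (hχb k p).1]
    exact (hχb k p).2
  have hi : ∀ (k : ℕ) {m : Measure E} {g : E → ℝ}, Integrable g m →
      Integrable (fun p => χ k p * g p) m := fun k m g hg =>
    hg.bdd_mul (c := 1) (hχm k).aestronglyMeasurable (Eventually.of_forall (hn k))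
  have hdct : ∀ {m : Measure E} {g : E → ℝ} {A : Set E}, Integrable g m →
      (∀ᵐ p ∂m, Tendsto (fun k => χ k p) atTop (𝓝 (A.indicator 1 p))) →
      Tendsto (fun k => ∫ p, χ k p * g p ∂m) atTop (𝓝 (∫ p, A.indicator 1 p * g p ∂m)) := by
    intro m g A hg hA
    refine tendsto_integral_of_dominated_convergence (fun p => ‖g p‖)
      (fun k => (hi k hg).aestronglyMeasurable) hg.norm (fun k => Eventually.of_forall fun p => ?_) ?_
    · rw [norm_mul]
      exact mul_le_of_le_one_left (norm_nonneg _) (hn k p)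
    · filter_upwards [hA] with p hp using hp.mul_const _
  have hsplit : ∀ k, fluxDefect μ ν X f β (fun x => χ k x * φ x) =
      ∫ p, χ k p * (fderiv ℝ φ p (X p) + φ p * f p) ∂μ + ∫ p, φ p * fderiv ℝ (χ k) p (X p) ∂μ +
        ∫ p, χ k p * (φ p * β p) ∂ν := by
    intro k
    have h1 : Integrable (fun p => φ p * fderiv ℝ (χ k) p (X p)) μ := by
      refine (((hχφ k).integrable_fderiv_apply hX).sub
        (hi k (hφ.integrable_fderiv_apply hX))).congr (Eventually.of_forall fun p => ?_)
      have := congrFun (hd k) p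
      simp only [Pi.sub_apply] at this ⊢
      rw [this]
      ring
    rw [← integral_add (hi k hg) h1]
    unfold fluxDefect
    congr 1
    · refine integral_congr_ae (Eventually.of_forall fun p => ?_)
      have := congrFun (hd k) p
      simp only at this ⊢
      rw [this]
      ring
    · simp only [mul_assoc]
  simp only [hsplit]
  exact ((hdct hg hS).add hJ).add (hdct (hφ.integrable_mul hβ) hS')

end FluxDefect

/-! ### The defect carried by a graph -/

section GraphCutoff

variable {E : Type*} [NormedAddCommGroup E] [NormedSpace ℝ E] [FiniteDimensional ℝ E]
  [MeasurableSpace E] [BorelSpace E] {μ ν : Measure E} {X : E → E} {f β : E → ℝ}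
  {H : Type*} [NormedAddCommGroup H] [NormedSpace ℝ H] [FiniteDimensional ℝ H]
  [MeasurableSpace H] [BorelSpace H] {μH : Measure H} [IsLocallyFiniteMeasure μH]

/-- If the divergence theorem holds off the graph of a `C¹` function `γ`, then its defect is the jump
of the flux of the field across the graph, plus the boundary flux prescribed on the graph. -/
theorem fluxDefect_eq_of_graph (Ψ : E ≃L[ℝ] H × ℝ)
    (hΨ : MeasurePreserving Ψ μ (μH.prod volume))
    (hX : LocallyIntegrable X μ) (hf : LocallyIntegrable f μ) (hβ : LocallyIntegrable β ν)
    {φ : E → ℝ} (hφ : IsC1Test φ) {γ : H → ℝ} (hγm : Measurable γ) {B : Set H} (hB : IsOpen B)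
    (hγ : ContDiffOn ℝ 1 γ B) (hφB : ∀ p ∈ tsupport φ, (Ψ p).1 ∈ B) {M : ℝ}
    (hM : ∀ᵐ p ∂μ, p ∈ tsupport φ → ‖X p‖ ≤ M)
    (hoff : ∀ ψ, IsC1Test ψ → tsupport ψ ⊆ tsupport φ →
      (∀ p ∈ tsupport ψ, (Ψ p).2 ≠ γ (Ψ p).1) → fluxDefect μ ν X f β ψ = 0)
    {W : Set E} (hW : μ W = 0) {jp jm : H → ℝ}
    (hp : ∀ᵐ y ∂μH, Ψ.symm (y, γ y) ∈ tsupport φ →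
      Tendsto (fun s => (Ψ (X (Ψ.symm (y, γ y + s)))).2 -
        fderiv ℝ γ y (Ψ (X (Ψ.symm (y, γ y + s)))).1)
          (𝓝[{s | 0 < s ∧ Ψ.symm (y, γ y + s) ∉ W}] 0) (𝓝 (jp y)))
    (hm : ∀ᵐ y ∂μH, Ψ.symm (y, γ y) ∈ tsupport φ →
      Tendsto (fun s => (Ψ (X (Ψ.symm (y, γ y + s)))).2 -
        fderiv ℝ γ y (Ψ (X (Ψ.symm (y, γ y + s)))).1)
          (𝓝[{s | s < 0 ∧ Ψ.symm (y, γ y + s) ∉ W}] 0) (𝓝 (jm y))) :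
    fluxDefect μ ν X f β φ =
      ∫ y, φ (Ψ.symm (y, γ y)) * (jm y - jp y) ∂μH +
      ∫ p, {p | (Ψ p).2 = γ (Ψ p).1}.indicator 1 p * (φ p * β p) ∂ν := by
  obtain ⟨κ, hκ, hκ0, hκb, hκs, hκ1⟩ := exists_cutoff
  have hΨ' : MeasurePreserving Ψ.symm (μH.prod volume) μ :=
    MeasurePreserving.symm (e := Ψ.toHomeomorph.toMeasurableEquiv) hΨ
  have hint : ∀ g : E → ℝ, ∫ p, g p ∂μ = ∫ q, g (Ψ.symm q) ∂(μH.prod volume) := fun g =>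
    (hΨ'.integral_comp Ψ.symm.toHomeomorph.measurableEmbedding g).symm
  have hVo : IsOpen {p : E | (Ψ p).1 ∈ B} := hB.preimage (continuous_fst.comp Ψ.continuous)
  set σ : E → ℝ := fun p => (Ψ p).2 - γ (Ψ p).1 with hσ
  have hσm : Measurable σ := by
    have : Measurable Ψ := Ψ.continuous.measurable
    exact (measurable_snd.comp this).sub (hγm.comp (measurable_fst.comp this))
  have hσc : ContDiffOn ℝ 1 σ {p : E | (Ψ p).1 ∈ B} := by
    refine (contDiff_snd.comp Ψ.contDiff).contDiffOn.sub ?_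
    exact hγ.comp (contDiff_fst.comp Ψ.contDiff).contDiffOn fun p hp => hp
  have hσd : ∀ p ∈ tsupport φ, HasFDerivAt σ ((ContinuousLinearMap.snd ℝ H ℝ -
      (fderiv ℝ γ (Ψ p).1).comp (ContinuousLinearMap.fst ℝ H ℝ)).comp
        (Ψ : E →L[ℝ] H × ℝ)) p := by
    intro p hp
    have h1 : HasFDerivAt γ (fderiv ℝ γ (Ψ p).1) (Ψ p).1 :=
      ((hγ.differentiableOn one_ne_zero).differentiableAt (hB.mem_nhds (hφB p hp))).hasFDerivAt
    have h2 : HasFDerivAt (fun q : H × ℝ => q.2 - γ q.1) (ContinuousLinearMap.snd ℝ H ℝ -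
      (fderiv ℝ γ (Ψ p).1).comp (ContinuousLinearMap.fst ℝ H ℝ)) (Ψ p) :=
      hasFDerivAt_snd.sub (HasFDerivAt.comp (Ψ p) h1 hasFDerivAt_fst)
    exact h2.comp p Ψ.hasFDerivAt
  have hk : ∀ k : ℕ, (0 : ℝ) < (k : ℝ) + 1 := fun k => by positivity
  -- cutoffs that equal `1` near the graph and concentrate on it
  let χ : ℕ → E → ℝ := fun k p => κ (((k : ℝ) + 1) * σ p)
  have hχc : ∀ k, ContDiffOn ℝ 1 (χ k) {p : E | (Ψ p).1 ∈ B} := fun k =>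
    hκ.comp_contDiffOn (contDiffOn_const.mul hσc)
  have hχφ : ∀ k, IsC1Test fun x => χ k x * φ x := fun k =>
    ⟨contDiff_mul_of_tsupport_subset hφ.contDiff hVo hφB (hχc k), hφ.hasCompactSupport.mul_left⟩
  have hχφ' : ∀ k, IsC1Test fun x => (1 - χ k x) * φ x := fun k =>
    ⟨contDiff_mul_of_tsupport_subset hφ.contDiff hVo hφB (contDiffOn_const.sub (hχc k)),
      hφ.hasCompactSupport.mul_left⟩
  have hχm : ∀ k, Measurable (χ k) := fun k =>
    hκ.continuous.measurable.comp (measurable_const.mul hσm)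
  have hχlim : ∀ p, Tendsto (fun k => χ k p) atTop
      (𝓝 ({p | (Ψ p).2 = γ (Ψ p).1}.indicator 1 p)) := by
    intro p
    by_cases hp : σ p = 0
    · rw [indicator_of_mem (show p ∈ {p | (Ψ p).2 = γ (Ψ p).1} from sub_eq_zero.1 hp)]
      simp only [χ, hp, mul_zero, hκ0]
      exact tendsto_const_nhds
    · rw [indicator_of_notMem (show p ∉ {p | (Ψ p).2 = γ (Ψ p).1} from
        fun h => hp (sub_eq_zero.2 h))]
      refine tendsto_const_nhds.congr' ?_
      obtain ⟨K, hK⟩ := exists_nat_gt |σ p|⁻¹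
      filter_upwards [eventually_ge_atTop K] with k hkK
      refine (hκs _ ?_).symm
      rw [abs_mul, abs_of_pos (hk k), ← inv_le_iff_one_le_mul₀ (abs_pos.2 hp)]
      have : (K : ℝ) ≤ k := by exact_mod_cast hkK
      linarith
  have hgraph : μ {p | (Ψ p).2 = γ (Ψ p).1} = 0 := by
    have hs : MeasurableSet {q : H × ℝ | q.2 = γ q.1} :=
      measurableSet_eq_fun measurable_snd (hγm.comp measurable_fst)
    have h0 := measure_graph_eq_zero μH hγm
    rw [← hΨ.measure_preimage hs.nullMeasurableSet] at h0
    exact h0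
  -- the cutoffs do not change the defect, which vanishes for test functions supported off the graph
  have hsupp : ∀ k, fluxDefect μ ν X f β φ = fluxDefect μ ν X f β (fun x => χ k x * φ x) := by
    intro k
    have h1 := fluxDefect_add hX hf hβ _ _ (hχφ k) (hχφ' k)
    have h2 : fluxDefect μ ν X f β (fun x => (1 - χ k x) * φ x) = 0 := by
      refine hoff _ (hχφ' k) (closure_mono fun y hy => right_ne_zero_of_mul hy) fun p hp heq => ?_
      have hpφ : p ∈ tsupport φ := closure_mono (fun y hy => right_ne_zero_of_mul hy) hp
      refine notMem_tsupport_iff_eventuallyEq.2 ?_ hp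
      have hc : ContinuousAt (fun x => ((k : ℝ) + 1) * σ x) p :=
        continuousAt_const.mul (hσd p hpφ).continuousAt
      have h0 : ((k : ℝ) + 1) * σ p = 0 := by
        rw [hσ]
        simp [heq]
      have := hc.eventually (p := fun s => κ s = 1) (by
        change ∀ᶠ s in 𝓝 (((k : ℝ) + 1) * σ p), κ s = 1
        rw [h0]
        exact hκ1)
      filter_upwards [this] with x hx
      simp [χ, hx]
    rw [h2, add_zero] at h1
    rw [← h1]
    congr 1
    funext x
    ring
  -- the flux through the thin layer around the graph
  let F : H × ℝ → ℝ := fun q => φ (Ψ.symm q) *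
    ((Ψ (X (Ψ.symm q))).2 - fderiv ℝ γ q.1 (Ψ (X (Ψ.symm q))).1)
  have hFk : ∀ k, ∫ p, φ p * fderiv ℝ (χ k) p (X p) ∂μ =
      ∫ q, F q * (deriv κ (((k : ℝ) + 1) * (q.2 - γ q.1)) * ((k : ℝ) + 1))
        ∂(μH.prod volume) := by
    intro k
    rw [hint]
    refine integral_congr_ae (Eventually.of_forall fun q => ?_)
    simp only [F]
    by_cases hq : Ψ.symm q ∈ tsupport φ
    · have h1 := (hκ.differentiable one_ne_zero
        (((k : ℝ) + 1) * σ (Ψ.symm q))).hasDerivAt.comp_hasFDerivAt (Ψ.symm q)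
          ((hσd _ hq).const_mul ((k : ℝ) + 1))
      have h2 : fderiv ℝ (χ k) (Ψ.symm q) = _ := h1.fderiv
      rw [h2]
      simp only [_root_.smul_apply, smul_eq_mul, ContinuousLinearMap.comp_apply, sub_apply, hσ,
        ContinuousLinearMap.coe_fst', ContinuousLinearMap.coe_snd',
        ContinuousLinearEquiv.coe_coe, ContinuousLinearEquiv.apply_symm_apply]
      ring
    · rw [image_eq_zero_of_notMem_tsupport hq]
      simp
  have hJ : Tendsto (fun k : ℕ => ∫ q, F q * (deriv κ (((k : ℝ) + 1) * (q.2 - γ q.1)) *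
      ((k : ℝ) + 1)) ∂(μH.prod volume)) atTop
      (𝓝 (∫ y, (φ (Ψ.symm (y, γ y)) * jm y - φ (Ψ.symm (y, γ y)) * jp y) ∂μH)) := by
    have hKc : IsCompact ((fun p => (Ψ p).1) '' tsupport φ) :=
      hφ.hasCompactSupport.isCompact.image (continuous_fst.comp Ψ.continuous)
    have hKB : (fun p => (Ψ p).1) '' tsupport φ ⊆ B := by
      rintro _ ⟨p, hp, rfl⟩
      exact hφB p hp
    have hdc : ContinuousOn (fun y => ‖fderiv ℝ γ y‖) B :=
      (hγ.continuousOn_fderiv_of_isOpen hB le_rfl).norm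
    obtain ⟨L, hL⟩ := hKc.bddAbove_image (hdc.mono hKB)
    obtain ⟨C, hC⟩ := hφ.hasCompactSupport.exists_bound_of_continuous hφ.contDiff.continuous
    have hFm : AEStronglyMeasurable F (μH.prod volume) := by
      have hXm : AEStronglyMeasurable (fun q => Ψ (X (Ψ.symm q))) (μH.prod volume) :=
        Ψ.continuous.comp_aestronglyMeasurable
          (hX.aestronglyMeasurable.comp_measurePreserving hΨ')
      have hD : AEStronglyMeasurable (fun q : H × ℝ => fderiv ℝ γ q.1) (μH.prod volume) :=
        ((measurable_fderiv ℝ γ).comp measurable_fst).aestronglyMeasurable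
      exact (hφ.contDiff.continuous.comp Ψ.symm.continuous).aestronglyMeasurable.mul
        ((continuous_snd.comp_aestronglyMeasurable hXm).sub
          ((ContinuousLinearMap.id ℝ (H →L[ℝ] ℝ)).aestronglyMeasurable_comp₂ hD
            (continuous_fst.comp_aestronglyMeasurable hXm)))
    have hFM : ∀ᵐ q ∂(μH.prod volume),
        |F q| ≤ |C| * ((1 + |L|) * (‖(Ψ : E →L[ℝ] H × ℝ)‖ * |M|)) := by
      have h1 := hΨ'.quasiMeasurePreserving.ae hM
      filter_upwards [h1] with q hq
      simp only [F]
      by_cases hqφ : Ψ.symm q ∈ tsupport φ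
      · have hX1 : ‖Ψ (X (Ψ.symm q))‖ ≤ ‖(Ψ : E →L[ℝ] H × ℝ)‖ * |M| :=
          ((Ψ : E →L[ℝ] H × ℝ).le_opNorm _).trans
            (mul_le_mul_of_nonneg_left ((hq hqφ).trans (le_abs_self M)) (norm_nonneg _))
        have hL1 : ‖fderiv ℝ γ q.1‖ ≤ |L| := by
          refine (hL ⟨q.1, ⟨Ψ.symm q, hqφ, by simp⟩, rfl⟩).trans (le_abs_self L)
        rw [abs_mul]
        refine mul_le_mul ((hC _).trans (le_abs_self C)) ?_ (abs_nonneg _) (abs_nonneg _)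
        set ξ := Ψ (X (Ψ.symm q))
        calc |ξ.2 - fderiv ℝ γ q.1 ξ.1| ≤ |ξ.2| + |fderiv ℝ γ q.1 ξ.1| := abs_sub _ _
          _ ≤ ‖ξ‖ + |L| * ‖ξ‖ := by
            refine add_le_add (norm_snd_le ξ) (((fderiv ℝ γ q.1).le_opNorm _).trans ?_)
            exact mul_le_mul hL1 (norm_fst_le ξ) (norm_nonneg _) (abs_nonneg _)
          _ = (1 + |L|) * ‖ξ‖ := by ring
          _ ≤ _ := mul_le_mul_of_nonneg_left hX1 (by positivity)
      · rw [image_eq_zero_of_notMem_tsupport hqφ, zero_mul, abs_zero]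
        positivity
    have hlim : ∀ {A : ℝ → Prop} {j : ℝ} {y : H}, (Ψ.symm (y, γ y) ∈ tsupport φ →
        Tendsto (fun s => (Ψ (X (Ψ.symm (y, γ y + s)))).2 -
          fderiv ℝ γ y (Ψ (X (Ψ.symm (y, γ y + s)))).1)
          (𝓝[{s | A s ∧ Ψ.symm (y, γ y + s) ∉ W}] 0) (𝓝 j)) → Tendsto (fun s => F (y, γ y + s))
            (𝓝[{s | A s ∧ (y, γ y + s) ∉ Ψ.symm ⁻¹' W}] 0)
            (𝓝 (φ (Ψ.symm (y, γ y)) * j)) := by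
      intro A j y h
      have hc : Tendsto (fun s : ℝ => Ψ.symm (y, γ y + s)) (𝓝 0) (𝓝 (Ψ.symm (y, γ y))) := by
        have : Continuous fun s : ℝ => Ψ.symm (y, γ y + s) := by fun_prop
        simpa using this.tendsto 0
      by_cases hy : Ψ.symm (y, γ y) ∈ tsupport φ
      · refine ((hφ.contDiff.continuous.tendsto _).comp (hc.mono_left nhdsWithin_le_nhds)).mul
          (h hy)
      · rw [image_eq_zero_of_notMem_tsupport hy, zero_mul]
        refine tendsto_const_nhds.congr' ?_
        have := hc.eventually (notMem_tsupport_iff_eventuallyEq.1 hy)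
        filter_upwards [nhdsWithin_le_nhds this] with s hs
        simp only [F]
        rw [hs]
        simp
    refine tendsto_integral_graph_cutoff (W := Ψ.symm ⁻¹' W) hγm hFm hFM hKc.measurableSet
      hKc.measure_ne_top (fun q hq => ?_) ?_ ?_ ?_ hκ hκ0 hκs
    · have : Ψ.symm q ∉ tsupport φ := fun h => hq ⟨_, h, by simp⟩
      simp only [F]
      rw [image_eq_zero_of_notMem_tsupport this, zero_mul]
    · exact hΨ'.quasiMeasurePreserving.preimage_null hW
    · filter_upwards [hp] with y hy using hlim hy
    · filter_upwards [hm] with y hy using hlim hy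
  have hmain := tendsto_fluxDefect_cutoff (S := ∅) hX hf hβ hφ hχφ
    (fun k p hp => ((hχc k).differentiableOn one_ne_zero).differentiableAt
      (hVo.mem_nhds (hφB p hp))) hχm (fun k x => hκb _) ?_
    (Eventually.of_forall hχlim) (by simpa only [hFk] using hJ)
  · simp only [← hsupp] at hmain
    rw [tendsto_nhds_unique tendsto_const_nhds hmain]
    simp only [indicator_empty, zero_mul, integral_zero, zero_add]
    congr 1
    refine integral_congr_ae (Eventually.of_forall fun y => ?_)
    ring
  · filter_upwards [measure_eq_zero_iff_ae_notMem.1 hgraph] with p hp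
    have := hχlim p
    rw [indicator_of_notMem (show p ∉ {p | (Ψ p).2 = γ (Ψ p).1} from hp)] at this
    simpa using this

end GraphCutoff

/-! ### Sets of zero capacity -/

section Capacity

variable {E : Type*} [NormedAddCommGroup E] [MeasurableSpace E] [BorelSpace E]

/-- Diameters are increased slightly, to radii of open balls, which are positive also where the diameter
is zero. -/
lemma exists_pow_lt_add (d : ℕ) (a : ℝ) {ε : ℝ} (hε : 0 < ε) {δ : ℝ} (hδ : 0 < δ) :
    ∃ r, a < r ∧ r < a + δ ∧ r ^ d < a ^ d + ε := by
  have h1 : ∀ᶠ r in 𝓝[>] a, r ^ d < a ^ d + ε :=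
    nhdsWithin_le_nhds (((continuous_pow d).tendsto a).eventually (gt_mem_nhds (by linarith)))
  have h2 : ∀ᶠ r in 𝓝[>] a, r < a + δ := nhdsWithin_le_nhds (gt_mem_nhds (by linarith))
  obtain ⟨r, h⟩ := (h1.and (h2.and self_mem_nhdsWithin)).exists
  exact ⟨r, h.2.2, h.2.1, h.1⟩

/-- A compact set of zero `d`-dimensional Hausdorff measure is covered by finitely many small balls
for which the sum of the `d`-th powers of the radii is small. -/
lemma exists_finite_ball_cover {d : ℕ} {K : Set E} (hK : IsCompact K)
    (hK0 : (μH[(d : ℝ)] : Measure E) K = 0) {ε : ℝ} (hε : 0 < ε) :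
    ∃ (ι : Finset ℕ) (q : ℕ → E) (r : ℕ → ℝ), (∀ i, 0 < r i ∧ r i < ε) ∧ (∀ i ∈ ι, q i ∈ K) ∧
      K ⊆ ⋃ i ∈ ι, Metric.ball (q i) (r i) ∧ ∑ i ∈ ι, r i ^ d < ε := by
  have hε2 : (0 : ENNReal) < ENNReal.ofReal (ε / 2) := by simpa using hε
  rw [Measure.hausdorffMeasure_apply] at hK0
  have h1 := (ENNReal.iSup_eq_zero.1 hK0) (ENNReal.ofReal (ε / 2))
  have h2 := (ENNReal.iSup_eq_zero.1 h1) hε2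
  have h3 : (⨅ (t : ℕ → Set E) (_ : K ⊆ ⋃ n, t n) (_ : ∀ n, Metric.ediam (t n) ≤
      ENNReal.ofReal (ε / 2)), ∑' n, ⨆ _ : (t n).Nonempty, Metric.ediam (t n) ^ (d : ℝ)) <
      ENNReal.ofReal (ε / 2) := by
    rw [h2]
    exact hε2
  obtain ⟨t, ht⟩ := iInf_lt_iff.1 h3
  obtain ⟨htK, ht⟩ := iInf_lt_iff.1 ht
  obtain ⟨htd, ht⟩ := iInf_lt_iff.1 ht
  have hfin : ∀ n, Metric.ediam (t n) ≠ ⊤ := fun n => ((htd n).trans_lt ENNReal.ofReal_lt_top).ne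
  have ha : ∀ n, (Metric.ediam (t n)).toReal ≤ ε / 2 := fun n =>
    ENNReal.toReal_le_of_le_ofReal (by positivity) (htd n)
  obtain ⟨e, he, c, hec, hc⟩ := posSumOfEncodable (half_pos hε) ℕ
  choose r hr1 hr2 hr3 using fun n => exists_pow_lt_add d (Metric.ediam (t n)).toReal (he n)
    (half_pos hε)
  have hq : ∀ n, ∃ q, (t n ∩ K).Nonempty → q ∈ t n ∩ K := fun n => by
    by_cases h : (t n ∩ K).Nonempty
    · exact ⟨h.some, fun _ => h.some_mem⟩
    · exact ⟨0, fun h' => absurd h' h⟩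
  choose q hq using hq
  have hcov : K ⊆ ⋃ n, ⋃ _ : (t n ∩ K).Nonempty, Metric.ball (q n) (r n) := by
    intro x hx
    obtain ⟨n, hn⟩ := mem_iUnion.1 (htK hx)
    have hne : (t n ∩ K).Nonempty := ⟨x, hn, hx⟩
    refine mem_iUnion.2 ⟨n, mem_iUnion.2 ⟨hne, ?_⟩⟩
    rw [Metric.mem_ball, dist_edist]
    exact (ENNReal.toReal_mono (hfin n) (Metric.edist_le_ediam_of_mem hn (hq n hne).1)).trans_lt
      (hr1 n)
  obtain ⟨ι, hι⟩ := hK.elim_finite_subcover _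
    (fun n => isOpen_iUnion fun _ => Metric.isOpen_ball) hcov
  classical
  refine ⟨ι.filter fun n => (t n ∩ K).Nonempty, q, r, fun i => ?_, fun i hi => ?_, ?_, ?_⟩
  · exact ⟨ENNReal.toReal_nonneg.trans_lt (hr1 i), by linarith [hr2 i, ha i]⟩
  · exact (hq i (Finset.mem_filter.1 hi).2).2
  · intro x hx
    obtain ⟨n, hn, hx⟩ := mem_iUnion₂.1 (hι hx)
    obtain ⟨hne, hx⟩ := mem_iUnion.1 hx
    exact mem_iUnion₂.2 ⟨n, Finset.mem_filter.2 ⟨hn, hne⟩, hx⟩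
  · set J := ι.filter fun n => (t n ∩ K).Nonempty
    have hs1 : ∑ i ∈ J, (Metric.ediam (t i)).toReal ^ d < ε / 2 := by
      have : ENNReal.ofReal (∑ i ∈ J, (Metric.ediam (t i)).toReal ^ d) < ENNReal.ofReal (ε / 2) := by
        refine lt_of_le_of_lt ?_ ht
        rw [ENNReal.ofReal_sum_of_nonneg fun i _ => by positivity]
        refine le_trans (Finset.sum_le_sum fun i hi => ?_) (ENNReal.sum_le_tsum J)
        have hne : (t i).Nonempty := (Finset.mem_filter.1 hi).2.mono inter_subset_left
        rw [iSup_pos hne, ENNReal.ofReal_pow ENNReal.toReal_nonneg, ENNReal.ofReal_toReal (hfin i),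
          ENNReal.rpow_natCast]
      exact (ENNReal.ofReal_lt_ofReal_iff (half_pos hε)).1 this
    have hs2 : ∑ i ∈ J, e i ≤ ε / 2 := (sum_le_hasSum J (fun i _ => (he i).le) hec).trans hc
    calc ∑ i ∈ J, r i ^ d ≤ ∑ i ∈ J, ((Metric.ediam (t i)).toReal ^ d + e i) :=
          Finset.sum_le_sum fun i _ => (hr3 i).le
      _ < ε := by
          rw [Finset.sum_add_distrib]
          linarith

/-- A compact set of zero `(dim E - 1)`-dimensional Hausdorff measure has zero capacity: it is cut
off by functions equal to `1` off a small neighbourhood and with small gradient in the mean. -/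
theorem exists_cutoff_of_hausdorffMeasure_zero [NormedSpace ℝ E]
    [FiniteDimensional ℝ E] (μ : Measure E) [μ.IsAddHaarMeasure] {d : ℕ}
    (hd : Module.finrank ℝ E = d + 1) {K : Set E} (hK : IsCompact K)
    (hK0 : (μH[(d : ℝ)] : Measure E) K = 0) {ε : ℝ} (hε : 0 < ε) :
    ∃ χ : E → ℝ, ContDiff ℝ 1 χ ∧ (∀ p, 0 ≤ χ p ∧ χ p ≤ 1) ∧ (∀ p ∈ K, ∀ᶠ x in 𝓝 p, χ x = 0) ∧
      (∀ p, (∀ q ∈ K, ε ≤ dist p q) → χ p = 1) ∧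
      Integrable (fun p => ‖fderiv ℝ χ p‖) μ ∧ ∫ p, ‖fderiv ℝ χ p‖ ∂μ ≤ ε := by
  obtain ⟨κ, hκ, hκ0, hκb, hκs, hκ1⟩ := exists_cutoff
  let b : ContDiffBump (0 : E) := ⟨1, 2, by norm_num, by norm_num⟩
  have hb1 : ContDiff ℝ 1 b := b.contDiff
  have hbd : Integrable (fun p => ‖fderiv ℝ b p‖) μ :=
    (hb1.continuous_fderiv one_ne_zero).norm.integrable_of_hasCompactSupport
      (b.hasCompactSupport.fderiv ℝ).norm
  set C₀ := ∫ p, ‖fderiv ℝ b p‖ ∂μ with hC₀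
  have hC₀' : 0 ≤ C₀ := integral_nonneg fun p => norm_nonneg _
  obtain ⟨L, hL⟩ : ∃ L, ∀ s, |deriv κ s| ≤ L := by
    have hκc : HasCompactSupport κ := by
      refine HasCompactSupport.of_support_subset_isCompact (isCompact_Icc (a := (-1 : ℝ)) (b := 1)) ?_
      intro s hs
      by_contra hcon
      refine hs (hκs s ?_)
      rw [mem_Icc, ← abs_le, not_le] at hcon
      exact hcon.le
    exact hκc.deriv.exists_bound_of_continuous (hκ.continuous_deriv le_rfl)
  have hL0 : 0 ≤ L := (abs_nonneg _).trans (hL 0)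
  -- the gradient of a bump function on a ball of radius `r` has the integral `C₀ r ^ d`; the sum of
  -- these, multiplied by `L`, is at most `L * C₀ * δ`, which has to be at most `ε`; the support of the
  -- bump function is a ball of radius `2 r ≤ ε`
  set δ := min (ε / 2) (ε / (L * C₀ + 1)) with hδdef
  have hδ : 0 < δ := by positivity
  obtain ⟨ι, q, r, hr, hqK, hcov, hsum⟩ := exists_finite_ball_cover hK hK0 hδ
  let B : ℕ → E → ℝ := fun i p => b ((r i)⁻¹ • (p - q i))
  have hBc : ∀ i, ContDiff ℝ 1 (B i) := fun i => hb1.comp (by fun_prop)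
  have hB0 : ∀ i p, 0 ≤ B i p := fun i p => b.nonneg
  have hBd : ∀ i p, fderiv ℝ (B i) p = (r i)⁻¹ • fderiv ℝ b ((r i)⁻¹ • (p - q i)) := by
    intro i p
    have h1 : HasFDerivAt (fun p => (r i)⁻¹ • (p - q i))
        ((r i)⁻¹ • ContinuousLinearMap.id ℝ E) p :=
      ((hasFDerivAt_id p).sub_const (q i)).const_smul _
    have h2 := (hb1.differentiable one_ne_zero ((r i)⁻¹ • (p - q i))).hasFDerivAt.comp p h1
    have h3 : fderiv ℝ (B i) p = _ := h2.fderiv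
    rw [h3]
    ext x
    simp
  have hBi : ∀ i, Integrable (fun p => ‖fderiv ℝ (B i) p‖) μ ∧
      ∫ p, ‖fderiv ℝ (B i) p‖ ∂μ = r i ^ d * C₀ := by
    intro i
    have hri := (hr i).1
    have e1 : ∀ p, ‖fderiv ℝ (B i) p‖ = (r i)⁻¹ * ‖fderiv ℝ b ((r i)⁻¹ • (p - q i))‖ := fun p => by
      rw [hBd, norm_smul, Real.norm_of_nonneg (inv_pos.2 hri).le]
    simp only [e1]
    have hi : Integrable (fun p => ‖fderiv ℝ b ((r i)⁻¹ • p)‖) μ :=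
      hbd.comp_smul (inv_ne_zero hri.ne')
    refine ⟨(hi.comp_sub_right (q i)).const_mul _, ?_⟩
    rw [integral_const_mul, integral_sub_right_eq_self (fun p => ‖fderiv ℝ b ((r i)⁻¹ • p)‖) (q i),
      Measure.integral_comp_inv_smul μ (fun p => ‖fderiv ℝ b p‖), hd, smul_eq_mul,
      abs_of_pos (by positivity), ← hC₀, pow_succ]
    field_simp
  let sumB : E → ℝ := fun p => ∑ i ∈ ι, B i p
  have hsc : ContDiff ℝ 1 sumB := ContDiff.sum fun i _ => hBc i
  have hdχ : ∀ p, fderiv ℝ (fun p => κ (sumB p)) p = deriv κ (sumB p) • ∑ i ∈ ι, fderiv ℝ (B i) p := by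
    intro p
    have h1 : HasFDerivAt sumB (∑ i ∈ ι, fderiv ℝ (B i) p) p :=
      HasFDerivAt.fun_sum fun i _ => ((hBc i).differentiable one_ne_zero p).hasFDerivAt
    exact ((hκ.differentiable one_ne_zero (sumB p)).hasDerivAt.comp_hasFDerivAt p h1).fderiv
  have hbound : ∀ p, ‖fderiv ℝ (fun p => κ (sumB p)) p‖ ≤ L * ∑ i ∈ ι, ‖fderiv ℝ (B i) p‖ := by
    intro p
    rw [hdχ, norm_smul]
    exact mul_le_mul (hL _) (norm_sum_le _ _) (norm_nonneg _) hL0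
  have hχc : ContDiff ℝ 1 fun p => κ (sumB p) := hκ.comp hsc
  have hgi : Integrable (fun p => L * ∑ i ∈ ι, ‖fderiv ℝ (B i) p‖) μ :=
    (integrable_finsetSum ι fun i _ => (hBi i).1).const_mul L
  have hχi : Integrable (fun p => ‖fderiv ℝ (fun p => κ (sumB p)) p‖) μ :=
    hgi.mono' (hχc.continuous_fderiv one_ne_zero).norm.aestronglyMeasurable
      (Eventually.of_forall fun p => by simpa using hbound p)
  refine ⟨fun p => κ (sumB p), hχc, fun p => hκb _, fun p hp => ?_, fun p hp => ?_, hχi, ?_⟩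
  · obtain ⟨i, hi, hpi⟩ := mem_iUnion₂.1 (hcov hp)
    filter_upwards [Metric.isOpen_ball.mem_nhds hpi] with x hx
    refine hκs _ (le_trans ?_ (le_abs_self _))
    have h1 : B i x = 1 := by
      refine b.one_of_mem_closedBall ?_
      rw [mem_closedBall_zero_iff, norm_smul, norm_inv, Real.norm_of_nonneg (hr i).1.le,
        ← dist_eq_norm]
      change (r i)⁻¹ * dist x (q i) ≤ 1
      rw [inv_mul_le_iff₀ (hr i).1, mul_one]
      exact (Metric.mem_ball.1 hx).le
    rw [← h1]
    exact Finset.single_le_sum (f := fun i => B i x) (fun i _ => hB0 i x) hi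
  · have h1 : sumB p = 0 := by
      refine Finset.sum_eq_zero fun i hi => b.zero_of_le_dist ?_
      rw [dist_zero_right, norm_smul, norm_inv, Real.norm_of_nonneg (hr i).1.le,
        ← dist_eq_norm]
      change 2 ≤ (r i)⁻¹ * dist p (q i)
      rw [le_inv_mul_iff₀ (hr i).1]
      have := hp _ (hqK i hi)
      have h2 : r i < ε / 2 := (hr i).2.trans_le (min_le_left _ _)
      linarith
    simp only [h1, hκ0]
  · calc ∫ p, ‖fderiv ℝ (fun p => κ (sumB p)) p‖ ∂μ ≤ ∫ p, L * ∑ i ∈ ι, ‖fderiv ℝ (B i) p‖ ∂μ :=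
          integral_mono hχi hgi hbound
      _ = L * C₀ * ∑ i ∈ ι, r i ^ d := by
          rw [integral_const_mul, integral_finsetSum ι fun i _ => (hBi i).1,
            Finset.sum_congr rfl fun i _ => (hBi i).2, ← Finset.sum_mul]
          ring
      _ ≤ L * C₀ * (ε / (L * C₀ + 1)) :=
          mul_le_mul_of_nonneg_left (hsum.le.trans (min_le_right _ _)) (by positivity)
      _ ≤ ε := by
          rw [← mul_div_assoc, div_le_iff₀ (by positivity)]
          nlinarith [mul_nonneg hL0 hC₀']

end Capacity

/-! ### Removable sets for the divergence theorem -/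

section Interior

variable {E : Type*} [NormedAddCommGroup E] [NormedSpace ℝ E] [FiniteDimensional ℝ E]
  [MeasurableSpace E] [BorelSpace E] {μ ν : Measure E} [μ.IsAddHaarMeasure]
  {X : E → E} {f β : E → ℝ}

/-- A set of zero `(dim E - 1)`-dimensional Hausdorff measure is removable for the divergence theorem
of a locally bounded field. -/
theorem fluxDefect_eq_zero_of_removable {d : ℕ} (hd : Module.finrank ℝ E = d + 1)
    (hX : LocallyIntegrable X μ) (hf : LocallyIntegrable f μ) (hβ : LocallyIntegrable β ν)
    {φ : E → ℝ} (hφ : IsC1Test φ) (hν : ν (tsupport φ) = 0) {M : ℝ}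
    (hM : ∀ᵐ p ∂μ, p ∈ tsupport φ → ‖X p‖ ≤ M)
    {Z : Set E} (hZ : IsClosed Z) (hZ0 : (μH[(d : ℝ)] : Measure E) Z = 0) (hμZ : μ Z = 0)
    (hoff : ∀ ψ, IsC1Test ψ → tsupport ψ ⊆ tsupport φ \ Z → fluxDefect μ ν X f β ψ = 0) :
    fluxDefect μ ν X f β φ = 0 := by
  set K := tsupport φ ∩ Z
  have hK : IsCompact K := hφ.hasCompactSupport.isCompact.inter_right hZ
  have hK0 : (μH[(d : ℝ)] : Measure E) K = 0 := measure_mono_null inter_subset_right hZ0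
  have hk : ∀ k : ℕ, (0 : ℝ) < 1 / ((k : ℝ) + 1) := fun k => by positivity
  choose χ hχc hχb hχ0 hχ1 hχi hχs using fun k : ℕ =>
    exists_cutoff_of_hausdorffMeasure_zero μ hd hK hK0 (hk k)
  obtain ⟨C, hC⟩ := hφ.hasCompactSupport.exists_bound_of_continuous hφ.contDiff.continuous
  have hz : ∀ k, fluxDefect μ ν X f β (fun x => χ k x * φ x) = 0 := by
    intro k
    refine hoff _ (hφ.mul (hχc k)) fun p hp => ?_
    have hpφ : p ∈ tsupport φ := closure_mono (fun y hy => right_ne_zero_of_mul hy) hp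
    refine ⟨hpφ, fun hpZ => ?_⟩
    refine notMem_tsupport_iff_eventuallyEq.2 ?_ hp
    filter_upwards [hχ0 k p ⟨hpφ, hpZ⟩] with x hx
    simp [hx]
  have hlim : ∀ p, Tendsto (fun k => χ k p) atTop (𝓝 (Kᶜ.indicator 1 p)) := by
    intro p
    by_cases hp : p ∈ K
    · have : ∀ k, χ k p = 0 := fun k => (hχ0 k p hp).self_of_nhds
      simp [this, hp]
    · rw [indicator_of_mem (mem_compl hp)]
      refine tendsto_const_nhds.congr' ?_
      obtain ⟨e, he, hball⟩ := Metric.isOpen_iff.1 hK.isClosed.isOpen_compl p hp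
      have := (tendsto_one_div_add_atTop_nhds_zero_nat (𝕜 := ℝ)).eventually (gt_mem_nhds he)
      filter_upwards [this] with k hkε
      refine (hχ1 k p fun q hq => ?_).symm
      by_contra hcon
      exact hball (Metric.mem_ball'.2 ((not_le.1 hcon).trans hkε)) hq
  -- a bounded field does not see the gradients of the cutoffs, which tend to zero in the mean
  have hJ : Tendsto (fun k => ∫ p, φ p * fderiv ℝ (χ k) p (X p) ∂μ) atTop (𝓝 0) := by
    refine squeeze_zero_norm (a := fun k : ℕ => |C| * |M| * (1 / ((k : ℝ) + 1))) (fun k => ?_) ?_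
    · refine (norm_integral_le_of_norm_le ((hχi k).const_mul (|C| * |M|)) ?_).trans ?_
      · filter_upwards [hM] with p hp
        by_cases hpφ : p ∈ tsupport φ
        · rw [norm_mul, mul_assoc]
          refine mul_le_mul ((hC p).trans (le_abs_self C)) ?_ (norm_nonneg _) (abs_nonneg _)
          refine ((fderiv ℝ (χ k) p).le_opNorm _).trans ?_
          rw [mul_comm]
          exact mul_le_mul_of_nonneg_right ((hp hpφ).trans (le_abs_self M)) (norm_nonneg _)
        · rw [image_eq_zero_of_notMem_tsupport hpφ, zero_mul, norm_zero]
          positivity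
      · rw [integral_const_mul]
        exact mul_le_mul_of_nonneg_left (hχs k) (by positivity)
    · simpa using (tendsto_one_div_add_atTop_nhds_zero_nat (𝕜 := ℝ)).const_mul (|C| * |M|)
  have hmain := tendsto_fluxDefect_cutoff hX hf hβ hφ (fun k => hφ.mul (hχc k))
    (fun k p _ => (hχc k).differentiable one_ne_zero p) (fun k => (hχc k).continuous.measurable)
    hχb (Eventually.of_forall hlim) (Eventually.of_forall hlim) hJ
  simp only [hz] at hmain
  rw [tendsto_nhds_unique tendsto_const_nhds hmain, add_zero, fluxDefect]
  have hμK : μ K = 0 := measure_mono_null inter_subset_right hμZ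
  have hνK : ν K = 0 := measure_mono_null inter_subset_left hν
  congr 1
  · refine integral_congr_ae ?_
    filter_upwards [measure_eq_zero_iff_ae_notMem.1 hμK] with p hp
    simp [hp]
  · refine integral_congr_ae ?_
    filter_upwards [measure_eq_zero_iff_ae_notMem.1 hνK] with p hp
    simp [hp]

end Interior

/-! ### Countable families of fronts -/

section Fronts

/-- A closed piece of a countable union of hypersurfaces lies, near one of its points, in a single
one of them. -/
lemma exists_subset_front_of_baire {E : Type*} [MetricSpace E] [LocallyCompactSpace E]
    [SecondCountableTopology E] {R : Set E} (hR : IsLocallyClosed R) (hne : R.Nonempty)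
    {F : ℕ → Set E} (hRF : R ⊆ ⋃ k, F k)
    (hF : ∀ k, ∀ p ∈ F k, ∃ r > 0, IsClosed (F k ∩ Metric.closedBall p r)) :
    ∃ k, ∃ q ∈ R, ∃ O, IsOpen O ∧ q ∈ O ∧ O ∩ R ⊆ F k := by
  -- by the Lindelöf property each hypersurface is a countable union of closed pieces
  choose! r hr0 hrc using hF
  have hcov := fun k => countable_cover_nhdsWithin (s := F k)
    (f := fun p => F k ∩ Metric.closedBall p (r k p)) fun p hp =>
      inter_mem self_mem_nhdsWithin
        (nhdsWithin_le_nhds (Metric.closedBall_mem_nhds p (hr0 k p hp)))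
  choose t htF htc ht using hcov
  have := hR.locallyCompactSpace
  have : Nonempty R := hne.to_subtype
  have : ∀ k, Countable (t k) := fun k => (htc k).to_subtype
  let A : (Σ k, t k) → Set R := fun i =>
    Subtype.val ⁻¹' (F i.1 ∩ Metric.closedBall i.2.1 (r i.1 i.2.1))
  obtain ⟨i, q, hq⟩ := nonempty_interior_of_iUnion_of_closed (f := A)
    (fun i => (hrc i.1 i.2.1 (htF i.1 i.2.2)).preimage continuous_subtype_val) (by
      refine eq_univ_of_forall fun x => ?_
      obtain ⟨k, hk⟩ := mem_iUnion.1 (hRF x.2)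
      obtain ⟨p, hp, hx⟩ := mem_iUnion₂.1 (ht k hk)
      exact mem_iUnion.2 ⟨⟨k, p, hp⟩, hx⟩)
  obtain ⟨O, hO, hOi⟩ := isOpen_induced_iff.1 (isOpen_interior (s := A i))
  refine ⟨i.1, q.1, q.2, O, hO, ?_, fun x hx => ?_⟩
  · have : q ∈ Subtype.val ⁻¹' O := by rwa [hOi]
    exact this
  · have : (⟨x, hx.2⟩ : R) ∈ Subtype.val ⁻¹' O := hx.1
    rw [hOi] at this
    exact (interior_subset this).1

variable {H : Type*} [NormedAddCommGroup H] [NormedSpace ℝ H] [FiniteDimensional ℝ H]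
  [MeasurableSpace H] [BorelSpace H]

/-- As `exists_implicit_graph`, with `γ` measurable on the whole space: it is set to zero
off the ball. -/
theorem exists_measurable_implicit_graph {g : H × ℝ → ℝ} {V : Set (H × ℝ)} (hV : IsOpen V)
    (hg : ContDiffOn ℝ 1 g V) {u : H × ℝ} (hu : u ∈ V) (h0 : g u = 0)
    (hd : 0 < fderiv ℝ g u (0, 1)) :
    ∃ (γ : H → ℝ) (ρ r : ℝ), 0 < ρ ∧ 0 < r ∧ Measurable γ ∧
      ContDiffOn ℝ 1 γ (Metric.ball u.1 ρ) ∧ γ u.1 = u.2 ∧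
      (∀ y ∈ Metric.ball u.1 ρ, γ y ∈ Metric.ball u.2 r) ∧
      Metric.ball u.1 ρ ×ˢ Metric.ball u.2 r ⊆ V ∧
      ∀ y ∈ Metric.ball u.1 ρ, ∀ t ∈ Metric.ball u.2 r,
        (g (y, t) < 0 ↔ t < γ y) ∧ (0 < g (y, t) ↔ γ y < t) := by
  obtain ⟨γ, ρ, r, hρ, hr, h1, h2, h3, h4, h5⟩ := exists_implicit_graph hV hg hu h0 hd
  have he : ∀ y ∈ Metric.ball u.1 ρ, (Metric.ball u.1 ρ).indicator γ y = γ y := fun y hy =>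
    indicator_of_mem hy γ
  refine ⟨(Metric.ball u.1 ρ).indicator γ, ρ, r, hρ, hr, ?_, h1.congr he, ?_, fun y hy => ?_, h4,
    fun y hy t ht => ?_⟩
  · classical
    rw [← piecewise_eq_indicator]
    exact h1.continuousOn.measurable_piecewise continuousOn_const Metric.isOpen_ball.measurableSet
  · rw [he _ (Metric.mem_ball_self hρ), h2]
  · rw [he y hy]
    exact h3 y hy
  · rw [he y hy]
    exact h5 y hy t ht

/-- At the point `p` of the hypersurface `F` the field `X` has one-sided limits off `W`, with the same
flux through `F`. The hypersurface is transversal to the last axis. -/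
def IsFluxContinuousAt (X : H × ℝ → H × ℝ) (W F : Set (H × ℝ)) (p : H × ℝ) : Prop :=
  ∃ (V : Set (H × ℝ)) (g : H × ℝ → ℝ) (Xp Xm : H × ℝ), IsOpen V ∧ p ∈ V ∧ ContDiffOn ℝ 1 g V ∧
    (∀ q ∈ V, q ∈ F ↔ g q = 0) ∧ fderiv ℝ g p (0, 1) < 0 ∧
    Tendsto X (𝓝[{q | 0 < g q} \ W] p) (𝓝 Xp) ∧ Tendsto X (𝓝[{q | g q < 0} \ W] p) (𝓝 Xm) ∧
    fderiv ℝ g p (Xp - Xm) = 0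

/-- A hypersurface transversal to the last axis is locally the graph of a `C¹` function. -/
lemma exists_graph_of_transversal {F V : Set (H × ℝ)} {g : H × ℝ → ℝ} {p : H × ℝ} (hV : IsOpen V)
    (hpV : p ∈ V) (hg : ContDiffOn ℝ 1 g V) (hF : ∀ q ∈ V, q ∈ F ↔ g q = 0) (hp : p ∈ F)
    (hd : fderiv ℝ g p (0, 1) < 0) :
    ∃ (γ : H → ℝ) (ρ r : ℝ), 0 < ρ ∧ 0 < r ∧ Measurable γ ∧
      ContDiffOn ℝ 1 γ (Metric.ball p.1 ρ) ∧ Metric.ball p.1 ρ ×ˢ Metric.ball p.2 r ⊆ V ∧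
      ∀ y ∈ Metric.ball p.1 ρ, ∀ t ∈ Metric.ball p.2 r, (y, t) ∈ F ↔ t = γ y := by
  obtain ⟨γ, ρ, r, hρ, hr, h1, h2, -, -, h4, h5⟩ := exists_measurable_implicit_graph hV hg.neg hpV
    (by simp [(hF p hpV).1 hp]) (by
      rw [fderiv_fun_neg]
      simpa using hd)
  refine ⟨γ, ρ, r, hρ, hr, h1, h2, h4, fun y hy t ht => ?_⟩
  have h := h5 y hy t ht
  simp only [neg_lt_zero, Left.neg_pos_iff] at h
  rw [hF _ (h4 ⟨hy, ht⟩)]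
  constructor
  · intro h0
    rw [h0] at h
    exact le_antisymm (not_lt.1 fun hlt => lt_irrefl _ (h.2.2 hlt))
      (not_lt.1 fun hlt => lt_irrefl _ (h.1.2 hlt))
  · intro ht
    exact le_antisymm (not_lt.1 fun hlt => (h.1.1 hlt).ne ht)
      (not_lt.1 fun hlt => (h.2.1 hlt).ne' ht)

/-- A hypersurface transversal to the last axis is locally a graph, hence a null set. -/
lemma measure_front_eq_zero (μH : Measure H) [SFinite μH] {X : H × ℝ → H × ℝ} {W F : Set (H × ℝ)}
    (hF : ∀ p ∈ F, IsFluxContinuousAt X W F p) : (μH.prod (volume : Measure ℝ)) F = 0 := by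
  refine measure_null_of_locally_null F fun p hp => ?_
  obtain ⟨V, g, -, -, hV, hpV, hg, hgF, hd, -⟩ := hF p hp
  obtain ⟨γ, ρ, r, hρ, hr, hγm, -, -, h⟩ := exists_graph_of_transversal hV hpV hg hgF hp hd
  refine ⟨{q | q.2 = γ q.1}, ?_, measure_graph_eq_zero μH hγm⟩
  filter_upwards [self_mem_nhdsWithin, nhdsWithin_le_nhds (prod_mem_nhds
    (Metric.ball_mem_nhds p.1 hρ) (Metric.ball_mem_nhds p.2 hr))] with q hqF hq
  exact (h q.1 hq.1 q.2 hq.2).1 hqF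

/-- Near `p`, the functional `T` vanishes. -/
def IsLocallyZeroAt {E : Type*} [NormedAddCommGroup E] [NormedSpace ℝ E] (T : (E → ℝ) → ℝ)
    (p : E) : Prop :=
  ∃ V ∈ 𝓝 p, ∀ ψ, IsC1Test ψ → tsupport ψ ⊆ V → T ψ = 0

lemma isOpen_setOf_isLocallyZeroAt {E : Type*} [NormedAddCommGroup E] [NormedSpace ℝ E]
    (T : (E → ℝ) → ℝ) : IsOpen {p | IsLocallyZeroAt T p} := by
  refine isOpen_iff_mem_nhds.2 fun p ⟨V, hV, h⟩ => ?_
  filter_upwards [eventually_mem_nhds_iff.2 hV] with q hq using ⟨V, hq, h⟩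

/-- A function with negative derivative at a zero changes sign there. -/
lemma eventually_sign_of_hasDerivAt {h : ℝ → ℝ} {d : ℝ} (hd : HasDerivAt h d 0) (h0 : h 0 = 0)
    (hneg : d < 0) : ∀ᶠ s in 𝓝 0, (0 < s → h s < 0) ∧ (s < 0 → 0 < h s) := by
  have h1 := hasDerivAt_iff_tendsto_slope.1 hd
  have h2 : ∀ᶠ s in 𝓝[≠] (0 : ℝ), slope h 0 s < 0 := h1.eventually (gt_mem_nhds hneg)
  rw [eventually_nhdsWithin_iff] at h2
  filter_upwards [h2] with s hs
  have e : s ≠ 0 → h s = slope h 0 s * s := fun hs0 => by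
    rw [slope_def_field, h0]
    field_simp
    ring
  exact ⟨fun hp => by rw [e hp.ne']; exact mul_neg_of_neg_of_pos (hs hp.ne') hp,
    fun hn => by rw [e hn.ne]; exact mul_pos_of_neg_of_neg (hs hn.ne) hn⟩

variable {μH : Measure H} [μH.IsAddHaarMeasure] {ν : Measure (H × ℝ)} {X : H × ℝ → H × ℝ}
  {f β : H × ℝ → ℝ}

/-- The divergence theorem holds across countably many, possibly accumulating, hypersurfaces through
which the flux of the field is continuous. By Baire's theorem the set of the points near which it fails
would locally lie in a single hypersurface, and there the defect is the jump of the flux. -/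
theorem fluxDefect_eq_zero_of_fronts (hX : LocallyIntegrable X (μH.prod volume))
    (hf : LocallyIntegrable f (μH.prod volume)) (hβ : LocallyIntegrable β ν)
    (hM : ∀ K, IsCompact K → ∃ M, ∀ᵐ p ∂(μH.prod volume), p ∈ K → ‖X p‖ ≤ M)
    {Q : Set (H × ℝ)} (hQ : IsOpen Q) (hν : ν Q = 0) {F : ℕ → Set (H × ℝ)} {Z : Set (H × ℝ)}
    (hZ : IsClosed Z) (hμZ : (μH.prod volume) Z = 0)
    (hF : ∀ k, ∀ p ∈ F k, IsFluxContinuousAt X (Z ∪ ⋃ k, F k) (F k) p)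
    (hW : IsClosed (Z ∪ ⋃ k, F k))
    (hoff : ∀ ψ, IsC1Test ψ → tsupport ψ ⊆ Q \ (Z ∪ ⋃ k, F k) →
      fluxDefect (μH.prod volume) ν X f β ψ = 0)
    {φ : H × ℝ → ℝ} (hφ : IsC1Test φ) (hφQ : tsupport φ ⊆ Q \ Z) :
    fluxDefect (μH.prod volume) ν X f β φ = 0 := by
  set T := fluxDefect (μH.prod (volume : Measure ℝ)) ν X f β with hT
  have hadd := fluxDefect_add hX hf hβ
  set W := Z ∪ ⋃ k, F k
  have hμW : (μH.prod volume) W = 0 :=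
    measure_union_null hμZ (measure_iUnion_null fun k => measure_front_eq_zero μH (hF k))
  have hQZ : IsOpen (Q \ Z) := hQ.sdiff hZ
  -- `R` is the set of the points near which the divergence theorem fails
  set R := (Q \ Z) \ {p | IsLocallyZeroAt T p} with hR
  suffices hRe : R = ∅ by
    refine eq_zero_of_locally hadd hφ fun p hp => ?_
    by_contra hcon
    exact (hRe ▸ (⟨hφQ hp, hcon⟩ : p ∈ R) : p ∈ (∅ : Set (H × ℝ)))
  by_contra hne
  have hRc : IsLocallyClosed R :=
    hQZ.isLocallyClosed.inter (isOpen_setOf_isLocallyZeroAt T).isClosed_compl.isLocallyClosed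
  have hRF : R ⊆ ⋃ k, F k := by
    intro p hp
    by_contra hcon
    have hpW : p ∉ W := fun h => h.elim hp.1.2 hcon
    exact hp.2 ⟨Q \ W, (hQ.sdiff hW).mem_nhds ⟨hp.1.1, hpW⟩, hoff⟩
  obtain ⟨k, q, hqR, O, hO, hqO, hOR⟩ := exists_subset_front_of_baire hRc
    (nonempty_iff_ne_empty.2 hne) hRF (by
      intro k p hp
      obtain ⟨V, g, -, -, hV, hpV, hg, hgF, -⟩ := hF k p hp
      obtain ⟨r, hr, hrV⟩ := Metric.nhds_basis_closedBall.mem_iff.1 (hV.mem_nhds hpV)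
      refine ⟨r, hr, ?_⟩
      have : F k ∩ Metric.closedBall p r = Metric.closedBall p r ∩ g ⁻¹' {0} := by
        ext x
        constructor
        · rintro ⟨h1, h2⟩
          exact ⟨h2, (hgF x (hrV h2)).1 h1⟩
        · rintro ⟨h1, h2⟩
          exact ⟨(hgF x (hrV h1)).2 h2, h1⟩
      rw [this]
      exact (hg.continuousOn.mono hrV).preimage_isClosed_of_isClosed Metric.isClosed_closedBall
        isClosed_singleton)
  refine hqR.2 ?_
  have hqF : q ∈ F k := hOR ⟨hqO, hqR⟩
  have hFk := hF k
  choose! V g Xp Xm hV hpV hg hgF hd hp hm hflux using hFk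
  obtain ⟨γ, ρ, r, hρ, hr, hγm, hγ, hbox, hgraph⟩ := exists_graph_of_transversal
    (((hV q hqF).inter hO).inter hQZ) ⟨⟨hpV q hqF, hqO⟩, hqR.1⟩
    ((hg q hqF).mono fun x hx => hx.1.1) (fun x hx => hgF q hqF x hx.1.1) hqF (hd q hqF)
  refine ⟨Metric.ball q.1 ρ ×ˢ Metric.ball q.2 r,
    prod_mem_nhds (Metric.ball_mem_nhds _ hρ) (Metric.ball_mem_nhds _ hr), fun ψ hψ hψs => ?_⟩
  obtain ⟨M, hMψ⟩ := hM _ hψ.hasCompactSupport.isCompact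
  -- the one-sided limits along vertical lines
  have hline : ∀ y : H, (y, γ y) ∈ tsupport ψ → (y, γ y) ∈ F k ∧
      ∀ᶠ s in 𝓝 (0 : ℝ), (0 < s → g (y, γ y) (y, γ y + s) < 0) ∧
        (s < 0 → 0 < g (y, γ y) (y, γ y + s)) := by
    intro y hy
    have hyF : (y, γ y) ∈ F k := (hgraph y (hψs hy).1 (γ y) (hψs hy).2).2 rfl
    refine ⟨hyF, eventually_sign_of_hasDerivAt (d := fderiv ℝ (g (y, γ y)) (y, γ y) (0, 1)) ?_ ?_
      (hd _ hyF)⟩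
    · have h1 : HasFDerivAt (g (y, γ y)) (fderiv ℝ (g (y, γ y)) (y, γ y)) (y, γ y + 0) := by
        rw [add_zero]
        exact (((hg _ hyF).differentiableOn one_ne_zero).differentiableAt
          ((hV _ hyF).mem_nhds (hpV _ hyF))).hasFDerivAt
      exact h1.comp_hasDerivAt 0 ((hasDerivAt_const 0 y).prodMk ((hasDerivAt_id 0).const_add _))
    · rw [add_zero]
      exact (hgF _ hyF _ (hpV _ hyF)).1 hyF
  have hc : ∀ y : H, Tendsto (fun s : ℝ => (y, γ y + s)) (𝓝 0) (𝓝 (y, γ y)) := fun y => by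
    have : Continuous fun s : ℝ => (y, γ y + s) := by fun_prop
    simpa using this.tendsto 0
  rw [hT, fluxDefect_eq_of_graph (ContinuousLinearEquiv.refl ℝ (H × ℝ)) (MeasurePreserving.id _)
    hX hf hβ hψ hγm Metric.isOpen_ball hγ (fun p hp => (hψs hp).1) hMψ ?_ hμW
    (jp := fun y => (Xm (y, γ y)).2 - fderiv ℝ γ y (Xm (y, γ y)).1)
    (jm := fun y => (Xp (y, γ y)).2 - fderiv ℝ γ y (Xp (y, γ y)).1) ?_ ?_]
  · have h1 : ∀ p, {p : H × ℝ | p.2 = γ p.1}.indicator (1 : H × ℝ → ℝ) p * (ψ p * β p) ≠ 0 →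
        p ∈ Q := fun p h => (hbox (hψs (subset_tsupport ψ
          (left_ne_zero_of_mul (right_ne_zero_of_mul h))))).2.1
    have h2 : ∫ p, {p : H × ℝ | p.2 = γ p.1}.indicator (1 : H × ℝ → ℝ) p * (ψ p * β p) ∂ν = 0 := by
      refine integral_eq_zero_of_ae ?_
      filter_upwards [measure_eq_zero_iff_ae_notMem.1 hν] with p hp
      exact not_not.1 fun h => hp (h1 p h)
    change _ + ∫ p, {p : H × ℝ | p.2 = γ p.1}.indicator (1 : H × ℝ → ℝ) p * (ψ p * β p) ∂ν = 0
    rw [h2, add_zero]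
    refine integral_eq_zero_of_ae (Eventually.of_forall fun y => ?_)
    change ψ (y, γ y) * (((Xp (y, γ y)).2 - fderiv ℝ γ y (Xp (y, γ y)).1) -
      ((Xm (y, γ y)).2 - fderiv ℝ γ y (Xm (y, γ y)).1)) = 0
    have hlin : ((Xp (y, γ y)).2 - fderiv ℝ γ y (Xp (y, γ y)).1) -
        ((Xm (y, γ y)).2 - fderiv ℝ γ y (Xm (y, γ y)).1) =
        (Xp (y, γ y) - Xm (y, γ y)).2 - fderiv ℝ γ y (Xp (y, γ y) - Xm (y, γ y)).1 := by
      simp only [Prod.fst_sub, Prod.snd_sub, map_sub]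
      ring
    rw [hlin]
    by_cases hy : (y, γ y) ∈ tsupport ψ
    · have hyF := (hline y hy).1
      have hyB := (hψs hy).1
      set ξ := Xp (y, γ y) - Xm (y, γ y) with hξ
      have hg1 : DifferentiableAt ℝ (g (y, γ y)) (y, γ y) :=
        ((hg _ hyF).differentiableOn one_ne_zero).differentiableAt
          ((hV _ hyF).mem_nhds (hpV _ hyF))
      have hγ1 : DifferentiableAt ℝ γ y :=
        (hγ.differentiableOn one_ne_zero).differentiableAt (Metric.isOpen_ball.mem_nhds hyB)
      have htan := fderiv_apply_tangent hg1 hγ1 (by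
        have hcγ : ContinuousAt (fun z => (z, γ z)) y := continuousAt_id.prodMk hγ1.continuousAt
        have e1 := hcγ.eventually ((hV _ hyF).mem_nhds (hpV _ hyF))
        have e2 := hcγ.eventually ((Metric.isOpen_ball.prod Metric.isOpen_ball).mem_nhds (hψs hy))
        filter_upwards [e1, e2] with z h1 h2
        exact (hgF _ hyF _ h1).1 ((hgraph z h2.1 (γ z) h2.2).2 rfl)) ξ.1
      have hfl := hflux _ hyF
      -- the jump of the field splits into a tangential part, on which the derivative of `g` vanishes, and
      -- a multiple of the last axis, to which the front is transversal
      have hdec : ξ = (ξ.1, fderiv ℝ γ y ξ.1) + (ξ.2 - fderiv ℝ γ y ξ.1) • (0, (1 : ℝ)) := by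
        ext <;> simp
      rw [← hξ, hdec, map_add, htan, map_smul, zero_add, smul_eq_mul] at hfl
      rw [(mul_eq_zero.1 hfl).resolve_right (hd _ hyF).ne, mul_zero]
    · rw [image_eq_zero_of_notMem_tsupport hy, zero_mul]
  · intro χ hχ hχψ hχoff
    refine eq_zero_of_locally hadd hχ fun p hp => ?_
    have hpb := hψs (hχψ hp)
    have hpF : p ∉ F k := fun h => hχoff p hp ((hgraph p.1 hpb.1 p.2 hpb.2).1 h)
    by_contra hcon
    exact hpF (hOR ⟨(hbox hpb).1.2, (hbox hpb).2, hcon⟩)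
  · refine Eventually.of_forall fun y hy => ?_
    obtain ⟨hyF, hs⟩ := hline y hy
    have hcont : Continuous fun ξ : H × ℝ => ξ.2 - fderiv ℝ γ y ξ.1 := by fun_prop
    refine (hcont.tendsto _).comp ?_
    refine (hm _ hyF).comp (tendsto_nhdsWithin_iff.2 ⟨(hc y).mono_left nhdsWithin_le_nhds, ?_⟩)
    filter_upwards [self_mem_nhdsWithin, nhdsWithin_le_nhds hs] with s h1 h2
    exact ⟨h2.1 h1.1, h1.2⟩
  · refine Eventually.of_forall fun y hy => ?_
    obtain ⟨hyF, hs⟩ := hline y hy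
    have hcont : Continuous fun ξ : H × ℝ => ξ.2 - fderiv ℝ γ y ξ.1 := by fun_prop
    refine (hcont.tendsto _).comp ?_
    refine (hp _ hyF).comp (tendsto_nhdsWithin_iff.2 ⟨(hc y).mono_left nhdsWithin_le_nhds, ?_⟩)
    filter_upwards [self_mem_nhdsWithin, nhdsWithin_le_nhds hs] with s h1 h2
    exact ⟨h2.2 h1.1, h1.2⟩

end Fronts

/-! ### Hausdorff measures of null sets and Lipschitz images -/

section HausdorffNull

variable {E : Type*} [NormedAddCommGroup E] [NormedSpace ℝ E] [FiniteDimensional ℝ E]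
  [MeasurableSpace E] [BorelSpace E]

lemma measure_eq_zero_of_hausdorffMeasure (μ : Measure E) [μ.IsAddHaarMeasure] {d : ℕ}
    (hd : d ≤ Module.finrank ℝ E) {s : Set E} (hs : (μH[(d : ℝ)] : Measure E) s = 0) :
    μ s = 0 := by
  have h : (μH[(Module.finrank ℝ E : ℝ)] : Measure E) s = 0 :=
    le_antisymm (hs ▸ Measure.hausdorffMeasure_mono (by exact_mod_cast hd) s) zero_le
  exact (Measure.absolutelyContinuous_isAddHaarMeasure μ _) h

lemma measure_image_eq_zero_of_hausdorffMeasure {E' : Type*} [NormedAddCommGroup E']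
    [MeasurableSpace E'] [BorelSpace E'] (μ : Measure E) [μ.IsAddHaarMeasure] {d : ℕ}
    (hd : d ≤ Module.finrank ℝ E) {K : NNReal} {f : E' → E} (hf : LipschitzWith K f) {s : Set E'}
    (hs : (μH[(d : ℝ)] : Measure E') s = 0) : μ (f '' s) = 0 := by
  refine measure_eq_zero_of_hausdorffMeasure μ hd (le_antisymm ?_ zero_le)
  refine (hf.hausdorffMeasure_image_le (Nat.cast_nonneg d) s).trans ?_
  rw [hs, mul_zero]

lemma LipschitzOnWith.euclideanHausdorffMeasure_image_le {X Y : Type*} [MetricSpace X]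
    [MeasurableSpace X] [BorelSpace X] [MetricSpace Y] [MeasurableSpace Y] [BorelSpace Y]
    {K : NNReal} {f : X → Y} {s : Set X} (hf : LipschitzOnWith K f s) (d : ℕ) :
    (μHE[d] : Measure Y) (f '' s) ≤ (K : ENNReal) ^ d * (μHE[d] : Measure X) s := by
  simp only [Measure.euclideanHausdorffMeasure_def, Measure.smul_apply]
  have h := hf.hausdorffMeasure_image_le (Nat.cast_nonneg (α := ℝ) d)
  rw [ENNReal.rpow_natCast] at h
  rw [ENNReal.smul_def, ENNReal.smul_def, smul_eq_mul, smul_eq_mul, mul_left_comm]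
  exact mul_le_mul_right h _

end HausdorffNull

/-! ### Tangential and normal components -/

section NormalSplit

variable {V : Type*} [NormedAddCommGroup V] [InnerProductSpace ℝ V]

/-- The decomposition of a vector into its tangential and normal components with respect to the unit
vector `e`. -/
def normalSplit (e : V) (he : ‖e‖ = 1) : V ≃L[ℝ] (ℝ ∙ e)ᗮ × ℝ :=
  ContinuousLinearEquiv.equivOfInverse
    (((ℝ ∙ e)ᗮ.orthogonalProjectionOnto).prod (innerSL ℝ e))
    ((ℝ ∙ e)ᗮ.subtypeL.comp (ContinuousLinearMap.fst ℝ (ℝ ∙ e)ᗮ ℝ) +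
      (ContinuousLinearMap.snd ℝ (ℝ ∙ e)ᗮ ℝ).smulRight e)
    (fun x => by
      have h := Submodule.starProjection_add_starProjection_orthogonal (K := ℝ ∙ e) x
      rw [Submodule.starProjection_unit_singleton ℝ he] at h
      rw [add_comm] at h
      exact h)
    (fun q => by
      have h1 : inner ℝ e (q.1 : V) = 0 := Submodule.mem_orthogonal_singleton_iff_inner_right.1 q.1.2
      have h2 : (ℝ ∙ e)ᗮ.orthogonalProjectionOnto e = 0 :=
        Submodule.orthogonalProjectionOnto_orthogonalComplement_singleton_eq_zero e
      ext
      · simp [h2]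
      · simp [h1, inner_add_right, inner_smul_right, he])

@[simp]
lemma normalSplit_apply (e : V) (he : ‖e‖ = 1) (x : V) :
    normalSplit e he x = ((ℝ ∙ e)ᗮ.orthogonalProjectionOnto x, inner ℝ e x) := rfl

@[simp]
lemma normalSplit_symm_apply (e : V) (he : ‖e‖ = 1) (q : (ℝ ∙ e)ᗮ × ℝ) :
    (normalSplit e he).symm q = (q.1 : V) + q.2 • e := rfl

variable [FiniteDimensional ℝ V] [MeasurableSpace V] [BorelSpace V]

lemma measurePreserving_normalSplit (e : V) (he : ‖e‖ = 1) :
    MeasurePreserving (normalSplit e he) volume (volume.prod volume) := by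
  have h1 : MeasurePreserving ((ℝ ∙ e).measurableEquivProd (0 : V)).symm (volume.prod volume)
      (volume : Measure V) := by
    have h := (Submodule.measurePreserving_measurableEquivProd (ℝ ∙ e) (0 : V)).symm
    rw [InnerProductSpace.euclideanHausdorffMeasure_eq_volume] at h
    exact h
  have h2 : MeasurePreserving (Prod.map (LinearIsometryEquiv.toSpanUnitSingleton (𝕜 := ℝ) e he)
      (id : (ℝ ∙ e)ᗮ → (ℝ ∙ e)ᗮ)) (volume.prod volume) (volume.prod volume) :=
    (LinearIsometryEquiv.toSpanUnitSingleton (𝕜 := ℝ) e he).measurePreserving.prod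
      (MeasurePreserving.id volume)
  have h3 : MeasurePreserving (normalSplit e he).symm (volume.prod volume) volume := by
    have h := h1.comp (h2.comp (Measure.measurePreserving_swap
      (μ := (volume : Measure (ℝ ∙ e)ᗮ)) (ν := (volume : Measure ℝ))))
    have heq : ((normalSplit e he).symm : (ℝ ∙ e)ᗮ × ℝ → V) = ((ℝ ∙ e).measurableEquivProd 0).symm ∘
        Prod.map (LinearIsometryEquiv.toSpanUnitSingleton e he) id ∘ Prod.swap := by
      funext q
      simp [add_comm]
    rw [heq]
    exact h
  exact MeasurePreserving.symm (e := (normalSplit e he).symm.toHomeomorph.toMeasurableEquiv) h3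

end NormalSplit

/-! ### The boundary of a Lyapunov domain as a graph -/

section BoundaryChart

lemma eventually_nnnorm_fderiv_lt {H : Type*} [NormedAddCommGroup H] [NormedSpace ℝ H]
    {γ : H → ℝ} {B : Set H} (hB : IsOpen B) (hγ : ContDiffOn ℝ 1 γ B) {u : H} (hu : u ∈ B)
    (h0 : ∀ v, fderiv ℝ γ u v = 0) {ε : NNReal} (hε : 0 < ε) :
    ∀ᶠ y in 𝓝 u, ‖fderiv ℝ γ y‖₊ < ε := by
  have h1 : fderiv ℝ γ u = 0 := ContinuousLinearMap.ext h0
  have hc := ((hγ.continuousOn_fderiv_of_isOpen hB le_rfl).continuousAt (hB.mem_nhds hu)).nnnorm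
  refine hc.eventually (gt_mem_nhds ?_)
  change ‖fderiv ℝ γ u‖₊ < ε
  rwa [h1, nnnorm_zero]

variable {N : ℕ} {Ω : Set (Space N)} {n : Space N → Space N}

lemma IsLyapunovDomain.norm_normal (hΩ : IsLyapunovDomain Ω n) {p : Space N}
    (hp : p ∈ frontier Ω) : ‖n p‖ = 1 := by
  obtain ⟨V, g, -, hpV, -, h⟩ := hΩ.smooth p hp
  obtain ⟨-, h1, h2⟩ := h p hpV
  rw [h2 hp, norm_smul, norm_inv, norm_norm, inv_mul_cancel₀ (norm_ne_zero_iff.2 h1)]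

lemma IsLyapunovDomain.continuousOn_normal (hΩ : IsLyapunovDomain Ω n) :
    ContinuousOn n (frontier Ω) := by
  obtain ⟨C, α, hα, -, h⟩ := hΩ.holder
  exact h.continuousOn hα

/-- In the coordinates given by the normal at a boundary point, the domain is locally the region
below the graph of a `C¹` function with small gradient. -/
theorem IsLyapunovDomain.exists_chart (hΩ : IsLyapunovDomain Ω n) {p : Space N}
    (hp : p ∈ frontier Ω) (he : ‖n p‖ = 1) {ε : NNReal} (hε : 0 < ε) :
    ∃ (γ : (ℝ ∙ n p)ᗮ → ℝ) (ρ r : ℝ), 0 < ρ ∧ 0 < r ∧ Measurable γ ∧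
      ContDiffOn ℝ 1 γ (Metric.ball (normalSplit (n p) he p).1 ρ) ∧
      ∀ y ∈ Metric.ball (normalSplit (n p) he p).1 ρ,
        ‖fderiv ℝ γ y‖₊ ≤ ε ∧ γ y ∈ Metric.ball (normalSplit (n p) he p).2 r ∧
        ‖n ((normalSplit (n p) he).symm (y, γ y)) - n p‖ ≤ ε ∧
        ∀ h ∈ Metric.ball (normalSplit (n p) he p).2 r,
          ((normalSplit (n p) he).symm (y, h) ∈ Ω ↔ h < γ y) ∧
          ((normalSplit (n p) he).symm (y, h) ∈ frontier Ω ↔ h = γ y) := by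
  obtain ⟨V, g, hV, hpV, hg, h⟩ := hΩ.smooth p hp
  set Ψ := normalSplit (n p) he with hΨ
  set u := Ψ p with hu
  have hup : Ψ.symm u = p := Ψ.symm_apply_apply p
  have hfr : ∀ q ∈ frontier Ω, q ∈ V → g q = 0 := by
    intro q hq hqV
    refine le_antisymm ?_ (not_lt.1 fun hlt => ?_)
    · by_contra hcon
      have h1 : ∀ᶠ x in 𝓝 q, 0 < g x :=
        (hg.continuousOn.continuousAt (hV.mem_nhds hqV)).eventually (lt_mem_nhds (not_le.1 hcon))
      have h2 := mem_closure_iff_frequently.1 (frontier_subset_closure hq)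
      obtain ⟨x, hx1, hx2, hx3⟩ := (h2.and_eventually (h1.and (hV.eventually_mem hqV))).exists
      exact lt_asymm hx2 ((h x hx3).1.1 hx1)
    · rw [hΩ.isOpen.frontier_eq] at hq
      exact hq.2 ((h q hqV).1.2 hlt)
  have hgrad : ∀ x ∈ V, HasFDerivAt g (innerSL ℝ (gradient g x)) x := fun x hx =>
    ((hg.differentiableOn one_ne_zero).differentiableAt (hV.mem_nhds hx)).hasGradientAt.hasFDerivAt
  have hnp : gradient g p = ‖gradient g p‖ • n p := by
    rw [(h p hpV).2.2 hp, smul_smul, mul_inv_cancel₀ (norm_ne_zero_iff.2 (h p hpV).2.1), one_smul]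
  set gΨ : (ℝ ∙ n p)ᗮ × ℝ → ℝ := fun q => g (Ψ.symm q) with hgΨ
  have hgΨd : HasFDerivAt gΨ ((innerSL ℝ (gradient g p)).comp
      (Ψ.symm : (ℝ ∙ n p)ᗮ × ℝ →L[ℝ] Space N)) u := by
    have h1 := hgrad p hpV
    rw [← hup] at h1
    have := h1.comp u Ψ.symm.hasFDerivAt
    rwa [hup] at this
  have hVΨ : IsOpen (Ψ.symm ⁻¹' V) := hV.preimage Ψ.symm.continuous
  have hnorm : 0 < ‖gradient g p‖ := norm_pos_iff.2 (h p hpV).2.1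
  have hinner : ∀ y : (ℝ ∙ n p)ᗮ, inner ℝ (n p) (y : Space N) = 0 := fun y =>
    Submodule.mem_orthogonal_singleton_iff_inner_right.1 y.2
  have hDval : ∀ q : (ℝ ∙ n p)ᗮ × ℝ, fderiv ℝ gΨ u q = ‖gradient g p‖ * q.2 := by
    intro q
    rw [hgΨd.fderiv, hnp]
    simp [hΨ, inner_add_right, inner_smul_right, hinner, he, norm_smul]
  obtain ⟨γ, ρ, r, hρ, hr, hγm, hγ, hγu, hγr, hbox, hsign⟩ := exists_measurable_implicit_graph hVΨ
    (hg.comp Ψ.symm.contDiff.contDiffOn fun q hq => hq) (u := u)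
    (show Ψ.symm u ∈ V by rwa [hup]) (show g (Ψ.symm u) = 0 by rw [hup]; exact hfr p hp hpV)
    (by
      change 0 < fderiv ℝ gΨ u (0, 1)
      rw [hDval]
      simpa using hnorm)
  have hgraph0 : ∀ y ∈ Metric.ball u.1 ρ, gΨ (y, γ y) = 0 := by
    intro y hy
    have h1 := hsign y hy (γ y) (hγr y hy)
    exact le_antisymm (not_lt.1 fun hlt => lt_irrefl _ (h1.2.1 hlt))
      (not_lt.1 fun hlt => lt_irrefl _ (h1.1.1 hlt))
  have hΩiff : ∀ y ∈ Metric.ball u.1 ρ, ∀ t ∈ Metric.ball u.2 r,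
      (Ψ.symm (y, t) ∈ Ω ↔ t < γ y) := fun y hy t ht =>
    ((h _ (hbox (mk_mem_prod hy ht))).1).trans (hsign y hy t ht).1
  have hfriff : ∀ y ∈ Metric.ball u.1 ρ, ∀ t ∈ Metric.ball u.2 r,
      (Ψ.symm (y, t) ∈ frontier Ω ↔ t = γ y) := by
    intro y hy t ht
    constructor
    · intro hf
      have h0 : gΨ (y, t) = 0 := hfr _ hf (hbox (mk_mem_prod hy ht))
      have h1 := hsign y hy t ht
      change (gΨ (y, t) < 0 ↔ _) ∧ (0 < gΨ (y, t) ↔ _) at h1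
      rw [h0] at h1
      exact le_antisymm (not_lt.1 fun hlt => lt_irrefl _ (h1.2.2 hlt))
        (not_lt.1 fun hlt => lt_irrefl _ (h1.1.2 hlt))
    · rintro rfl
      rw [hΩ.isOpen.frontier_eq]
      refine ⟨?_, fun hin => lt_irrefl _ ((hΩiff y hy _ ht).1 hin)⟩
      have hc : Tendsto (fun t : ℝ => Ψ.symm (y, t)) (𝓝[<] (γ y)) (𝓝 (Ψ.symm (y, γ y))) := by
        have : Continuous fun t : ℝ => Ψ.symm (y, t) := by fun_prop
        exact (this.tendsto _).mono_left nhdsWithin_le_nhds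
      refine mem_closure_of_tendsto hc ?_
      filter_upwards [self_mem_nhdsWithin, nhdsWithin_le_nhds (Metric.isOpen_ball.mem_nhds ht)]
        with t h1 h2
      exact (hΩiff y hy t h2).2 h1
  have hmem : u.1 ∈ Metric.ball u.1 ρ := Metric.mem_ball_self hρ
  have hγd : DifferentiableAt ℝ γ u.1 :=
    (hγ.differentiableOn one_ne_zero).differentiableAt (Metric.isOpen_ball.mem_nhds hmem)
  -- the gradient of `g` at `p` is a multiple of the normal, so the slope of the graph vanishes at `p`,
  -- and by continuity it is small near `p`
  have hDγ : ∀ y, fderiv ℝ γ u.1 y = 0 := by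
    intro y
    have hu' : (u.1, γ u.1) = u := by rw [hγu]
    have h1 := fderiv_apply_tangent (g := gΨ) (γ := γ) (y := u.1)
      (by rw [hu']; exact hgΨd.differentiableAt) hγd
      (by filter_upwards [Metric.isOpen_ball.mem_nhds hmem] with y hy using hgraph0 y hy) y
    rw [hu', hDval] at h1
    simpa [hnorm.ne'] using h1
  have hev1 : ∀ᶠ y in 𝓝 u.1, ‖fderiv ℝ γ y‖₊ < ε :=
    eventually_nnnorm_fderiv_lt Metric.isOpen_ball hγ hmem hDγ hε
  have hev2 : ∀ᶠ y in 𝓝 u.1, ‖n (Ψ.symm (y, γ y)) - n p‖ < ε := by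
    have hc : ContinuousOn (fun y => n (Ψ.symm (y, γ y))) (Metric.ball u.1 ρ) := by
      refine hΩ.continuousOn_normal.comp
        (Ψ.symm.continuous.comp_continuousOn (continuousOn_id.prodMk hγ.continuousOn)) ?_
      exact fun y hy => (hfriff y hy _ (hγr y hy)).2 rfl
    have hc2 := (((hc.continuousAt (Metric.isOpen_ball.mem_nhds hmem)).sub
      continuousAt_const : ContinuousAt (fun y => n (Ψ.symm (y, γ y)) - n p) u.1)).norm
    refine hc2.eventually (gt_mem_nhds ?_)
    have hu' : (u.1, γ u.1) = u := by rw [hγu]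
    change ‖n (Ψ.symm (u.1, γ u.1)) - n p‖ < ε
    rw [hu', hup, sub_self, norm_zero]
    exact_mod_cast hε
  obtain ⟨δ, hδ, hδs⟩ := Metric.eventually_nhds_iff_ball.1
    (hev1.and (hev2.and (Metric.isOpen_ball.eventually_mem hmem)))
  refine ⟨γ, δ, r, hδ, hr, hγm, hγ.mono fun y hy => (hδs y hy).2.2, fun y hy => ?_⟩
  obtain ⟨h1, h2, h3⟩ := hδs y hy
  exact ⟨h1.le, hγr y h3, h2.le, fun t ht => ⟨hΩiff y h3 t ht, hfriff y h3 t ht⟩⟩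

end BoundaryChart

/-! ### The surface measure in charts -/

section SurfaceMeasure

variable {N : ℕ} {Ω : Set (Space N)} {n : Space N → Space N}

lemma finrank_orthogonal_unit {e : Space N} (he : ‖e‖ = 1) :
    Module.finrank ℝ (ℝ ∙ e)ᗮ = N - 1 := by
  have h := (ℝ ∙ e).finrank_add_finrank_orthogonal
  rw [finrank_span_singleton (norm_ne_zero_iff.1 (by rw [he]; exact one_ne_zero)),
    finrank_euclideanSpace_fin] at h
  omega

/-- A chart of the boundary at a point with unit normal `e`: over the ball of centre `u.1` and radius
`ρ` in the tangent hyperplane the boundary is the graph of `γ`, whose slope is at most `ε`, the domain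
lies below it, and the normal deviates from `e` by at most `ε`. -/
structure IsBoundaryChart (Ω : Set (Space N)) (n : Space N → Space N) (e : Space N) (he : ‖e‖ = 1)
    (u : (ℝ ∙ e)ᗮ × ℝ) (ε : NNReal) (γ : (ℝ ∙ e)ᗮ → ℝ) (ρ r : ℝ) : Prop where
  measurable : Measurable γ
  contDiffOn : ContDiffOn ℝ 1 γ (Metric.ball u.1 ρ)
  slope : ∀ y ∈ Metric.ball u.1 ρ, ‖fderiv ℝ γ y‖₊ ≤ ε
  mem_ball : ∀ y ∈ Metric.ball u.1 ρ, γ y ∈ Metric.ball u.2 r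
  normal : ∀ y ∈ Metric.ball u.1 ρ, ‖n ((normalSplit e he).symm (y, γ y)) - e‖ ≤ ε
  mem_iff : ∀ y ∈ Metric.ball u.1 ρ, ∀ h ∈ Metric.ball u.2 r,
    ((normalSplit e he).symm (y, h) ∈ Ω ↔ h < γ y)
  mem_frontier_iff : ∀ y ∈ Metric.ball u.1 ρ, ∀ h ∈ Metric.ball u.2 r,
    ((normalSplit e he).symm (y, h) ∈ frontier Ω ↔ h = γ y)

namespace IsBoundaryChart

variable {e : Space N} {he : ‖e‖ = 1} {u : (ℝ ∙ e)ᗮ × ℝ} {ε : NNReal} {γ : (ℝ ∙ e)ᗮ → ℝ} {ρ r : ℝ}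

/-- The part of space covered by a chart. -/
def box (_ : IsBoundaryChart Ω n e he u ε γ ρ r) : Set (Space N) :=
  normalSplit e he ⁻¹' (Metric.ball u.1 ρ ×ˢ Metric.ball u.2 r)

/-- The parametrization of the boundary by the tangent hyperplane. -/
def param (_ : IsBoundaryChart Ω n e he u ε γ ρ r) (y : (ℝ ∙ e)ᗮ) : Space N :=
  (normalSplit e he).symm (y, γ y)

variable (h : IsBoundaryChart Ω n e he u ε γ ρ r)

lemma isOpen_box : IsOpen h.box :=
  (Metric.isOpen_ball.prod Metric.isOpen_ball).preimage (normalSplit e he).continuous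

lemma measurable_param : Measurable h.param :=
  (normalSplit e he).symm.continuous.measurable.comp (measurable_id.prodMk h.measurable)

lemma split_param (y : (ℝ ∙ e)ᗮ) : normalSplit e he (h.param y) = (y, γ y) :=
  (normalSplit e he).apply_symm_apply _

lemma param_mem {y : (ℝ ∙ e)ᗮ} (hy : y ∈ Metric.ball u.1 ρ) : h.param y ∈ frontier Ω ∩ h.box := by
  refine ⟨(h.mem_frontier_iff y hy _ (h.mem_ball y hy)).2 rfl, ?_⟩
  rw [box, mem_preimage, split_param]
  exact ⟨hy, h.mem_ball y hy⟩

lemma eq_param {x : Space N} (hx : x ∈ frontier Ω) (hxb : x ∈ h.box) :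
    x = h.param (normalSplit e he x).1 := by
  have h1 := h.mem_frontier_iff (normalSplit e he x).1 hxb.1 (normalSplit e he x).2 hxb.2
  rw [Prod.mk.eta, ContinuousLinearEquiv.symm_apply_apply] at h1
  rw [param, ← h1.1 hx, Prod.mk.eta, ContinuousLinearEquiv.symm_apply_apply]

lemma lipschitzOnWith_param : LipschitzOnWith (1 + ε) h.param (Metric.ball u.1 ρ) := by
  have hγ : LipschitzOnWith ε γ (Metric.ball u.1 ρ) :=
    (convex_ball _ _).lipschitzOnWith_of_nnnorm_fderiv_le (𝕜 := ℝ)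
      (fun y hy => (h.contDiffOn.differentiableOn one_ne_zero).differentiableAt
        (Metric.isOpen_ball.mem_nhds hy)) h.slope
  refine LipschitzOnWith.of_dist_le_mul fun y hy z hz => ?_
  have h1 := hγ.dist_le_mul y hy z hz
  have h2 : h.param y - h.param z = ((y - z : (ℝ ∙ e)ᗮ) : Space N) + (γ y - γ z) • e := by
    simp only [param, normalSplit_symm_apply, Submodule.coe_sub, sub_smul]
    abel
  rw [dist_eq_norm, h2]
  refine (norm_add_le _ _).trans ?_
  rw [norm_smul, he, mul_one, NNReal.coe_add, NNReal.coe_one, add_mul, one_mul]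
  refine add_le_add ?_ h1
  rw [dist_eq_norm]
  rfl

/-- The Lebesgue measure of the tangent hyperplane, carried over to the boundary. -/
def flatMeasure : Measure (Space N) := (volume.restrict (Metric.ball u.1 ρ)).map h.param

instance : IsFiniteMeasure h.flatMeasure := by
  have : IsFiniteMeasure (volume.restrict (Metric.ball u.1 ρ)) :=
    ⟨by simpa using measure_ball_lt_top⟩
  exact Measure.isFiniteMeasure_map _ _

lemma flatMeasure_apply {A : Set (Space N)} (hA : MeasurableSet A) :
    h.flatMeasure A = (μHE[N - 1] : Measure (ℝ ∙ e)ᗮ) (h.param ⁻¹' A ∩ Metric.ball u.1 ρ) := by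
  have := InnerProductSpace.euclideanHausdorffMeasure_eq_volume (V := (ℝ ∙ e)ᗮ)
  rw [finrank_orthogonal_unit he] at this
  rw [flatMeasure, Measure.map_apply h.measurable_param hA,
    Measure.restrict_apply (h.measurable_param hA), this]

/-- The part of the surface measure seen by a chart. -/
def curvedMeasure : Measure (Space N) := (surfaceMeasure Ω).restrict h.box

lemma curvedMeasure_apply {A : Set (Space N)} (hA : MeasurableSet A) :
    h.curvedMeasure A = (μHE[N - 1] : Measure (Space N))
      (h.param '' (h.param ⁻¹' A ∩ Metric.ball u.1 ρ)) := by
  rw [curvedMeasure, surfaceMeasure, Measure.restrict_restrict h.isOpen_box.measurableSet,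
    Measure.restrict_apply hA]
  congr 1
  ext x
  constructor
  · rintro ⟨hxA, hxb, hx⟩
    refine ⟨(normalSplit e he x).1, ⟨?_, hxb.1⟩, (h.eq_param hx hxb).symm⟩
    change h.param _ ∈ A
    rwa [← h.eq_param hx hxb]
  · rintro ⟨y, ⟨hyA, hy⟩, rfl⟩
    exact ⟨hyA, (h.param_mem hy).2, (h.param_mem hy).1⟩

/-- The orthogonal projection to the tangent hyperplane does not increase the surface measure. -/
lemma flatMeasure_le : h.flatMeasure ≤ h.curvedMeasure := by
  refine Measure.le_iff.2 fun A hA => ?_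
  rw [h.flatMeasure_apply hA, h.curvedMeasure_apply hA]
  have hL : LipschitzOnWith 1 (fun x => (normalSplit e he x).1)
      (h.param '' (h.param ⁻¹' A ∩ Metric.ball u.1 ρ)) :=
    ((ℝ ∙ e)ᗮ.lipschitzWith_orthogonalProjectionOnto).lipschitzOnWith
  have h1 := hL.euclideanHausdorffMeasure_image_le (N - 1)
  rw [ENNReal.coe_one, one_pow, one_mul, image_image] at h1
  simpa only [split_param, image_id'] using h1

/-- The parametrization is Lipschitz with constant `1 + ε`, so the surface measure exceeds the flat one
by a factor of at most `(1 + ε) ^ (N - 1)`. -/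
lemma curvedMeasure_le : h.curvedMeasure ≤ ((1 + ε : NNReal) : ENNReal) ^ (N - 1) • h.flatMeasure := by
  refine Measure.le_iff.2 fun A hA => ?_
  rw [Measure.smul_apply, h.flatMeasure_apply hA, h.curvedMeasure_apply hA, smul_eq_mul]
  exact (h.lipschitzOnWith_param.mono inter_subset_right).euclideanHausdorffMeasure_image_le (N - 1)

/-- In a chart, almost no point of the lateral boundary lies in a set of zero `N`-dimensional
measure. -/
lemma ae_notMem (hN : 1 ≤ N) {Z : Set (SpaceTime N)}
    (hZ : (μH[(N : ℝ)] : Measure (SpaceTime N)) Z = 0) :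
    ∀ᵐ q ∂((volume : Measure (ℝ ∙ e)ᗮ).prod (volume : Measure ℝ)), (h.param q.1, q.2) ∉ Z := by
  have hL : LipschitzWith 1 (Prod.map (fun x => (normalSplit e he x).1) (id : ℝ → ℝ)) := by
    have h1 : LipschitzWith 1 fun x => (normalSplit e he x).1 :=
      (ℝ ∙ e)ᗮ.lipschitzWith_orthogonalProjectionOnto
    have h2 := (h1.comp (LipschitzWith.prod_fst (α := Space N) (β := ℝ))).prodMk
      LipschitzWith.prod_snd
    rw [one_mul, max_self] at h2
    exact h2
  have hfr : N ≤ Module.finrank ℝ ((ℝ ∙ e)ᗮ × ℝ) := by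
    rw [Module.finrank_prod, finrank_orthogonal_unit he, Module.finrank_self]
    omega
  have h0 := measure_image_eq_zero_of_hausdorffMeasure
    ((volume : Measure (ℝ ∙ e)ᗮ).prod (volume : Measure ℝ)) hfr hL hZ
  filter_upwards [measure_eq_zero_iff_ae_notMem.1 h0] with x hx hxZ
  refine hx ⟨_, hxZ, ?_⟩
  change ((normalSplit e he (h.param x.1)).1, x.2) = x
  rw [h.split_param]

end IsBoundaryChart

lemma IsLyapunovDomain.exists_isBoundaryChart (hΩ : IsLyapunovDomain Ω n) {p : Space N}
    (hp : p ∈ frontier Ω) {ε : NNReal} (hε : 0 < ε) :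
    ∃ (he : ‖n p‖ = 1) (γ : (ℝ ∙ n p)ᗮ → ℝ) (ρ r : ℝ)
      (h : IsBoundaryChart Ω n (n p) he (normalSplit (n p) he p) ε γ ρ r), p ∈ h.box := by
  obtain ⟨γ, ρ, r, hρ, hr, h1, h2, h3⟩ := hΩ.exists_chart hp (hΩ.norm_normal hp) hε
  refine ⟨hΩ.norm_normal hp, γ, ρ, r, ⟨h1, h2, fun y hy => (h3 y hy).1,
    fun y hy => (h3 y hy).2.1, fun y hy => (h3 y hy).2.2.1,
    fun y hy t ht => ((h3 y hy).2.2.2 t ht).1, fun y hy t ht => ((h3 y hy).2.2.2 t ht).2⟩, ?_⟩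
  exact ⟨Metric.mem_ball_self hρ, Metric.mem_ball_self hr⟩

lemma IsLyapunovDomain.isCompact_frontier (hΩ : IsLyapunovDomain Ω n) : IsCompact (frontier Ω) :=
  Metric.isCompact_of_isClosed_isBounded isClosed_frontier
    (hΩ.isBounded.closure.subset frontier_subset_closure)

lemma IsLyapunovDomain.isFiniteMeasure_surfaceMeasure (hΩ : IsLyapunovDomain Ω n) :
    IsFiniteMeasure (surfaceMeasure Ω) := by
  refine ⟨?_⟩
  have h0 : surfaceMeasure Ω univ = surfaceMeasure Ω (frontier Ω) := by
    simp [surfaceMeasure]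
  rw [h0]
  refine hΩ.isCompact_frontier.measure_lt_top_of_nhdsWithin fun p hp => ?_
  obtain ⟨he, γ, ρ, r, h, hpb⟩ := hΩ.exists_isBoundaryChart hp one_pos
  refine ⟨h.box, nhdsWithin_le_nhds (h.isOpen_box.mem_nhds hpb), ?_⟩
  have h1 := h.curvedMeasure_le univ
  rw [IsBoundaryChart.curvedMeasure, Measure.restrict_apply_univ] at h1
  refine h1.trans_lt ?_
  rw [Measure.smul_apply, smul_eq_mul]
  exact ENNReal.mul_lt_top (ENNReal.pow_lt_top ENNReal.coe_lt_top) (measure_lt_top _ _)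

lemma IsLyapunovDomain.volume_frontier (hN : 1 ≤ N) (hΩ : IsLyapunovDomain Ω n) :
    volume (frontier Ω) = 0 := by
  have h1 := hΩ.isFiniteMeasure_surfaceMeasure
  have h2 : (μHE[N - 1] : Measure (Space N)) (frontier Ω) ≠ ⊤ := by
    have := (measure_lt_top (surfaceMeasure Ω) univ).ne
    rwa [surfaceMeasure, Measure.restrict_apply_univ] at this
  have h3 := (Measure.euclideanHausdorffMeasure_zero_or_top (show N - 1 < N by omega)
    (frontier Ω)).resolve_right h2
  have h4 := InnerProductSpace.euclideanHausdorffMeasure_eq_volume (V := Space N)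
  rw [finrank_euclideanSpace_fin] at h4
  rwa [h4] at h3

/-- A set of zero `N`-dimensional measure is negligible on the lateral boundary. -/
lemma IsLyapunovDomain.lateral_eq_zero (hN : 1 ≤ N) (hΩ : IsLyapunovDomain Ω n)
    {Z : Set (SpaceTime N)} (hZ : (μH[(N : ℝ)] : Measure (SpaceTime N)) Z = 0)
    (hZm : MeasurableSet Z) : lateral Ω Z = 0 := by
  have := hΩ.isFiniteMeasure_surfaceMeasure
  have h0 : lateral Ω (frontier Ω ×ˢ univ)ᶜ = 0 := by
    have : (frontier Ω ×ˢ (univ : Set ℝ))ᶜ = (frontier Ω)ᶜ ×ˢ univ := by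
      ext q
      simp
    rw [this, lateral, Measure.prod_prod]
    simp [surfaceMeasure, isClosed_frontier.measurableSet]
  refine measure_mono_null (t := (Z ∩ frontier Ω ×ˢ univ) ∪ (frontier Ω ×ˢ univ)ᶜ)
    (fun q hq => ?_) (measure_union_null ?_ h0)
  · by_cases h : q ∈ frontier Ω ×ˢ (univ : Set ℝ)
    · exact Or.inl ⟨hq, h⟩
    · exact Or.inr h
  refine measure_null_of_locally_null _ fun q hq => ?_
  obtain ⟨he, γ, ρ, r, h, hpb⟩ := hΩ.exists_isBoundaryChart hq.2.1 one_pos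
  refine ⟨Z ∩ h.box ×ˢ univ, ?_, ?_⟩
  · exact inter_mem (mem_of_superset self_mem_nhdsWithin inter_subset_left)
      (nhdsWithin_le_nhds (prod_mem_nhds (h.isOpen_box.mem_nhds hpb) univ_mem))
  · have e1 : lateral Ω (Z ∩ h.box ×ˢ univ) =
        (h.curvedMeasure.prod (volume.restrict (Ici (0 : ℝ)))) Z := by
      rw [IsBoundaryChart.curvedMeasure, lateral, ← Measure.restrict_apply hZm,
        ← Measure.prod_restrict, Measure.restrict_univ]
    have e2 : h.curvedMeasure ≪ h.flatMeasure :=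
      (Measure.absolutelyContinuous_of_le h.curvedMeasure_le).trans
        Measure.smul_absolutelyContinuous
    have : IsFiniteMeasure h.curvedMeasure := by
      rw [IsBoundaryChart.curvedMeasure]
      infer_instance
    rw [e1]
    refine (e2.prod Measure.absolutelyContinuous_restrict) ?_
    have e3 : h.flatMeasure.prod (volume : Measure ℝ) =
        ((volume.restrict (Metric.ball (normalSplit (n q.1) he q.1).1 ρ)).prod volume).map
          (Prod.map h.param id) := by
      rw [← Measure.map_prod_map _ _ h.measurable_param measurable_id, Measure.map_id]
      rfl
    rw [e3, Measure.map_apply (h.measurable_param.prodMap measurable_id) hZm]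
    refine (Measure.absolutelyContinuous_restrict.prod Measure.AbsolutelyContinuous.rfl :
      _ ≪ (volume : Measure (ℝ ∙ n q.1)ᗮ).prod (volume : Measure ℝ)) ?_
    exact measure_eq_zero_iff_ae_notMem.2 (h.ae_notMem hN hZ)

/-- Almost every line parallel to the time axis avoids a set of zero `N`-dimensional measure. -/
lemma ae_forall_notMem_of_hausdorffMeasure {Z : Set (SpaceTime N)}
    (hZ : (μH[(N : ℝ)] : Measure (SpaceTime N)) Z = 0) :
    ∀ᵐ x : Space N, ∀ t, (x, t) ∉ Z := by
  have h := measure_image_eq_zero_of_hausdorffMeasure (volume : Measure (Space N)) (d := N)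
    (by simp) (LipschitzWith.prod_fst (α := Space N) (β := ℝ)) hZ
  filter_upwards [measure_eq_zero_iff_ae_notMem.1 h] with x hx t ht
  exact hx ⟨(x, t), ht, rfl⟩

lemma volume_eq_zero_of_hausdorffMeasure {Z : Set (SpaceTime N)}
    (hZ : (μH[(N : ℝ)] : Measure (SpaceTime N)) Z = 0) : volume Z = 0 :=
  measure_eq_zero_of_hausdorffMeasure ((volume : Measure (Space N)).prod (volume : Measure ℝ))
    (d := N) (by simp) hZ

end SurfaceMeasure

/-! ### Locally bounded fields -/

section LocallyBounded

variable {E : Type*} [NormedAddCommGroup E] [NormedSpace ℝ E] [FiniteDimensional ℝ E]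
  [MeasurableSpace E] [BorelSpace E] {μ : Measure E} [IsLocallyFiniteMeasure μ]

lemma locallyIntegrable_of_ae_bounded {E' : Type*} [NormedAddCommGroup E'] {X : E → E'}
    (hX : AEStronglyMeasurable X μ)
    (hM : ∀ K, IsCompact K → ∃ M, ∀ᵐ p ∂μ, p ∈ K → ‖X p‖ ≤ M) : LocallyIntegrable X μ := by
  refine locallyIntegrable_iff.2 fun K hK => ?_
  obtain ⟨M, hM⟩ := hM K hK
  exact Measure.integrableOn_of_bounded hK.measure_ne_top hX
    ((ae_restrict_iff' hK.measurableSet).2 hM)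

end LocallyBounded

/-! ### Fields with shocks on the semicylinder -/

section ShockField

variable {N : ℕ} {Ω : Set (Space N)} {n : Space N → Space N} {F : ℕ → Set (SpaceTime N)}
  {Z : Set (SpaceTime N)} {Y : SpaceTime N → SpaceTime N} {f : SpaceTime N → ℝ}

/-- The exceptional set `Z` and the fronts `F k` are placed in the semicylinder over `Ω` as in the
definition of classical solutions. -/
structure IsFrontSystem (Ω : Set (Space N)) (F : ℕ → Set (SpaceTime N)) (Z : Set (SpaceTime N)) :
    Prop where
  isClosed_exceptional : IsClosed Z
  exceptional_null : (μH[(N : ℝ)] : Measure (SpaceTime N)) Z = 0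
  front_subset : ∀ k, F k ⊆ Ω ×ˢ Ioi 0
  isClosed_fronts : IsClosed (Z ∪ ⋃ k, F k)

/-- The field `Y` has divergence `f` in the semicylinder off the fronts, its flux is continuous across
the fronts, it is bounded for bounded times, and its normal components extend continuously to the
boundary. -/
structure IsShockField (Ω : Set (Space N)) (F : ℕ → Set (SpaceTime N)) (Z : Set (SpaceTime N))
    (Y : SpaceTime N → SpaceTime N) (f : SpaceTime N → ℝ) : Prop where
  contDiffOn : ContDiffOn ℝ 1 Y ((Ω ×ˢ Ioi 0) \ (Z ∪ ⋃ k, F k))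
  divergence : ∀ p ∈ (Ω ×ˢ Ioi 0) \ (Z ∪ ⋃ k, F k),
    ∑ j : Fin N, (fderiv ℝ Y p (spaceDir j)).1 j + (fderiv ℝ Y p (timeDir N)).2 = f p
  flux : ∀ k, ∀ p ∈ F k, IsFluxContinuousAt Y (Z ∪ ⋃ k, F k) (F k) p
  bounded : ∀ T : ℝ, ∃ M : ℝ, ∀ p ∈ (Ω ×ˢ Ioc 0 T) \ (Z ∪ ⋃ k, F k), ‖Y p‖ ≤ M
  continuousOn_fst : ContinuousOn (fun p => (Y p).1) ((closure Ω ×ˢ Ioi 0) \ (Z ∪ ⋃ k, F k))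
  continuousOn_snd : ContinuousOn (fun p => (Y p).2) ((Ω ×ˢ Ici 0) \ (Z ∪ ⋃ k, F k))
  locallyIntegrable : LocallyIntegrable ((Ω ×ˢ Ioi 0).indicator f) volume

lemma IsFrontSystem.mem_closure (hF : IsFrontSystem Ω F Z) {p : SpaceTime N} (h1 : p.1 ∈ closure Ω)
    (h2 : 0 ≤ p.2) (h3 : p ∉ Z ∪ ⋃ k, F k) {T : ℝ} (hT : p.2 < T) :
    p ∈ closure ((Ω ×ˢ Ioo 0 T) \ (Z ∪ ⋃ k, F k)) := by
  have h4 : p ∈ closure (Ω ×ˢ Ioo 0 T) := by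
    rw [closure_prod_eq, closure_Ioo (h2.trans_lt hT).ne]
    exact ⟨h1, h2, hT.le⟩
  have h5 := hF.isClosed_fronts.isOpen_compl.inter_closure (t := Ω ×ˢ Ioo 0 T) ⟨h3, h4⟩
  rwa [inter_comm] at h5

lemma IsFrontSystem.notMem_fronts (hF : IsFrontSystem Ω F Z) {p : SpaceTime N}
    (h : p ∉ Ω ×ˢ Ioi (0 : ℝ)) (hZ : p ∉ Z) : p ∉ Z ∪ ⋃ k, F k := by
  rintro (h1 | h1)
  · exact hZ h1
  · obtain ⟨k, hk⟩ := mem_iUnion.1 h1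
    exact h (hF.front_subset k hk)

namespace IsShockField

variable (hF : IsFrontSystem Ω F Z) (hY : IsShockField Ω F Z Y f)
include hF hY

lemma volume_fronts : volume (Z ∪ ⋃ k, F k) = 0 :=
  measure_union_null (volume_eq_zero_of_hausdorffMeasure hF.exceptional_null)
    (measure_iUnion_null fun k => measure_front_eq_zero volume (hY.flux k))

lemma norm_fst_le {T M : ℝ} (hM : ∀ p ∈ (Ω ×ˢ Ioc 0 T) \ (Z ∪ ⋃ k, F k), ‖Y p‖ ≤ M)
    {p : SpaceTime N} (h1 : p.1 ∈ closure Ω) (h2 : 0 < p.2) (h3 : p ∉ Z ∪ ⋃ k, F k)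
    (hT : p.2 < T) : ‖(Y p).1‖ ≤ M := by
  refine ContinuousWithinAt.closure_le (hF.mem_closure h1 h2.le h3 hT) ?_
    continuousWithinAt_const (g := fun _ => M) (f := fun p => ‖(Y p).1‖) fun q hq => ?_
  · refine (hY.continuousOn_fst.norm p ⟨⟨h1, h2⟩, h3⟩).mono fun q hq => ?_
    exact ⟨⟨subset_closure hq.1.1, hq.1.2.1⟩, hq.2⟩
  · exact (_root_.norm_fst_le _).trans (hM q ⟨⟨hq.1.1, hq.1.2.1, hq.1.2.2.le⟩, hq.2⟩)

lemma abs_snd_le {T M : ℝ} (hM : ∀ p ∈ (Ω ×ˢ Ioc 0 T) \ (Z ∪ ⋃ k, F k), ‖Y p‖ ≤ M)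
    {p : SpaceTime N} (h1 : p.1 ∈ Ω) (h2 : 0 ≤ p.2) (h3 : p ∉ Z ∪ ⋃ k, F k)
    (hT : p.2 < T) : |(Y p).2| ≤ M := by
  refine ContinuousWithinAt.closure_le (hF.mem_closure (subset_closure h1) h2 h3 hT) ?_
    continuousWithinAt_const (g := fun _ => M) (f := fun p => |(Y p).2|) fun q hq => ?_
  · refine (hY.continuousOn_snd.abs p ⟨⟨h1, h2⟩, h3⟩).mono fun q hq => ?_
    exact ⟨⟨hq.1.1, hq.1.2.1.le⟩, hq.2⟩
  · exact (_root_.norm_snd_le _).trans (hM q ⟨⟨hq.1.1, hq.1.2.1, hq.1.2.2.le⟩, hq.2⟩)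

end IsShockField

lemma exists_time_bound {K : Set (SpaceTime N)} (hK : IsCompact K) : ∃ T, ∀ p ∈ K, p.2 < T := by
  obtain ⟨T, hT⟩ := hK.bddAbove_image (f := Prod.snd) continuous_snd.continuousOn
  exact ⟨T + 1, fun p hp => by linarith [hT ⟨p, hp, rfl⟩]⟩

/-- The bottom `Ω × {0}` of the semicylinder, with the Lebesgue measure. -/
def bottom (Ω : Set (Space N)) : Measure (SpaceTime N) :=
  (volume.restrict Ω).prod (Measure.dirac (0 : ℝ))

lemma ae_lateral (hN : 1 ≤ N) (hΩ : IsLyapunovDomain Ω n) (hF : IsFrontSystem Ω F Z) :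
    ∀ᵐ p ∂lateral Ω, p ∈ (frontier Ω ×ˢ Ioi (0 : ℝ)) \ Z := by
  have := hΩ.isFiniteMeasure_surfaceMeasure
  have h1 : ∀ᵐ p ∂lateral Ω, p.1 ∈ frontier Ω :=
    Measure.quasiMeasurePreserving_fst.ae
      (ae_restrict_mem isClosed_frontier.measurableSet : ∀ᵐ x ∂surfaceMeasure Ω, x ∈ frontier Ω)
  have h2 : ∀ᵐ p ∂lateral Ω, p.2 ∈ Ioi (0 : ℝ) := by
    refine Measure.quasiMeasurePreserving_snd.ae ?_
    rw [← restrict_Ioi_eq_restrict_Ici]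
    exact ae_restrict_mem measurableSet_Ioi
  have h3 := measure_eq_zero_iff_ae_notMem.1
    (hΩ.lateral_eq_zero hN hF.exceptional_null hF.isClosed_exceptional.measurableSet)
  filter_upwards [h1, h2, h3] with p a b c using ⟨⟨a, b⟩, c⟩

lemma ae_bottom (hΩ : IsOpen Ω) (hF : IsFrontSystem Ω F Z) :
    ∀ᵐ p ∂bottom Ω, p ∈ (Ω ×ˢ {(0 : ℝ)}) \ Z := by
  have h1 : ∀ᵐ p ∂bottom Ω, p.1 ∈ Ω :=
    Measure.quasiMeasurePreserving_fst.ae (ae_restrict_mem hΩ.measurableSet)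
  have h0 : ∀ᵐ s ∂(Measure.dirac (0 : ℝ)), s = 0 := by
    rw [ae_dirac_eq]
    exact eventually_pure.2 rfl
  have h2 : ∀ᵐ p ∂bottom Ω, p.2 = 0 := Measure.quasiMeasurePreserving_snd.ae h0
  have h3 : ∀ᵐ p ∂bottom Ω, ∀ t, (p.1, t) ∉ Z :=
    Measure.quasiMeasurePreserving_fst.ae
      (ae_restrict_of_ae (ae_forall_notMem_of_hausdorffMeasure hF.exceptional_null))
  filter_upwards [h1, h2, h3] with p a b c using ⟨⟨a, b⟩, c p.2⟩

lemma frontier_notMem (hΩ : IsOpen Ω) {x : Space N} (hx : x ∈ frontier Ω) : x ∉ Ω := by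
  rw [hΩ.frontier_eq] at hx
  exact hx.2

lemma aestronglyMeasurable_of_continuousOn_ae {μ : Measure (SpaceTime N)} {E' : Type*}
    [NormedAddCommGroup E'] [SecondCountableTopology E'] {g : SpaceTime N → E'} {A : Set (SpaceTime N)}
    (hA : MeasurableSet A) (hg : ContinuousOn g A) (h : ∀ᵐ p ∂μ, p ∈ A) :
    AEStronglyMeasurable g μ := by
  rw [← Measure.restrict_eq_self_of_ae_mem h]
  exact hg.aestronglyMeasurable hA

namespace IsShockField

lemma aestronglyMeasurable_fst_lateral (hN : 1 ≤ N) (hΩ : IsLyapunovDomain Ω n)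
    (hF : IsFrontSystem Ω F Z) (hY : IsShockField Ω F Z Y f) :
    AEStronglyMeasurable (fun p => (Y p).1) (lateral Ω) :=
  aestronglyMeasurable_of_continuousOn_ae
    ((isClosed_frontier.measurableSet.prod measurableSet_Ioi).diff
      hF.isClosed_exceptional.measurableSet)
    (hY.continuousOn_fst.mono fun _ hp => ⟨⟨frontier_subset_closure hp.1.1, hp.1.2⟩,
      hF.notMem_fronts (fun h => frontier_notMem hΩ.isOpen hp.1.1 h.1) hp.2⟩)
    (ae_lateral hN hΩ hF)

lemma ae_bounded_fst_lateral (hN : 1 ≤ N) (hΩ : IsLyapunovDomain Ω n)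
    (hF : IsFrontSystem Ω F Z) (hY : IsShockField Ω F Z Y f) {T M : ℝ}
    (hM : ∀ p ∈ (Ω ×ˢ Ioc 0 T) \ (Z ∪ ⋃ k, F k), ‖Y p‖ ≤ M) :
    ∀ᵐ p ∂lateral Ω, p.2 < T → ‖(Y p).1‖ ≤ M := by
  filter_upwards [ae_lateral hN hΩ hF] with p hp hT
  exact hY.norm_fst_le hF hM (frontier_subset_closure hp.1.1) hp.1.2
    (hF.notMem_fronts (fun h => frontier_notMem hΩ.isOpen hp.1.1 h.1) hp.2) hT

lemma locallyIntegrable_flux_lateral (hN : 1 ≤ N) (hΩ : IsLyapunovDomain Ω n)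
    (hF : IsFrontSystem Ω F Z) (hY : IsShockField Ω F Z Y f) :
    LocallyIntegrable (fun p => inner ℝ (Y p).1 (n p.1)) (lateral Ω) := by
  have := hΩ.isFiniteMeasure_surfaceMeasure
  have hn : AEStronglyMeasurable (fun p : SpaceTime N => n p.1) (lateral Ω) :=
    aestronglyMeasurable_of_continuousOn_ae (isClosed_frontier.measurableSet.prod
      (MeasurableSet.univ (α := ℝ)))
      (hΩ.continuousOn_normal.comp continuous_fst.continuousOn fun p hp => hp.1)
      (by filter_upwards [ae_lateral hN hΩ hF] with _ hp using ⟨hp.1.1, mem_univ _⟩)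
  have : IsLocallyFiniteMeasure (lateral Ω) := by
    unfold lateral
    infer_instance
  refine locallyIntegrable_of_ae_bounded
    ((hY.aestronglyMeasurable_fst_lateral hN hΩ hF).inner hn) fun K hK => ?_
  obtain ⟨T, hT⟩ := exists_time_bound hK
  obtain ⟨M, hM⟩ := hY.bounded T
  refine ⟨M, ?_⟩
  filter_upwards [hY.ae_bounded_fst_lateral hN hΩ hF hM, ae_lateral hN hΩ hF] with p h1 h2 hpK
  refine (norm_inner_le_norm _ _).trans ?_
  rw [hΩ.norm_normal h2.1.1, mul_one]
  exact h1 (hT p hpK)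

lemma locallyIntegrable_flux_bottom (hΩ : IsOpen Ω) (hF : IsFrontSystem Ω F Z)
    (hY : IsShockField Ω F Z Y f) :
    LocallyIntegrable (fun p => (Y p).2) (bottom Ω) := by
  have hsub : ∀ p ∈ (Ω ×ˢ {(0 : ℝ)}) \ Z, p ∉ Z ∪ ⋃ k, F k := fun p hp =>
    hF.notMem_fronts (fun h => (mem_Ioi.1 h.2).ne' hp.1.2) hp.2
  have : IsLocallyFiniteMeasure (bottom Ω) := by
    unfold bottom
    infer_instance
  refine locallyIntegrable_of_ae_bounded (aestronglyMeasurable_of_continuousOn_ae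
    ((hΩ.measurableSet.prod (measurableSet_singleton 0)).diff
      hF.isClosed_exceptional.measurableSet)
    (hY.continuousOn_snd.mono fun p hp => ⟨⟨hp.1.1, (mem_singleton_iff.1 hp.1.2).ge⟩, hsub p hp⟩)
    (ae_bottom hΩ hF)) fun K hK => ?_
  obtain ⟨T, hT⟩ := exists_time_bound hK
  obtain ⟨M, hM⟩ := hY.bounded T
  refine ⟨M, ?_⟩
  filter_upwards [ae_bottom hΩ hF] with p hp hpK
  exact hY.abs_snd_le hF hM hp.1.1 (mem_singleton_iff.1 hp.1.2).ge (hsub p hp) (hT p hpK)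

lemma aestronglyMeasurable_indicator (hΩ : IsOpen Ω) (hF : IsFrontSystem Ω F Z)
    (hY : IsShockField Ω F Z Y f) : AEStronglyMeasurable ((Ω ×ˢ Ioi 0).indicator Y) volume := by
  have hQ : IsOpen (Ω ×ˢ Ioi (0 : ℝ)) := hΩ.prod isOpen_Ioi
  have hQW := hQ.sdiff hF.isClosed_fronts
  have h1 : AEStronglyMeasurable (((Ω ×ˢ Ioi 0) \ (Z ∪ ⋃ k, F k)).indicator Y) volume :=
    (aestronglyMeasurable_indicator_iff hQW.measurableSet).2
      (hY.contDiffOn.continuousOn.aestronglyMeasurable hQW.measurableSet)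
  refine h1.congr ?_
  filter_upwards [measure_eq_zero_iff_ae_notMem.1 (hY.volume_fronts hF)] with p hp
  by_cases hpQ : p ∈ Ω ×ˢ Ioi (0 : ℝ)
  · rw [indicator_of_mem hpQ, indicator_of_mem (show p ∈ _ \ _ from ⟨hpQ, hp⟩)]
  · rw [indicator_of_notMem hpQ, indicator_of_notMem fun h => hpQ h.1]

lemma ae_bounded_indicator (hF : IsFrontSystem Ω F Z) (hY : IsShockField Ω F Z Y f)
    (K : Set (SpaceTime N)) (hK : IsCompact K) :
    ∃ M, ∀ᵐ p, p ∈ K → ‖(Ω ×ˢ Ioi 0).indicator Y p‖ ≤ M := by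
  obtain ⟨T, hT⟩ := exists_time_bound hK
  obtain ⟨M, hM⟩ := hY.bounded T
  refine ⟨|M|, ?_⟩
  filter_upwards [measure_eq_zero_iff_ae_notMem.1 (hY.volume_fronts hF)] with p hp hpK
  by_cases hpQ : p ∈ Ω ×ˢ Ioi (0 : ℝ)
  · rw [indicator_of_mem hpQ]
    exact (hM p ⟨⟨hpQ.1, hpQ.2, (hT p hpK).le⟩, hp⟩).trans (le_abs_self M)
  · rw [indicator_of_notMem hpQ, norm_zero]
    exact abs_nonneg M

lemma locallyIntegrable_indicator (hΩ : IsOpen Ω) (hF : IsFrontSystem Ω F Z)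
    (hY : IsShockField Ω F Z Y f) : LocallyIntegrable ((Ω ×ˢ Ioi 0).indicator Y) volume := by
  have : IsLocallyFiniteMeasure (volume : Measure (SpaceTime N)) :=
    inferInstanceAs (IsLocallyFiniteMeasure ((volume : Measure (Space N)).prod
      (volume : Measure ℝ)))
  exact locallyIntegrable_of_ae_bounded (hY.aestronglyMeasurable_indicator hΩ hF)
    (hY.ae_bounded_indicator hF)

end IsShockField

end ShockField

/-! ### The divergence theorem for smooth fields -/

section SmoothDivergence

variable {N : ℕ}

lemma integral_fderiv_apply_eq_zero {E : Type*} [NormedAddCommGroup E] [NormedSpace ℝ E]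
    [FiniteDimensional ℝ E] [MeasurableSpace E] [BorelSpace E] (μ : Measure E) [μ.IsAddHaarMeasure]
    {h : E → ℝ} (hh : IsC1Test h) (e : E) : ∫ p, fderiv ℝ h p e ∂μ = 0 := by
  have hd : Integrable (fun p => fderiv ℝ h p e) μ :=
    ((hh.contDiff.continuous_fderiv one_ne_zero).clm_apply continuous_const).integrable_of_hasCompactSupport
      ((hh.hasCompactSupport.fderiv ℝ).comp_left (g := fun L : E →L[ℝ] ℝ => L e) rfl)
  have hi : Integrable h μ := hh.contDiff.continuous.integrable_of_hasCompactSupport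
    hh.hasCompactSupport
  have := integral_mul_fderiv_eq_neg_fderiv_mul_of_integrable (μ := μ) (v := e)
    (f := fun _ : E => (1 : ℝ)) (g := h) (by simp) (by simpa using hd) (by simpa using hi)
    (fun _ _ => differentiableAt_const _) (fun p _ => hh.differentiable p)
  simpa using this

lemma SpaceTime.eq_sum (p : SpaceTime N) :
    p = ∑ j, p.1 j • spaceDir j + p.2 • timeDir N := by
  have h : p.1 = ∑ j, p.1 j • EuclideanSpace.single j (1 : ℝ) := by
    have := (EuclideanSpace.basisFun (Fin N) ℝ).sum_repr p.1
    simpa using this.symm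
  ext1
  · simp only [Prod.fst_add, Prod.fst_sum, Prod.smul_fst, spaceDir, timeDir, smul_zero, add_zero]
    exact h
  · simp [Prod.snd_sum, spaceDir, timeDir]

lemma continuousLinearMap_apply_eq_sum (L : SpaceTime N →L[ℝ] ℝ) (ξ : SpaceTime N) :
    L ξ = ∑ j, L (spaceDir j) * ξ.1 j + L (timeDir N) * ξ.2 := by
  conv_lhs => rw [SpaceTime.eq_sum ξ]
  simp [map_sum, mul_comm]

/-- The divergence theorem for a smooth field and a test function supported where it is smooth. -/
lemma integral_divergence_eq_zero {Y : SpaceTime N → SpaceTime N} {f : SpaceTime N → ℝ}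
    {O : Set (SpaceTime N)} (hO : IsOpen O) (hY : ContDiffOn ℝ 1 Y O)
    (hf : ∀ p ∈ O, ∑ j : Fin N, (fderiv ℝ Y p (spaceDir j)).1 j + (fderiv ℝ Y p (timeDir N)).2 = f p)
    {φ : SpaceTime N → ℝ} (hφ : IsC1Test φ) (hφO : tsupport φ ⊆ O) :
    ∫ p, (fderiv ℝ φ p (Y p) + φ p * f p) = 0 := by
  have hcomp : ∀ ℓ : SpaceTime N →L[ℝ] ℝ, IsC1Test fun p => ℓ (Y p) * φ p := fun ℓ =>
    ⟨contDiff_mul_of_tsupport_subset hφ.contDiff hO hφO (ℓ.contDiff.comp_contDiffOn hY),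
      hφ.hasCompactSupport.mul_left⟩
  have hder : ∀ (ℓ : SpaceTime N →L[ℝ] ℝ) (e p : SpaceTime N),
      fderiv ℝ (fun p => ℓ (Y p) * φ p) p e =
        fderiv ℝ φ p e * ℓ (Y p) + φ p * (ℓ (fderiv ℝ Y p e)) := by
    intro ℓ e p
    by_cases hp : p ∈ tsupport φ
    · have h1 : HasFDerivAt Y (fderiv ℝ Y p) p :=
        ((hY.differentiableOn one_ne_zero).differentiableAt (hO.mem_nhds (hφO hp))).hasFDerivAt
      have h2 := (ℓ.hasFDerivAt.comp p h1).mul (hφ.differentiable p).hasFDerivAt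
      have h3 : fderiv ℝ (fun p => ℓ (Y p) * φ p) p = _ := h2.fderiv
      rw [h3]
      simp only [add_apply, _root_.smul_apply, smul_eq_mul, ContinuousLinearMap.comp_apply,
        Function.comp_apply]
      ring
    · have h1 : p ∉ tsupport fun p => ℓ (Y p) * φ p := fun h =>
        hp (closure_mono (fun y hy => right_ne_zero_of_mul hy) h)
      have h2 : fderiv ℝ (fun p => ℓ (Y p) * φ p) p = 0 :=
        image_eq_zero_of_notMem_tsupport fun h => h1 (tsupport_fderiv_subset ℝ h)
      have h3 : fderiv ℝ φ p = 0 :=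
        image_eq_zero_of_notMem_tsupport fun h => hp (tsupport_fderiv_subset ℝ h)
      rw [h2, h3, image_eq_zero_of_notMem_tsupport hp]
      simp
  let ℓ : Fin N → SpaceTime N →L[ℝ] ℝ := fun j =>
    (EuclideanSpace.proj j).comp (ContinuousLinearMap.fst ℝ (Space N) ℝ)
  let τ : SpaceTime N →L[ℝ] ℝ := ContinuousLinearMap.snd ℝ (Space N) ℝ
  have hvol : (volume : Measure (SpaceTime N)) =
    (volume : Measure (Space N)).prod (volume : Measure ℝ) := rfl
  have hz : ∀ (ℓ : SpaceTime N →L[ℝ] ℝ) (e : SpaceTime N),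
      ∫ p, fderiv ℝ (fun p => ℓ (Y p) * φ p) p e = 0 := fun ℓ e => by
    rw [hvol]
    exact integral_fderiv_apply_eq_zero _ (hcomp ℓ) e
  have hi : ∀ (ℓ : SpaceTime N →L[ℝ] ℝ) (e : SpaceTime N),
      Integrable (fun p => fderiv ℝ (fun p => ℓ (Y p) * φ p) p e) := fun ℓ e => by
    have : IsLocallyFiniteMeasure (volume : Measure (SpaceTime N)) := by
      rw [hvol]
      infer_instance
    exact (((hcomp ℓ).contDiff.continuous_fderiv one_ne_zero).clm_apply
      continuous_const).integrable_of_hasCompactSupport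
        (((hcomp ℓ).hasCompactSupport.fderiv ℝ).comp_left
          (g := fun L : SpaceTime N →L[ℝ] ℝ => L e) rfl)
  have heq : ∀ p, fderiv ℝ φ p (Y p) + φ p * f p =
      ∑ j, fderiv ℝ (fun p => ℓ j (Y p) * φ p) p (spaceDir j) +
        fderiv ℝ (fun p => τ (Y p) * φ p) p (timeDir N) := by
    intro p
    have h1 : φ p * f p = φ p * (∑ j : Fin N, (fderiv ℝ Y p (spaceDir j)).1 j +
        (fderiv ℝ Y p (timeDir N)).2) := by
      by_cases hp : p ∈ tsupport φ
      · rw [hf p (hφO hp)]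
      · rw [image_eq_zero_of_notMem_tsupport hp]
        simp
    rw [h1, continuousLinearMap_apply_eq_sum (fderiv ℝ φ p)]
    simp only [hder]
    rw [Finset.sum_add_distrib, mul_add, Finset.mul_sum]
    change _ = ∑ j, fderiv ℝ φ p (spaceDir j) * (Y p).1 j +
      ∑ j, φ p * (fderiv ℝ Y p (spaceDir j)).1 j +
      (fderiv ℝ φ p (timeDir N) * (Y p).2 + φ p * (fderiv ℝ Y p (timeDir N)).2)
    ring
  simp only [heq]
  rw [integral_add (integrable_finsetSum _ fun j _ => hi _ _) (hi _ _),
    integral_finsetSum _ fun j _ => hi _ _]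
  simp [hz]

end SmoothDivergence

/-! ### The divergence theorem in the interior -/

section ShockDivergence

variable {N : ℕ} {Ω : Set (Space N)} {n : Space N → Space N} {F : ℕ → Set (SpaceTime N)}
  {Z : Set (SpaceTime N)} {Y : SpaceTime N → SpaceTime N} {f : SpaceTime N → ℝ}

open Classical in
/-- The density of the flux of `Y` through the boundary of the semicylinder over `Ω`, with respect to
the inner normal: this is `-n` on the lateral boundary, and the time axis on the bottom. -/
def boundaryFlux (Ω : Set (Space N)) (n : Space N → Space N) (Y : SpaceTime N → SpaceTime N)
    (p : SpaceTime N) : ℝ :=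
  if p.1 ∈ frontier Ω then -inner ℝ (Y p).1 (n p.1) else (Y p).2

/-- The defect in the divergence theorem for the field `Y` on the semicylinder over `Ω`. The field is
extended by zero, so that the boundary of the semicylinder is a surface on which the flux may jump. -/
def shockDefect (Ω : Set (Space N)) (n : Space N → Space N) (Y : SpaceTime N → SpaceTime N)
    (f : SpaceTime N → ℝ) : (SpaceTime N → ℝ) → ℝ :=
  fluxDefect ((volume : Measure (Space N)).prod (volume : Measure ℝ)) (lateral Ω + bottom Ω)
    ((Ω ×ˢ Ioi 0).indicator Y) ((Ω ×ˢ Ioi 0).indicator f) (boundaryFlux Ω n Y)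

lemma ae_boundaryFlux_lateral (hN : 1 ≤ N) (hΩ : IsLyapunovDomain Ω n)
    (hF : IsFrontSystem Ω F Z) (Y : SpaceTime N → SpaceTime N) :
    (fun p => -inner ℝ (Y p).1 (n p.1)) =ᵐ[lateral Ω] boundaryFlux Ω n Y := by
  filter_upwards [ae_lateral hN hΩ hF] with p hp
  rw [boundaryFlux, if_pos hp.1.1]

lemma ae_boundaryFlux_bottom (hΩ : IsOpen Ω)
    (hF : IsFrontSystem Ω F Z) (Y : SpaceTime N → SpaceTime N) :
    (fun p => (Y p).2) =ᵐ[bottom Ω] boundaryFlux Ω n Y := by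
  filter_upwards [ae_bottom hΩ hF] with p hp
  rw [boundaryFlux, if_neg fun h => frontier_notMem hΩ h hp.1.1]

lemma LocallyIntegrable.add_measure {E E' : Type*} [TopologicalSpace E] [MeasurableSpace E]
    [NormedAddCommGroup E'] {μ ν : Measure E} {g : E → E'} (hμ : LocallyIntegrable g μ)
    (hν : LocallyIntegrable g ν) : LocallyIntegrable g (μ + ν) := by
  intro x
  obtain ⟨U, hU, hU'⟩ := hμ x
  obtain ⟨V, hV, hV'⟩ := hν x
  refine ⟨U ∩ V, inter_mem hU hV, ?_⟩
  exact (hU'.mono_set inter_subset_left).add_measure (hV'.mono_set inter_subset_right)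

namespace IsShockField

lemma locallyIntegrable_boundaryFlux (hN : 1 ≤ N) (hΩ : IsLyapunovDomain Ω n)
    (hF : IsFrontSystem Ω F Z) (hY : IsShockField Ω F Z Y f) :
    LocallyIntegrable (boundaryFlux Ω n Y) (lateral Ω + bottom Ω) :=
  LocallyIntegrable.add_measure
    ((hY.locallyIntegrable_flux_lateral hN hΩ hF).neg.congr (ae_boundaryFlux_lateral hN hΩ hF Y))
    ((hY.locallyIntegrable_flux_bottom hΩ.isOpen hF).congr
      (ae_boundaryFlux_bottom hΩ.isOpen hF Y))

lemma shockDefect_add (hN : 1 ≤ N) (hΩ : IsLyapunovDomain Ω n)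
    (hF : IsFrontSystem Ω F Z) (hY : IsShockField Ω F Z Y f) (φ ψ : SpaceTime N → ℝ)
    (hφ : IsC1Test φ) (hψ : IsC1Test ψ) :
    shockDefect Ω n Y f (fun x => φ x + ψ x) = shockDefect Ω n Y f φ + shockDefect Ω n Y f ψ :=
  fluxDefect_add (hY.locallyIntegrable_indicator hΩ.isOpen hF) hY.locallyIntegrable
    (hY.locallyIntegrable_boundaryFlux hN hΩ hF) φ ψ hφ hψ

lemma measure_boundary_interior (hN : 1 ≤ N) (hΩ : IsLyapunovDomain Ω n)
    (hF : IsFrontSystem Ω F Z) : (lateral Ω + bottom Ω) (Ω ×ˢ Ioi (0 : ℝ)) = 0 := by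
  rw [Measure.add_apply, add_eq_zero]
  refine ⟨measure_eq_zero_iff_ae_notMem.2 ?_, measure_eq_zero_iff_ae_notMem.2 ?_⟩
  · filter_upwards [ae_lateral hN hΩ hF] with p hp h
    exact frontier_notMem hΩ.isOpen hp.1.1 h.1
  · filter_upwards [ae_bottom hΩ.isOpen hF] with p hp h
    exact (mem_Ioi.1 h.2).ne' hp.1.2

/-- The divergence theorem in the interior of the semicylinder. -/
theorem shockDefect_eq_zero_of_interior (hN : 1 ≤ N) (hΩ : IsLyapunovDomain Ω n)
    (hF : IsFrontSystem Ω F Z) (hY : IsShockField Ω F Z Y f) {φ : SpaceTime N → ℝ}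
    (hφ : IsC1Test φ) (hφQ : tsupport φ ⊆ Ω ×ˢ Ioi 0) : shockDefect Ω n Y f φ = 0 := by
  have hQ : IsOpen (Ω ×ˢ Ioi (0 : ℝ)) := hΩ.isOpen.prod isOpen_Ioi
  have hν := measure_boundary_interior hN hΩ hF
  have hX := hY.locallyIntegrable_indicator hΩ.isOpen hF
  have hβ := hY.locallyIntegrable_boundaryFlux hN hΩ hF
  have hμZ := volume_eq_zero_of_hausdorffMeasure hF.exceptional_null
  obtain ⟨M, hM⟩ := hY.ae_bounded_indicator hF _ hφ.hasCompactSupport.isCompact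
  -- the exceptional set is removable, and off it only the fronts have to be crossed
  refine fluxDefect_eq_zero_of_removable (μ := (volume : Measure (Space N)).prod volume)
    (d := N) (by simp) hX hY.locallyIntegrable hβ hφ
    (measure_mono_null hφQ hν) hM hF.isClosed_exceptional hF.exceptional_null hμZ
    fun ψ hψ hψs => ?_
  refine fluxDefect_eq_zero_of_fronts (μH := (volume : Measure (Space N))) hX hY.locallyIntegrable
    hβ (hY.ae_bounded_indicator hF) hQ hν
    hF.isClosed_exceptional hμZ (fun k p hp => ?_) hF.isClosed_fronts (fun χ hχ hχs => ?_) hψ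
    (fun p hp => ⟨hφQ (hψs hp).1, (hψs hp).2⟩)
  · obtain ⟨V, g, Yp, Ym, hV, hpV, hg, hgF, hd, h1, h2, h3⟩ := hY.flux k p hp
    have heq : ∀ᶠ q in 𝓝 p, Y q = (Ω ×ˢ Ioi 0).indicator Y q := by
      filter_upwards [hQ.mem_nhds (hF.front_subset k hp)] with q hq
      rw [indicator_of_mem hq]
    exact ⟨V, g, Yp, Ym, hV, hpV, hg, hgF, hd, h1.congr' (nhdsWithin_le_nhds heq),
      h2.congr' (nhdsWithin_le_nhds heq), h3⟩
  · have e1 : ∫ p, χ p * boundaryFlux Ω n Y p ∂(lateral Ω + bottom Ω) = 0 := by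
      refine integral_eq_zero_of_ae ?_
      filter_upwards [measure_eq_zero_iff_ae_notMem.1 hν] with p hp
      have : p ∉ tsupport χ := fun h => hp (hχs h).1
      simp [image_eq_zero_of_notMem_tsupport this]
    rw [fluxDefect, e1, add_zero]
    have e2 := integral_divergence_eq_zero (hQ.sdiff hF.isClosed_fronts) hY.contDiffOn
      hY.divergence hχ hχs
    refine (integral_congr_ae (Eventually.of_forall fun p => ?_)).trans e2
    by_cases hp : p ∈ tsupport χ
    · simp only [indicator_of_mem (hχs hp).1]
    · have h3 : fderiv ℝ χ p = 0 :=
        image_eq_zero_of_notMem_tsupport fun h => hp (tsupport_fderiv_subset ℝ h)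
      simp [h3, image_eq_zero_of_notMem_tsupport hp]

/-- The divergence theorem is trivial for test functions supported off the closed semicylinder. -/
lemma shockDefect_eq_zero_of_exterior (hN : 1 ≤ N) (hΩ : IsLyapunovDomain Ω n)
    (hF : IsFrontSystem Ω F Z) (Y : SpaceTime N → SpaceTime N) (f : SpaceTime N → ℝ)
    {φ : SpaceTime N → ℝ} (hφQ : ∀ p ∈ tsupport φ, p ∉ closure Ω ×ˢ Ici (0 : ℝ)) :
    shockDefect Ω n Y f φ = 0 := by
  have e1 : ∫ p, φ p * boundaryFlux Ω n Y p ∂(lateral Ω + bottom Ω) = 0 := by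
    refine integral_eq_zero_of_ae ?_
    have h1 : ∀ᵐ p ∂(lateral Ω + bottom Ω), p ∈ closure Ω ×ˢ Ici (0 : ℝ) := by
      rw [ae_add_measure_iff]
      constructor
      · filter_upwards [ae_lateral hN hΩ hF] with p hp using
          ⟨frontier_subset_closure hp.1.1, (mem_Ioi.1 hp.1.2).le⟩
      · filter_upwards [ae_bottom hΩ.isOpen hF] with p hp using
          ⟨subset_closure hp.1.1, (mem_singleton_iff.1 hp.1.2).ge⟩
    filter_upwards [h1] with p hp
    have : p ∉ tsupport φ := fun h => hφQ p h hp
    simp [image_eq_zero_of_notMem_tsupport this]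
  rw [shockDefect, fluxDefect, e1, add_zero]
  refine integral_eq_zero_of_ae (Eventually.of_forall fun p => ?_)
  by_cases hp : p ∈ tsupport φ
  · have : p ∉ Ω ×ˢ Ioi (0 : ℝ) := fun h =>
      hφQ p hp ⟨subset_closure h.1, (mem_Ioi.1 h.2).le⟩
    simp [indicator_of_notMem this]
  · have h3 : fderiv ℝ φ p = 0 :=
      image_eq_zero_of_notMem_tsupport fun h => hp (tsupport_fderiv_subset ℝ h)
    simp [h3, image_eq_zero_of_notMem_tsupport hp]

end IsShockField

end ShockDivergence

/-! ### The divergence theorem up to the bottom -/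

section BottomDivergence

variable {N : ℕ} {Ω : Set (Space N)} {n : Space N → Space N} {F : ℕ → Set (SpaceTime N)}
  {Z : Set (SpaceTime N)} {Y : SpaceTime N → SpaceTime N} {f : SpaceTime N → ℝ}

lemma integral_bottom (Ω : Set (Space N)) (g : SpaceTime N → ℝ) :
    ∫ p, g p ∂bottom Ω = ∫ x in Ω, g (x, 0) := by
  rw [bottom, Measure.prod_dirac, (measurableEmbedding_prod_mk_right (0 : ℝ)).integral_map]

namespace IsShockField

lemma integral_boundaryFlux (hN : 1 ≤ N) (hΩ : IsLyapunovDomain Ω n)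
    (hF : IsFrontSystem Ω F Z) (hY : IsShockField Ω F Z Y f) {φ : SpaceTime N → ℝ}
    (hφ : IsC1Test φ) : ∫ p, φ p * boundaryFlux Ω n Y p ∂(lateral Ω + bottom Ω) =
      (∫ x in Ω, φ (x, 0) * (Y (x, 0)).2) - ∫ p, φ p * inner ℝ (Y p).1 (n p.1) ∂lateral Ω := by
  have hi := hφ.integrable_mul (hY.locallyIntegrable_boundaryFlux hN hΩ hF)
  rw [integral_add_measure (hi.mono_measure (Measure.le_add_right le_rfl))
    (hi.mono_measure (Measure.le_add_left le_rfl)), sub_eq_add_neg, add_comm, ← integral_neg]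
  congr 1
  · refine Eq.trans ?_ (integral_bottom Ω fun p => φ p * (Y p).2)
    refine integral_congr_ae ?_
    filter_upwards [ae_boundaryFlux_bottom (n := n) hΩ.isOpen hF Y] with p hp
    rw [← hp]
  · refine integral_congr_ae ?_
    filter_upwards [ae_boundaryFlux_lateral hN hΩ hF Y] with p hp
    rw [← hp, mul_neg]

/-- The divergence theorem for test functions supported off the lateral boundary. -/
theorem shockDefect_eq_zero_of_cylinder (hN : 1 ≤ N) (hΩ : IsLyapunovDomain Ω n)
    (hF : IsFrontSystem Ω F Z) (hY : IsShockField Ω F Z Y f) {φ : SpaceTime N → ℝ}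
    (hφ : IsC1Test φ) (hφQ : ∀ p ∈ tsupport φ, p.1 ∈ Ω) : shockDefect Ω n Y f φ = 0 := by
  have hX := hY.locallyIntegrable_indicator hΩ.isOpen hF
  have hβ := hY.locallyIntegrable_boundaryFlux hN hΩ hF
  obtain ⟨M, hM⟩ := hY.ae_bounded_indicator hF _ hφ.hasCompactSupport.isCompact
  -- the bottom is the graph of the function zero; the field vanishes below it
  have hkey := fluxDefect_eq_of_graph (μ := (volume : Measure (Space N)).prod volume)
    (μH := (volume : Measure (Space N))) (ContinuousLinearEquiv.refl ℝ (Space N × ℝ))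
    (MeasurePreserving.id _) hX hY.locallyIntegrable hβ hφ (γ := fun _ => 0) measurable_const
    isOpen_univ contDiffOn_const (fun _ _ => mem_univ _) hM ?_ (hY.volume_fronts hF)
    (jp := Ω.indicator fun y => (Y (y, 0)).2) (jm := fun _ => 0) ?_ ?_
  · rw [shockDefect, hkey]
    have e1 : ∫ p, {p : SpaceTime N | p.2 = 0}.indicator 1 p * (φ p * boundaryFlux Ω n Y p)
        ∂(lateral Ω + bottom Ω) = ∫ p, φ p * boundaryFlux Ω n Y p ∂(lateral Ω + bottom Ω) := by
      refine integral_congr_ae ?_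
      rw [EventuallyEq, ae_add_measure_iff]
      constructor
      · filter_upwards [ae_lateral hN hΩ hF] with p hp
        have : p ∉ tsupport φ := fun h => frontier_notMem hΩ.isOpen hp.1.1 (hφQ p h)
        simp [image_eq_zero_of_notMem_tsupport this]
      · filter_upwards [ae_bottom hΩ.isOpen hF] with p hp
        rw [indicator_of_mem (show p ∈ {p : SpaceTime N | p.2 = 0} from hp.1.2)]
        simp
    have e2 : ∫ p, φ p * inner ℝ (Y p).1 (n p.1) ∂lateral Ω = 0 := by
      refine integral_eq_zero_of_ae ?_
      filter_upwards [ae_lateral hN hΩ hF] with p hp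
      have : p ∉ tsupport φ := fun h => frontier_notMem hΩ.isOpen hp.1.1 (hφQ p h)
      simp [image_eq_zero_of_notMem_tsupport this]
    change _ + ∫ p, {p : SpaceTime N | p.2 = 0}.indicator 1 p * (φ p * boundaryFlux Ω n Y p)
        ∂(lateral Ω + bottom Ω) = 0
    rw [e1, hY.integral_boundaryFlux hN hΩ hF hφ, e2]
    have e3 : ∫ y : Space N, φ (y, 0) * (0 - Ω.indicator (fun y => (Y (y, 0)).2) y) =
        -∫ x in Ω, φ (x, 0) * (Y (x, 0)).2 := by
      rw [← integral_neg, ← integral_indicator hΩ.isOpen.measurableSet]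
      refine integral_congr_ae (Eventually.of_forall fun y => ?_)
      by_cases hy : y ∈ Ω
      · simp [hy]
      · simp [hy]
    have e4 : ∀ y : Space N, (ContinuousLinearEquiv.refl ℝ (Space N × ℝ)).symm (y, 0) = (y, 0) :=
      fun _ => rfl
    simp only [e4]
    rw [e3]
    ring
  · intro ψ hψ hψs hψ0
    refine eq_zero_of_locally (hY.shockDefect_add hN hΩ hF) hψ fun p hp => ?_
    have hpΩ := hφQ p (hψs hp)
    rcases lt_or_gt_of_ne (hψ0 p hp) with hneg | hpos
    · refine ⟨{q | q.2 < 0}, (isOpen_lt continuous_snd continuous_const).mem_nhds hneg,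
        fun χ hχ hχs => shockDefect_eq_zero_of_exterior hN hΩ hF Y f fun q hq h => ?_⟩
      exact not_lt.2 (mem_Ici.1 h.2) (hχs hq)
    · exact ⟨Ω ×ˢ Ioi 0, (hΩ.isOpen.prod isOpen_Ioi).mem_nhds ⟨hpΩ, hpos⟩, fun χ hχ hχs =>
        hY.shockDefect_eq_zero_of_interior hN hΩ hF hχ hχs⟩
  · filter_upwards [ae_forall_notMem_of_hausdorffMeasure hF.exceptional_null] with y hy hyφ
    have hyΩ : y ∈ Ω := hφQ _ hyφ
    have hyW : (y, (0 : ℝ)) ∉ Z ∪ ⋃ k, F k := hF.notMem_fronts (fun h => lt_irrefl (0 : ℝ) h.2) (hy 0)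
    rw [indicator_of_mem hyΩ]
    have hc : Tendsto (fun s : ℝ => (y, s)) (𝓝[{s | 0 < s ∧ (y, s) ∉ Z ∪ ⋃ k, F k}] 0)
        (𝓝[(Ω ×ˢ Ici 0) \ (Z ∪ ⋃ k, F k)] (y, 0)) := by
      refine tendsto_nhdsWithin_iff.2 ⟨?_, ?_⟩
      · have : Continuous fun s : ℝ => (y, s) := by fun_prop
        exact (this.tendsto 0).mono_left nhdsWithin_le_nhds
      · filter_upwards [self_mem_nhdsWithin] with s hs using ⟨⟨hyΩ, hs.1.le⟩, hs.2⟩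
    have h1 := (hY.continuousOn_snd (y, 0) ⟨⟨hyΩ, self_mem_Ici⟩, hyW⟩).tendsto.comp hc
    simp only [zero_add, ContinuousLinearEquiv.refl_symm,
      ContinuousLinearEquiv.refl_apply]
    refine h1.congr' ?_
    filter_upwards [self_mem_nhdsWithin] with s hs
    rw [indicator_of_mem (show (y, s) ∈ Ω ×ˢ Ioi 0 from ⟨hyΩ, hs.1⟩)]
    simp
  · refine Eventually.of_forall fun y hy => ?_
    refine tendsto_const_nhds.congr' ?_
    filter_upwards [self_mem_nhdsWithin] with s hs
    have : (y, s) ∉ Ω ×ˢ Ioi (0 : ℝ) := fun h => lt_asymm hs.1 h.2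
    simp [indicator_of_notMem this]

end IsShockField

end BottomDivergence

/-! ### Integrals against comparable measures -/

section CompareMeasures

variable {α : Type*} [MeasurableSpace α] {A B : Measure α}

/-- Integrals with respect to two measures, each of which is at most a multiple close to `1` of the
other, are close to each other. -/
lemma abs_integral_sub_le_of_le {c : NNReal} (h1 : A ≤ B) (h2 : B ≤ (c : ENNReal) • A) {g : α → ℝ}
    (hg : Integrable g B) : |∫ x, g x ∂B - ∫ x, g x ∂A| ≤ (c - 1) * ∫ x, |g x| ∂A := by
  have hgA := hg.mono_measure h1
  have key : ∀ f : α → ℝ, Integrable f B → (∀ x, 0 ≤ f x) →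
      0 ≤ ∫ x, f x ∂B - ∫ x, f x ∂A ∧ ∫ x, f x ∂B - ∫ x, f x ∂A ≤ (c - 1) * ∫ x, f x ∂A := by
    intro f hf h0
    have hfA := hf.mono_measure h1
    have e1 := integral_mono_measure h1 (Eventually.of_forall h0) hf
    have e2 := integral_mono_measure h2 (Eventually.of_forall h0)
      (hfA.smul_measure ENNReal.coe_ne_top)
    rw [integral_smul_measure, ENNReal.coe_toReal, smul_eq_mul] at e2
    constructor <;> linarith
  have ha : Integrable (fun x => |g x|) B := hg.abs
  have haA : Integrable (fun x => |g x|) A := hgA.abs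
  obtain ⟨p1, p2⟩ := key (fun x => |g x| + g x) (ha.add hg) fun x => by
    linarith [neg_abs_le (g x)]
  obtain ⟨q1, q2⟩ := key (fun x => |g x| - g x) (ha.sub hg) fun x => by
    linarith [le_abs_self (g x)]
  rw [integral_add ha hg, integral_add haA hgA] at p1 p2
  rw [integral_sub ha hg, integral_sub haA hgA] at q1 q2
  obtain ⟨r1, r2⟩ := key _ ha fun x => abs_nonneg _
  rw [abs_le]
  constructor <;> linarith

end CompareMeasures

/-! ### Coordinates at the lateral boundary -/

section LateralSplit

variable {N : ℕ}

/-- The splitting of space-time into the tangent hyperplane and the time axis on one side, and the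
normal direction `e` on the other. -/
def lateralSplit (e : Space N) (he : ‖e‖ = 1) : SpaceTime N ≃L[ℝ] ((ℝ ∙ e)ᗮ × ℝ) × ℝ :=
  ((normalSplit e he).prodCongr (ContinuousLinearEquiv.refl ℝ ℝ)).trans
    (ContinuousLinearEquiv.equivOfInverse
      (((ContinuousLinearMap.fst ℝ _ _ ∘L ContinuousLinearMap.fst ℝ ((ℝ ∙ e)ᗮ × ℝ) ℝ).prod
        (ContinuousLinearMap.snd ℝ _ _)).prod
        (ContinuousLinearMap.snd ℝ _ _ ∘L ContinuousLinearMap.fst ℝ _ _))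
      (((ContinuousLinearMap.fst ℝ _ _ ∘L ContinuousLinearMap.fst ℝ ((ℝ ∙ e)ᗮ × ℝ) ℝ).prod
        (ContinuousLinearMap.snd ℝ _ _)).prod
        (ContinuousLinearMap.snd ℝ _ _ ∘L ContinuousLinearMap.fst ℝ _ _))
      (fun _ => rfl) fun _ => rfl)

lemma lateralSplit_symm_apply (e : Space N) (he : ‖e‖ = 1) (q : ((ℝ ∙ e)ᗮ × ℝ) × ℝ) :
    (lateralSplit e he).symm q = ((normalSplit e he).symm (q.1.1, q.2), q.1.2) := rfl

lemma measurePreserving_lateralSplit (e : Space N) (he : ‖e‖ = 1) :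
    MeasurePreserving (lateralSplit e he) ((volume : Measure (Space N)).prod volume)
      (((volume : Measure (ℝ ∙ e)ᗮ).prod volume).prod volume) := by
  have h1 := (measurePreserving_normalSplit e he).prod (MeasurePreserving.id (volume : Measure ℝ))
  have h2 := measurePreserving_prodAssoc (volume : Measure (ℝ ∙ e)ᗮ) (volume : Measure ℝ)
    (volume : Measure ℝ)
  have h3 := (MeasurePreserving.id (volume : Measure (ℝ ∙ e)ᗮ)).prod
    (Measure.measurePreserving_swap (μ := (volume : Measure ℝ)) (ν := (volume : Measure ℝ)))
  have h4 := MeasurePreserving.symm MeasurableEquiv.prodAssoc h2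
  exact h4.comp (h3.comp (h2.comp h1))

end LateralSplit

/-! ### The flattened lateral boundary -/

section LateralDivergence

variable {N : ℕ} {Ω : Set (Space N)} {n : Space N → Space N} {F : ℕ → Set (SpaceTime N)}
  {Z : Set (SpaceTime N)} {Y : SpaceTime N → SpaceTime N} {f : SpaceTime N → ℝ}

namespace IsBoundaryChart

variable {e : Space N} {he : ‖e‖ = 1} {u : (ℝ ∙ e)ᗮ × ℝ} {ε : NNReal} {γ : (ℝ ∙ e)ᗮ → ℝ} {ρ r : ℝ}
  (h : IsBoundaryChart Ω n e he u ε γ ρ r)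

/-- The flux density through the graph of `γ` with respect to the Lebesgue measure of the tangent
hyperplane: the scalar product of `Y` with the upward normal `(-∇γ, 1)`. -/
def graphFlux (_ : IsBoundaryChart Ω n e he u ε γ ρ r) (Y : SpaceTime N → SpaceTime N)
    (p : SpaceTime N) : ℝ :=
  (normalSplit e he (Y p).1).2 - fderiv ℝ γ (normalSplit e he p.1).1 (normalSplit e he (Y p).1).1

/-- The normal `(-∇γ, 1)` of the graph and the unit normal of the domain are close to `e`, hence the two
flux densities differ little. -/
lemma abs_graphFlux_sub_le {p : SpaceTime N} (hp : p.1 ∈ frontier Ω ∩ h.box) {M : ℝ}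
    (hM : ‖(Y p).1‖ ≤ M) : |h.graphFlux Y p - inner ℝ (Y p).1 (n p.1)| ≤ 2 * ε * M := by
  have hM0 : 0 ≤ M := (norm_nonneg _).trans hM
  have hy : (normalSplit e he p.1).1 ∈ Metric.ball u.1 ρ := hp.2.1
  have h1 : ‖n p.1 - e‖ ≤ ε := by
    have := h.normal _ hy
    change ‖n (h.param _) - e‖ ≤ ε at this
    rwa [← h.eq_param hp.1 hp.2] at this
  have h2 : |inner ℝ (Y p).1 (n p.1 - e)| ≤ M * ε :=
    (abs_real_inner_le_norm _ _).trans (mul_le_mul hM h1 (norm_nonneg _) hM0)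
  have h3 : |fderiv ℝ γ (normalSplit e he p.1).1 (normalSplit e he (Y p).1).1| ≤ ε * M := by
    refine ((fderiv ℝ γ _).le_opNorm _).trans (mul_le_mul (h.slope _ hy) ?_ (norm_nonneg _)
      ε.coe_nonneg)
    exact ((ℝ ∙ e)ᗮ.norm_orthogonalProjectionOnto_apply_le _).trans hM
  have h4 : h.graphFlux Y p - inner ℝ (Y p).1 (n p.1) = -inner ℝ (Y p).1 (n p.1 - e) -
      fderiv ℝ γ (normalSplit e he p.1).1 (normalSplit e he (Y p).1).1 := by
    rw [graphFlux, inner_sub_right, real_inner_comm e]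
    simp only [normalSplit_apply]
    ring
  rw [h4, abs_le]
  rw [abs_le] at h2 h3
  constructor <;> linarith

/-- The part of the lateral boundary seen by a chart. -/
def curvedLateral : Measure (SpaceTime N) := (lateral Ω).restrict (h.box ×ˢ univ)

/-- The flattened lateral boundary: the Lebesgue measure of the tangent hyperplane, carried over to
the boundary, times the half-line of non-negative times. -/
def flatLateral : Measure (SpaceTime N) := h.flatMeasure.prod (volume.restrict (Ici (0 : ℝ)))

lemma curvedLateral_eq (hΩ : IsLyapunovDomain Ω n) :
    h.curvedLateral = h.curvedMeasure.prod (volume.restrict (Ici (0 : ℝ))) := by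
  have := hΩ.isFiniteMeasure_surfaceMeasure
  rw [curvedLateral, curvedMeasure, lateral, ← Measure.prod_restrict, Measure.restrict_univ]

lemma flatLateral_le (hΩ : IsLyapunovDomain Ω n) : h.flatLateral ≤ h.curvedLateral := by
  rw [curvedLateral_eq h hΩ]
  exact Measure.prod_mono h.flatMeasure_le le_rfl

lemma curvedLateral_le (hΩ : IsLyapunovDomain Ω n) :
    h.curvedLateral ≤ (((1 + ε) ^ (N - 1) : NNReal) : ENNReal) • h.flatLateral := by
  have := hΩ.isFiniteMeasure_surfaceMeasure
  rw [curvedLateral_eq h hΩ, flatLateral, ← Measure.prod_smul_left, ENNReal.coe_pow]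
  exact Measure.prod_mono h.curvedMeasure_le le_rfl

lemma flatLateral_eq_map : h.flatLateral = ((volume.restrict (Metric.ball u.1 ρ)).prod
    (volume.restrict (Ici (0 : ℝ)))).map (Prod.map h.param id) := by
  rw [← Measure.map_prod_map _ _ h.measurable_param measurable_id, Measure.map_id]
  rfl

lemma aestronglyMeasurable_graphFlux (hY : AEStronglyMeasurable (fun p => (Y p).1) (lateral Ω))
    (hΩ : IsLyapunovDomain Ω n) : AEStronglyMeasurable (h.graphFlux Y) h.flatLateral := by
  have h1 : AEStronglyMeasurable (fun p => normalSplit e he (Y p).1) h.flatLateral :=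
    (normalSplit e he).continuous.comp_aestronglyMeasurable
      (hY.mono_measure ((h.flatLateral_le hΩ).trans Measure.restrict_le_self))
  have h2 : AEStronglyMeasurable (fun p : SpaceTime N => fderiv ℝ γ (normalSplit e he p.1).1)
      h.flatLateral :=
    ((measurable_fderiv ℝ γ).comp (measurable_fst.comp ((normalSplit e he).continuous.measurable.comp
      measurable_fst))).aestronglyMeasurable
  exact (continuous_snd.comp_aestronglyMeasurable h1).sub
    (isBoundedBilinearMap_apply.continuous.comp_aestronglyMeasurable
      (h2.prodMk (continuous_fst.comp_aestronglyMeasurable h1)))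

end IsBoundaryChart

end LateralDivergence

/-! ### The divergence theorem for fields with shocks -/

section LateralEstimate

variable {N : ℕ} {Ω : Set (Space N)} {n : Space N → Space N} {F : ℕ → Set (SpaceTime N)}
  {Z : Set (SpaceTime N)} {Y : SpaceTime N → SpaceTime N} {f : SpaceTime N → ℝ}
  {e : Space N} {he : ‖e‖ = 1} {u : (ℝ ∙ e)ᗮ × ℝ} {ε : NNReal} {γ : (ℝ ∙ e)ᗮ → ℝ} {ρ r : ℝ}

namespace IsShockField

/-- In a chart, the defect in the divergence theorem is the difference of the fluxes through the
flattened and through the actual lateral boundary. -/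
lemma shockDefect_eq_of_chart (hN : 1 ≤ N) (hΩ : IsLyapunovDomain Ω n)
    (hF : IsFrontSystem Ω F Z) (hY : IsShockField Ω F Z Y f)
    (h : IsBoundaryChart Ω n e he u ε γ ρ r) {ψ : SpaceTime N → ℝ} (hψ : IsC1Test ψ)
    (hψb : ∀ p ∈ tsupport ψ, p.1 ∈ h.box) :
    shockDefect Ω n Y f ψ = ∫ p, ψ p * h.graphFlux Y p ∂h.flatLateral -
      ∫ p, ψ p * inner ℝ (Y p).1 (n p.1) ∂h.curvedLateral := by
  have hX := hY.locallyIntegrable_indicator hΩ.isOpen hF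
  have hβ := hY.locallyIntegrable_boundaryFlux hN hΩ hF
  obtain ⟨M, hM⟩ := hY.ae_bounded_indicator hF _ hψ.hasCompactSupport.isCompact
  have hbox : ∀ {q : (ℝ ∙ e)ᗮ × ℝ}, (lateralSplit e he).symm (q, γ q.1) ∈ tsupport ψ →
      q.1 ∈ Metric.ball u.1 ρ := by
    intro q hq
    have := (hψb _ hq).1
    rwa [lateralSplit_symm_apply, ContinuousLinearEquiv.apply_symm_apply] at this
  have hder : ∀ q : (ℝ ∙ e)ᗮ × ℝ, q.1 ∈ Metric.ball u.1 ρ → ∀ z : (ℝ ∙ e)ᗮ × ℝ,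
      fderiv ℝ (fun q : (ℝ ∙ e)ᗮ × ℝ => γ q.1) q z = fderiv ℝ γ q.1 z.1 := by
    intro q hq z
    have h1 := ((h.contDiffOn.differentiableOn one_ne_zero).differentiableAt
      (Metric.isOpen_ball.mem_nhds hq)).hasFDerivAt.comp q
        (ContinuousLinearMap.fst ℝ (ℝ ∙ e)ᗮ ℝ).hasFDerivAt
    have h2 : fderiv ℝ (fun q : (ℝ ∙ e)ᗮ × ℝ => γ q.1) q = _ := h1.fderiv
    rw [h2]
    rfl
  have hnear : ∀ q : (ℝ ∙ e)ᗮ × ℝ, q.1 ∈ Metric.ball u.1 ρ →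
      ∀ᶠ s in 𝓝 (0 : ℝ), γ q.1 + s ∈ Metric.ball u.2 r := by
    intro q hq
    refine (Continuous.tendsto' (by fun_prop) 0 (γ q.1) (by simp)).eventually
      (Metric.isOpen_ball.mem_nhds (h.mem_ball _ hq))
  -- in the coordinates of the chart the lateral boundary is a graph over the product of the tangent
  -- hyperplane and the time axis, and the field vanishes above it
  have hkey := fluxDefect_eq_of_graph (μ := (volume : Measure (Space N)).prod volume)
    (μH := (volume : Measure (ℝ ∙ e)ᗮ).prod (volume : Measure ℝ)) (lateralSplit e he)
    (measurePreserving_lateralSplit e he) hX hY.locallyIntegrable hβ hψ (γ := fun q => γ q.1)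
    (h.measurable.comp measurable_fst) (B := Metric.ball u.1 ρ ×ˢ univ)
    (Metric.isOpen_ball.prod isOpen_univ)
    (h.contDiffOn.comp contDiff_fst.contDiffOn fun q hq => hq.1)
    (fun p hp => ⟨(hψb p hp).1, mem_univ _⟩) hM ?_ (hY.volume_fronts hF) (jp := fun _ => 0)
    (jm := fun q => (Ici (0 : ℝ)).indicator (fun t => h.graphFlux Y (h.param q.1, t)) q.2) ?_ ?_
  · rw [shockDefect, hkey, sub_eq_add_neg, ← integral_neg]
    congr 1
    · have hmp : MeasurableEmbedding (Prod.map h.param (id : ℝ → ℝ)) :=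
        (h.measurable_param.prodMap measurable_id).measurableEmbedding fun a b hab => by
          have h1 := congrArg (fun z : SpaceTime N => (normalSplit e he z.1).1) hab
          have h2 := congrArg Prod.snd hab
          simp only [Prod.map_fst, h.split_param] at h1
          exact Prod.ext h1 h2
      rw [h.flatLateral_eq_map, hmp.integral_map, Measure.prod_restrict,
        ← integral_indicator (Metric.isOpen_ball.measurableSet.prod measurableSet_Ici)]
      refine integral_congr_ae (Eventually.of_forall fun q => ?_)
      simp only [sub_zero]
      by_cases hq : q.1 ∈ Metric.ball u.1 ρ
      · by_cases ht : q.2 ∈ Ici (0 : ℝ)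
        · rw [indicator_of_mem ht, indicator_of_mem (show q ∈ _ ×ˢ _ from ⟨hq, ht⟩)]
          rfl
        · rw [indicator_of_notMem ht, indicator_of_notMem fun hc : q ∈ Metric.ball u.1 ρ ×ˢ
            Ici (0 : ℝ) => ht hc.2, mul_zero]
      · rw [image_eq_zero_of_notMem_tsupport fun h => hq (hbox h),
          indicator_of_notMem fun hc : q ∈ Metric.ball u.1 ρ ×ˢ Ici (0 : ℝ) => hq hc.1, zero_mul]
    · have hi := hψ.integrable_mul hβ
      have e1 : ∀ᵐ p ∂lateral Ω, {p | (lateralSplit e he p).2 =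
          γ (lateralSplit e he p).1.1}.indicator 1 p * (ψ p * boundaryFlux Ω n Y p) =
          (h.box ×ˢ univ).indicator (fun p => -(ψ p * inner ℝ (Y p).1 (n p.1))) p := by
        filter_upwards [ae_lateral hN hΩ hF, ae_boundaryFlux_lateral hN hΩ hF Y] with p hp hpb
        by_cases hb : p.1 ∈ h.box
        · have h1 := congrArg (normalSplit e he) (h.eq_param hp.1.1 hb)
          rw [h.split_param] at h1
          rw [indicator_of_mem (show p ∈ {p | (lateralSplit e he p).2 =
            γ (lateralSplit e he p).1.1} from congrArg Prod.snd h1),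
            indicator_of_mem (show p ∈ h.box ×ˢ univ from ⟨hb, mem_univ _⟩), ← hpb]
          simp
        · rw [image_eq_zero_of_notMem_tsupport fun h => hb (hψb p h),
            indicator_of_notMem fun hc : p ∈ h.box ×ˢ univ => hb hc.1]
          simp
      have e2 : ∀ᵐ p ∂bottom Ω, {p | (lateralSplit e he p).2 =
          γ (lateralSplit e he p).1.1}.indicator 1 p * (ψ p * boundaryFlux Ω n Y p) = 0 := by
        filter_upwards [ae_bottom hΩ.isOpen hF] with p hp
        by_cases hb : p.1 ∈ h.box
        · have h1 := (h.mem_iff _ hb.1 _ hb.2).1 (by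
            rw [Prod.mk.eta, ContinuousLinearEquiv.symm_apply_apply]
            exact hp.1.1)
          rw [indicator_of_notMem fun h : p ∈ {p | (lateralSplit e he p).2 =
            γ (lateralSplit e he p).1.1} => h1.ne h, zero_mul]
        · rw [image_eq_zero_of_notMem_tsupport fun h => hb (hψb p h)]
          simp
      have hms : MeasurableSet {p : SpaceTime N | (lateralSplit e he p).2 =
          γ (lateralSplit e he p).1.1} := by
        have hc := (lateralSplit e he).continuous.measurable
        exact measurableSet_eq_fun (measurable_snd.comp hc)
          (h.measurable.comp (measurable_fst.comp (measurable_fst.comp hc)))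
      have e0 : ∀ p : SpaceTime N, {p | (lateralSplit e he p).2 =
          γ (lateralSplit e he p).1.1}.indicator 1 p * (ψ p * boundaryFlux Ω n Y p) =
          {p | (lateralSplit e he p).2 = γ (lateralSplit e he p).1.1}.indicator
            (fun p => ψ p * boundaryFlux Ω n Y p) p := fun p => by
        by_cases hp : p ∈ {p | (lateralSplit e he p).2 = γ (lateralSplit e he p).1.1}
        · rw [indicator_of_mem hp, indicator_of_mem hp, Pi.one_apply, one_mul]
        · rw [indicator_of_notMem hp, indicator_of_notMem hp, zero_mul]
      have hi' : Integrable (fun p => {p | (lateralSplit e he p).2 =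
          γ (lateralSplit e he p).1.1}.indicator 1 p * (ψ p * boundaryFlux Ω n Y p))
          (lateral Ω + bottom Ω) := by
        simp only [e0]
        exact hi.indicator hms
      rw [integral_add_measure (hi'.mono_measure (Measure.le_add_right le_rfl))
        (hi'.mono_measure (Measure.le_add_left le_rfl)), integral_congr_ae e1,
        integral_congr_ae e2, integral_zero, add_zero, integral_indicator
          (h.isOpen_box.measurableSet.prod MeasurableSet.univ)]
      rfl
  · intro χ hχ hχs hχ0
    refine eq_zero_of_locally (hY.shockDefect_add hN hΩ hF) hχ fun p hp => ?_
    have hb := hψb p (hχs hp)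
    have hps : (normalSplit e he).symm ((normalSplit e he p.1).1, (normalSplit e he p.1).2) = p.1 := by
      rw [Prod.mk.eta, ContinuousLinearEquiv.symm_apply_apply]
    have hfr := h.mem_frontier_iff _ hb.1 _ hb.2
    rw [hps] at hfr
    have hnf : p.1 ∉ frontier Ω := fun hf => hχ0 p hp (hfr.1 hf)
    by_cases hpΩ : p.1 ∈ Ω
    · exact ⟨Ω ×ˢ univ, (hΩ.isOpen.prod isOpen_univ).mem_nhds ⟨hpΩ, mem_univ _⟩, fun ξ hξ hξs =>
        hY.shockDefect_eq_zero_of_cylinder hN hΩ hF hξ fun q hq => (hξs hq).1⟩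
    · have hpc : p.1 ∉ closure Ω := fun hc => hnf (by
        rw [hΩ.isOpen.frontier_eq]
        exact ⟨hc, hpΩ⟩)
      exact ⟨(closure Ω)ᶜ ×ˢ univ, (isClosed_closure.isOpen_compl.prod isOpen_univ).mem_nhds
        ⟨hpc, mem_univ _⟩, fun ξ hξ hξs => shockDefect_eq_zero_of_exterior hN hΩ hF Y f
          fun q hq hc => (hξs hq).1 hc.1⟩
  · refine Eventually.of_forall fun q hq => ?_
    refine tendsto_const_nhds.congr' ?_
    filter_upwards [self_mem_nhdsWithin, nhdsWithin_le_nhds (hnear q (hbox hq))] with s hs hsb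
    have : (lateralSplit e he).symm (q, γ q.1 + s) ∉ Ω ×ˢ Ioi (0 : ℝ) := fun hc => by
      have := (h.mem_iff q.1 (hbox hq) _ hsb).1 hc.1
      linarith [hs.1]
    rw [indicator_of_notMem this]
    simp only [map_zero, Prod.snd_zero, Prod.fst_zero, sub_zero]
  · have hne : ∀ᵐ q : (ℝ ∙ e)ᗮ × ℝ ∂(volume.prod volume), q.2 ≠ 0 := by
      have : ∀ᵐ t : ℝ, t ≠ 0 := compl_mem_ae_iff.2 (measure_singleton 0)
      exact Measure.quasiMeasurePreserving_snd.ae this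
    filter_upwards [h.ae_notMem hN hF.exceptional_null, hne] with q hqZ hq0 hq
    have hqb := hbox hq
    have hqW : (h.param q.1, q.2) ∉ Z ∪ ⋃ k, F k :=
      hF.notMem_fronts (fun hc => frontier_notMem hΩ.isOpen (h.param_mem hqb).1 hc.1) hqZ
    rcases lt_or_gt_of_ne hq0 with hneg | hpos
    · rw [indicator_of_notMem (notMem_Ici.2 hneg)]
      refine tendsto_const_nhds.congr' ?_
      filter_upwards with s
      have : (lateralSplit e he).symm (q, γ q.1 + s) ∉ Ω ×ˢ Ioi (0 : ℝ) := fun hc =>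
        lt_asymm hneg hc.2
      rw [indicator_of_notMem this]
      simp only [map_zero, Prod.snd_zero, Prod.fst_zero, sub_zero]
    · rw [indicator_of_mem (mem_Ici.2 hpos.le)]
      have hc : Tendsto (fun s : ℝ => (lateralSplit e he).symm (q, γ q.1 + s))
          (𝓝[{s | s < 0 ∧ (lateralSplit e he).symm (q, γ q.1 + s) ∉ Z ∪ ⋃ k, F k}] 0)
          (𝓝[(closure Ω ×ˢ Ioi 0) \ (Z ∪ ⋃ k, F k)] (h.param q.1, q.2)) := by
        refine tendsto_nhdsWithin_iff.2 ⟨?_, ?_⟩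
        · have : Continuous fun s : ℝ => (lateralSplit e he).symm (q, γ q.1 + s) := by fun_prop
          refine (this.tendsto' 0 _ ?_).mono_left nhdsWithin_le_nhds
          rw [add_zero]
          rfl
        · filter_upwards [self_mem_nhdsWithin, nhdsWithin_le_nhds (hnear q hqb)] with s hs hsb
          refine ⟨⟨subset_closure ((h.mem_iff q.1 hqb _ hsb).2 (by linarith [hs.1])), hpos⟩, hs.2⟩
      have h1 := (hY.continuousOn_fst (h.param q.1, q.2)
        ⟨⟨frontier_subset_closure (h.param_mem hqb).1, hpos⟩, hqW⟩).tendsto.comp hc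
      have h2 : Continuous fun z : Space N =>
          (normalSplit e he z).2 - fderiv ℝ γ q.1 (normalSplit e he z).1 := by fun_prop
      have h3 := (h2.tendsto _).comp h1
      have h4 : h.graphFlux Y (h.param q.1, q.2) = (normalSplit e he (Y (h.param q.1, q.2)).1).2 -
          fderiv ℝ γ q.1 (normalSplit e he (Y (h.param q.1, q.2)).1).1 := by
        rw [IsBoundaryChart.graphFlux, h.split_param]
      rw [h4]
      refine h3.congr' ?_
      filter_upwards [self_mem_nhdsWithin, nhdsWithin_le_nhds (hnear q hqb)] with s hs hsb
      rw [indicator_of_mem (show (lateralSplit e he).symm (q, γ q.1 + s) ∈ Ω ×ˢ Ioi 0 from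
        ⟨(h.mem_iff q.1 hqb _ hsb).2 (by linarith [hs.1]), hpos⟩), hder q hqb]
      rfl

/-- The flux through the actual boundary and the flux through the flattened one differ by the deviation
of the normals, at most `2 ε M`, and by the factor between the measures. -/
lemma abs_shockDefect_le_of_chart (hN : 1 ≤ N) (hΩ : IsLyapunovDomain Ω n)
    (hF : IsFrontSystem Ω F Z) (hY : IsShockField Ω F Z Y f)
    (h : IsBoundaryChart Ω n e he u ε γ ρ r) {T M : ℝ} (hM0 : 0 ≤ M)
    (hM : ∀ p ∈ (Ω ×ˢ Ioc 0 T) \ (Z ∪ ⋃ k, F k), ‖Y p‖ ≤ M) {ψ : SpaceTime N → ℝ}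
    (hψ : IsC1Test ψ) (hψb : ∀ p ∈ tsupport ψ, p.1 ∈ h.box ∧ p.2 < T) :
    |shockDefect Ω n Y f ψ| ≤
      M * (2 * ε + ((1 + ε : ℝ) ^ (N - 1) - 1)) * ∫ p, |ψ p| ∂lateral Ω := by
  have := hΩ.isFiniteMeasure_surfaceMeasure
  have : IsLocallyFiniteMeasure (lateral Ω) := by
    unfold lateral
    infer_instance
  rw [hY.shockDefect_eq_of_chart hN hΩ hF h hψ fun p hp => (hψb p hp).1]
  have hAB := h.flatLateral_le hΩ
  have hBL : h.curvedLateral ≤ lateral Ω := Measure.restrict_le_self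
  have hbd := hY.ae_bounded_fst_lateral hN hΩ hF hM
  have hlat := ae_lateral hN hΩ hF
  have hψL : Integrable (fun p => |ψ p|) (lateral Ω) :=
    (hψ.contDiff.continuous.integrable_of_hasCompactSupport hψ.hasCompactSupport).abs
  have hψA := hψL.mono_measure (hAB.trans hBL)
  have hψB := hψL.mono_measure hBL
  have hg : Integrable (fun p => ψ p * inner ℝ (Y p).1 (n p.1)) (lateral Ω) :=
    hψ.integrable_mul (hY.locallyIntegrable_flux_lateral hN hΩ hF)
  have hgA := hg.mono_measure (hAB.trans hBL)
  have hIA : ∫ p, |ψ p| ∂h.flatLateral ≤ ∫ p, |ψ p| ∂lateral Ω :=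
    integral_mono_measure (hAB.trans hBL) (Eventually.of_forall fun _ => abs_nonneg _) hψL
  have hac : ∀ {P : SpaceTime N → Prop}, (∀ᵐ p ∂lateral Ω, P p) → ∀ᵐ p ∂h.flatLateral, P p :=
    fun hP => (Measure.absolutelyContinuous_of_le (hAB.trans hBL)).ae_le hP
  have hd : ∀ᵐ p ∂h.flatLateral, ‖ψ p * (h.graphFlux Y p - inner ℝ (Y p).1 (n p.1))‖ ≤
      2 * ε * M * |ψ p| := by
    filter_upwards [hac hbd, hac hlat] with p hp hpl
    by_cases hps : p ∈ tsupport ψ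
    · have h1 := h.abs_graphFlux_sub_le ⟨hpl.1.1, (hψb p hps).1⟩ (hp (hψb p hps).2)
      rw [norm_mul, Real.norm_eq_abs, Real.norm_eq_abs, mul_comm]
      exact mul_le_mul_of_nonneg_right h1 (abs_nonneg _)
    · rw [image_eq_zero_of_notMem_tsupport hps]
      simp
  have hdm : AEStronglyMeasurable (fun p => ψ p * (h.graphFlux Y p - inner ℝ (Y p).1 (n p.1)))
      h.flatLateral :=
    hψ.contDiff.continuous.aestronglyMeasurable.mul
      ((h.aestronglyMeasurable_graphFlux (hY.aestronglyMeasurable_fst_lateral hN hΩ hF) hΩ).sub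
        ((hY.locallyIntegrable_flux_lateral hN hΩ hF).aestronglyMeasurable.mono_measure
          (hAB.trans hBL)))
  have hdi : Integrable (fun p => ψ p * (h.graphFlux Y p - inner ℝ (Y p).1 (n p.1)))
      h.flatLateral := (hψA.const_mul (2 * ε * M)).mono' hdm hd
  have e1 : ∫ p, ψ p * h.graphFlux Y p ∂h.flatLateral =
      ∫ p, ψ p * (h.graphFlux Y p - inner ℝ (Y p).1 (n p.1)) ∂h.flatLateral +
      ∫ p, ψ p * inner ℝ (Y p).1 (n p.1) ∂h.flatLateral := by
    rw [← integral_add hdi hgA]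
    refine integral_congr_ae (Eventually.of_forall fun p => ?_)
    simp only
    ring
  have e2 : |∫ p, ψ p * (h.graphFlux Y p - inner ℝ (Y p).1 (n p.1)) ∂h.flatLateral| ≤
      2 * ε * M * ∫ p, |ψ p| ∂lateral Ω := by
    refine (norm_integral_le_of_norm_le (hψA.const_mul (2 * ε * M)) hd).trans ?_
    rw [integral_const_mul]
    exact mul_le_mul_of_nonneg_left hIA (by positivity)
  have e3 := abs_integral_sub_le_of_le hAB (h.curvedLateral_le hΩ) (hg.mono_measure hBL)
  have e4 : ∫ p, |ψ p * inner ℝ (Y p).1 (n p.1)| ∂h.flatLateral ≤ M * ∫ p, |ψ p| ∂lateral Ω := by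
    refine le_trans ?_ (mul_le_mul_of_nonneg_left hIA hM0)
    rw [← integral_const_mul]
    refine integral_mono_ae hgA.abs (hψA.const_mul M) ?_
    filter_upwards [hac hbd, hac hlat] with p hp hpl
    by_cases hps : p ∈ tsupport ψ
    · rw [abs_mul, mul_comm]
      refine mul_le_mul_of_nonneg_right ((abs_real_inner_le_norm _ _).trans ?_) (abs_nonneg _)
      rw [hΩ.norm_normal hpl.1.1, mul_one]
      exact hp (hψb p hps).2
    · rw [image_eq_zero_of_notMem_tsupport hps]
      simp
  have hc : (1 : ℝ) ≤ (((1 + ε) ^ (N - 1) : NNReal) : ℝ) := by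
    rw [NNReal.coe_pow]
    exact one_le_pow₀ (by simp)
  have e5 := e3.trans (mul_le_mul_of_nonneg_left e4 (sub_nonneg.2 hc))
  rw [e1]
  rw [NNReal.coe_pow, NNReal.coe_add, NNReal.coe_one] at e5
  rw [abs_le] at e2 e5 ⊢
  constructor <;> linarith

/-- The divergence theorem for a field with shocks. In charts of small slope the defect is at most a
small multiple of the lateral mass of the test function; such bounds add up over a partition of unity,
so the defect vanishes, without an area formula for the boundary. -/
theorem shockDefect_eq_zero (hN : 1 ≤ N) (hΩ : IsLyapunovDomain Ω n)
    (hF : IsFrontSystem Ω F Z) (hY : IsShockField Ω F Z Y f) {φ : SpaceTime N → ℝ}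
    (hφ : IsC1Test φ) : shockDefect Ω n Y f φ = 0 := by
  have := hΩ.isFiniteMeasure_surfaceMeasure
  have : IsLocallyFiniteMeasure (lateral Ω) := by
    unfold lateral
    infer_instance
  have hint : ∀ ψ : SpaceTime N → ℝ, IsC1Test ψ → Integrable (fun p => |ψ p|) (lateral Ω) :=
    fun ψ hψ =>
      (hψ.contDiff.continuous.integrable_of_hasCompactSupport hψ.hasCompactSupport).abs
  obtain ⟨T, hT⟩ := exists_time_bound hφ.hasCompactSupport.isCompact
  obtain ⟨M, hM⟩ := hY.bounded T
  have hM' : ∀ p ∈ (Ω ×ˢ Ioc 0 T) \ (Z ∪ ⋃ k, F k), ‖Y p‖ ≤ |M| := fun p hp =>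
    (hM p hp).trans (le_abs_self M)
  have key : ∀ δ : ℝ, 0 < δ → |shockDefect Ω n Y f φ| ≤ δ * ∫ p, |φ p| ∂lateral Ω := by
    intro δ hδ
    refine abs_le_of_locally (b := fun ψ => δ * ∫ p, |ψ p| ∂lateral Ω)
      (hY.shockDefect_add hN hΩ hF) (by simp) (fun ψ χ hψ hχ h01 => ?_) hφ fun p hp => ?_
    · have i1 := hint _ (hψ.mul hχ)
      have i2 := hint _ (hψ.mul (χ := fun x => 1 - χ x) (contDiff_const.sub hχ))
      rw [← mul_add, ← integral_add i1 i2]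
      refine le_of_eq ?_
      congr 1
      refine integral_congr_ae (Eventually.of_forall fun x => ?_)
      simp only [abs_mul, abs_of_nonneg (h01 x).1, abs_of_nonneg (sub_nonneg.2 (h01 x).2)]
      ring
    · have hnn : ∀ ψ : SpaceTime N → ℝ, 0 ≤ δ * ∫ p, |ψ p| ∂lateral Ω := fun ψ =>
        mul_nonneg hδ.le (integral_nonneg fun _ => abs_nonneg _)
      by_cases hpΩ : p.1 ∈ Ω
      · refine ⟨Ω ×ˢ univ, (hΩ.isOpen.prod isOpen_univ).mem_nhds ⟨hpΩ, mem_univ _⟩,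
          fun ψ hψ hψs => ?_⟩
        rw [hY.shockDefect_eq_zero_of_cylinder hN hΩ hF hψ fun q hq => (hψs hq).1, abs_zero]
        exact hnn ψ
      by_cases hpc : p.1 ∈ closure Ω
      swap
      · refine ⟨(closure Ω)ᶜ ×ˢ univ, (isClosed_closure.isOpen_compl.prod isOpen_univ).mem_nhds
          ⟨hpc, mem_univ _⟩, fun ψ hψ hψs => ?_⟩
        rw [shockDefect_eq_zero_of_exterior hN hΩ hF Y f fun q hq hc => (hψs hq).1 hc.1, abs_zero]
        exact hnn ψ
      have hfr : p.1 ∈ frontier Ω := by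
        rw [hΩ.isOpen.frontier_eq]
        exact ⟨hpc, hpΩ⟩
      -- a slope for which the error factor of the chart is at most `δ`
      obtain ⟨ε, hε, hεδ⟩ : ∃ ε : NNReal, 0 < ε ∧
          |M| * (2 * ε + ((1 + ε : ℝ) ^ (N - 1) - 1)) ≤ δ := by
        have hc : Continuous fun ε : ℝ => |M| * (2 * ε + ((1 + ε : ℝ) ^ (N - 1) - 1)) := by
          fun_prop
        have h1 : ∀ᶠ ε in 𝓝[>] (0 : ℝ), |M| * (2 * ε + ((1 + ε : ℝ) ^ (N - 1) - 1)) < δ :=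
          nhdsWithin_le_nhds ((hc.tendsto' 0 0 (by simp)).eventually (gt_mem_nhds hδ))
        obtain ⟨ε, h2, h3⟩ := (h1.and self_mem_nhdsWithin).exists
        exact ⟨⟨ε, (mem_Ioi.1 h3).le⟩, h3, h2.le⟩
      obtain ⟨he, γ, ρ, r, h, hpb⟩ := hΩ.exists_isBoundaryChart hfr hε
      refine ⟨h.box ×ˢ Iio T, (h.isOpen_box.prod isOpen_Iio).mem_nhds ⟨hpb, hT p hp⟩,
        fun ψ hψ hψs => ?_⟩
      exact (hY.abs_shockDefect_le_of_chart hN hΩ hF h (abs_nonneg M) hM' hψ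
        fun q hq => hψs hq).trans (mul_le_mul_of_nonneg_right hεδ
          (integral_nonneg fun _ => abs_nonneg _))
  have hlim : Tendsto (fun δ : ℝ => δ * ∫ p, |φ p| ∂lateral Ω) (𝓝[>] 0) (𝓝 0) :=
    ((continuous_mul_const _).tendsto' 0 0 (zero_mul _)).mono_left nhdsWithin_le_nhds
  refine abs_eq_zero.1 (le_antisymm (ge_of_tendsto hlim ?_) (abs_nonneg _))
  filter_upwards [self_mem_nhdsWithin] with δ hδ using key δ hδ

/-- The divergence theorem for a field with shocks, with the boundary terms written out. -/
theorem integral_divergence (hN : 1 ≤ N) (hΩ : IsLyapunovDomain Ω n)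
    (hF : IsFrontSystem Ω F Z) (hY : IsShockField Ω F Z Y f) {φ : SpaceTime N → ℝ}
    (hφ : IsC1Test φ) :
    (∫ p in Ω ×ˢ Ioi (0 : ℝ), (fderiv ℝ φ p (Y p) + φ p * f p)) +
      (∫ x in Ω, φ (x, 0) * (Y (x, 0)).2) - ∫ p, φ p * inner ℝ (Y p).1 (n p.1) ∂lateral Ω = 0 := by
  have h1 := hY.shockDefect_eq_zero hN hΩ hF hφ
  rw [shockDefect, fluxDefect, hY.integral_boundaryFlux hN hΩ hF hφ] at h1
  have h2 : ∫ p in Ω ×ˢ Ioi (0 : ℝ), (fderiv ℝ φ p (Y p) + φ p * f p) =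
      ∫ p, (fderiv ℝ φ p ((Ω ×ˢ Ioi 0).indicator Y p) + φ p * (Ω ×ˢ Ioi 0).indicator f p)
        ∂((volume : Measure (Space N)).prod (volume : Measure ℝ)) := by
    rw [← integral_indicator (hΩ.isOpen.measurableSet.prod measurableSet_Ioi)]
    refine integral_congr_ae (Eventually.of_forall fun p => ?_)
    by_cases hp : p ∈ Ω ×ˢ Ioi (0 : ℝ)
    · simp only [indicator_of_mem hp]
    · simp only [indicator_of_notMem hp, map_zero, mul_zero, add_zero]
  rw [h2]
  linarith

end IsShockField

end LateralEstimate

/-! ### The fields attached to a classical solution -/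

section SolutionFields

variable {N : ℕ} {Ω : Set (Space N)} {n : Space N → Space N} {F : ℕ → Set (SpaceTime N)}
  {Z : Set (SpaceTime N)} {c : ℝ} {G : SpaceTime N → ℝ} {u₀ u₁ : Space N → ℝ}
  {u : SpaceTime N → ℝ} {v : SpaceTime N → Space N} {w : SpaceTime N → ℝ}

section Slice

variable {E : Type*} [NormedAddCommGroup E] [NormedSpace ℝ E] {g : SpaceTime N → E}
  {L : SpaceTime N →L[ℝ] E} {p : SpaceTime N}

lemma HasFDerivAt.space_slice (h : HasFDerivAt g L p) :
    HasFDerivAt (fun y => g (y, p.2)) (L ∘L ContinuousLinearMap.inl ℝ (Space N) ℝ) p.1 := by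
  have h1 : HasFDerivAt (fun y : Space N => (y, p.2)) (ContinuousLinearMap.inl ℝ (Space N) ℝ) p.1 :=
    hasFDerivAt_prodMk_left p.1 p.2
  exact HasFDerivAt.comp (f := fun y : Space N => (y, p.2)) p.1 h h1

lemma HasFDerivAt.time_slice (h : HasFDerivAt g L p) :
    HasDerivAt (fun s => g (p.1, s)) (L (timeDir N)) p.2 := by
  have h1 : HasFDerivAt (fun s : ℝ => (p.1, s)) (ContinuousLinearMap.inr ℝ (Space N) ℝ) p.2 :=
    hasFDerivAt_prodMk_right p.1 p.2
  have h2 := (HasFDerivAt.comp (f := fun s : ℝ => (p.1, s)) p.2 h h1).hasDerivAt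
  rwa [ContinuousLinearMap.comp_apply, ContinuousLinearMap.inr_apply] at h2

end Slice

lemma inner_single_one_right (x : Space N) (j : Fin N) :
    inner ℝ x (EuclideanSpace.single j 1) = x j := by
  rw [EuclideanSpace.inner_single_right]
  simp

namespace IsClassicalSolution

lemma isFrontSystem (hu : IsClassicalSolution c Ω G u₀ u₁ u v w F Z) : IsFrontSystem Ω F Z :=
  ⟨hu.isClosed_exceptional, hu.exceptional_null, hu.front_subset, hu.isClosed_fronts⟩

lemma isOpen_regular (hu : IsClassicalSolution c Ω G u₀ u₁ u v w F Z) (hΩ : IsOpen Ω) :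
    IsOpen ((Ω ×ˢ Ioi (0 : ℝ)) \ (Z ∪ ⋃ k, F k)) :=
  (hΩ.prod isOpen_Ioi).sdiff hu.isClosed_fronts

lemma hasFDerivAt (hu : IsClassicalSolution c Ω G u₀ u₁ u v w F Z) (hΩ : IsOpen Ω)
    {p : SpaceTime N} (hp : p ∈ (Ω ×ˢ Ioi 0) \ (Z ∪ ⋃ k, F k)) :
    HasFDerivAt u (fderiv ℝ u p) p :=
  ((hu.contDiffOn.differentiableOn two_ne_zero).differentiableAt
    ((hu.isOpen_regular hΩ).mem_nhds hp)).hasFDerivAt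

lemma fderiv_apply_space (hu : IsClassicalSolution c Ω G u₀ u₁ u v w F Z) (hΩ : IsOpen Ω)
    {p : SpaceTime N} (hp : p ∈ (Ω ×ˢ Ioi 0) \ (Z ∪ ⋃ k, F k)) (ξ : Space N) :
    fderiv ℝ u p (ξ, 0) = inner ℝ (v p) ξ := by
  have h1 := HasFDerivAt.space_slice (hu.hasFDerivAt hΩ hp)
  have h2 := (hu.gradient_eq p hp).hasFDerivAt
  have h3 := congrArg (fun L => L ξ) (h1.unique h2)
  simpa using h3

lemma fderiv_apply_time (hu : IsClassicalSolution c Ω G u₀ u₁ u v w F Z) (hΩ : IsOpen Ω)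
    {p : SpaceTime N} (hp : p ∈ (Ω ×ˢ Ioi 0) \ (Z ∪ ⋃ k, F k)) :
    fderiv ℝ u p (timeDir N) = w p :=
  (HasFDerivAt.time_slice (hu.hasFDerivAt hΩ hp)).unique (hu.velocity_eq p hp)

lemma contDiffOn_gradient (hu : IsClassicalSolution c Ω G u₀ u₁ u v w F Z) (hΩ : IsOpen Ω) :
    ContDiffOn ℝ 1 v ((Ω ×ˢ Ioi 0) \ (Z ∪ ⋃ k, F k)) := by
  refine contDiffOn_euclidean.2 fun j => ?_
  refine ((hu.contDiffOn.fderiv_of_isOpen (m := 1) (hu.isOpen_regular hΩ) (by norm_num)).clm_apply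
    (contDiffOn_const (c := (spaceDir j : SpaceTime N)))).congr fun p hp => ?_
  rw [spaceDir, hu.fderiv_apply_space hΩ hp, inner_single_one_right]

lemma contDiffOn_velocity (hu : IsClassicalSolution c Ω G u₀ u₁ u v w F Z) (hΩ : IsOpen Ω) :
    ContDiffOn ℝ 1 w ((Ω ×ˢ Ioi 0) \ (Z ∪ ⋃ k, F k)) := by
  refine ((hu.contDiffOn.fderiv_of_isOpen (m := 1) (hu.isOpen_regular hΩ) (by norm_num)).clm_apply
    (contDiffOn_const (c := timeDir N))).congr fun p hp => ?_
  rw [hu.fderiv_apply_time hΩ hp]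

lemma laplacian_eq (hu : IsClassicalSolution c Ω G u₀ u₁ u v w F Z) (hΩ : IsOpen Ω)
    {p : SpaceTime N} (hp : p ∈ (Ω ×ˢ Ioi 0) \ (Z ∪ ⋃ k, F k)) :
    Δ (fun y => u (y, p.2)) p.1 = ∑ j : Fin N, (fderiv ℝ v p (spaceDir j)) j := by
  have hO := hu.isOpen_regular hΩ
  have hvd : HasFDerivAt v (fderiv ℝ v p) p :=
    (((hu.contDiffOn_gradient hΩ).differentiableOn one_ne_zero).differentiableAt
      (hO.mem_nhds hp)).hasFDerivAt
  have hev : ∀ᶠ y in 𝓝 p.1, (y, p.2) ∈ (Ω ×ˢ Ioi 0) \ (Z ∪ ⋃ k, F k) :=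
    (Continuous.tendsto' (by fun_prop) p.1 p rfl : Tendsto (fun y => (y, p.2)) _ _).eventually
      (hO.mem_nhds hp)
  have hC : ContDiffAt ℝ 2 (fun y => u (y, p.2)) p.1 := by
    have h1 : ContDiffAt ℝ 2 u (p.1, p.2) := hu.contDiffOn.contDiffAt (hO.mem_nhds hp)
    exact h1.comp p.1 (contDiffAt_id.prodMk contDiffAt_const)
  have hD : DifferentiableAt ℝ (fderiv ℝ fun y => u (y, p.2)) p.1 :=
    (hC.fderiv_right (m := 1) (by norm_num)).differentiableAt one_ne_zero
  rw [InnerProductSpace.laplacian_eq_iteratedFDeriv_orthonormalBasis _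
    (EuclideanSpace.basisFun (Fin N) ℝ)]
  refine Finset.sum_congr rfl fun j _ => ?_
  rw [iteratedFDeriv_two_apply]
  simp only [EuclideanSpace.basisFun_apply, Matrix.cons_val_zero, Matrix.cons_val_one]
  set ej : Space N := EuclideanSpace.single j 1 with hej
  have h1 : fderiv ℝ (fderiv ℝ fun y => u (y, p.2)) p.1 ej ej =
      fderiv ℝ (fun z => fderiv ℝ (fun y => u (y, p.2)) z ej) p.1 ej := by
    rw [fderiv_clm_apply hD (differentiableAt_const _)]
    simp
  have h2 : (fun z => fderiv ℝ (fun y => u (y, p.2)) z ej) =ᶠ[𝓝 p.1] fun z => v (z, p.2) j := by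
    filter_upwards [hev] with z hz
    rw [(hu.gradient_eq _ hz).hasFDerivAt.fderiv, InnerProductSpace.toDual_apply_apply, hej,
      inner_single_one_right]
  have h3 := (EuclideanSpace.proj j : Space N →L[ℝ] ℝ).hasFDerivAt.comp p.1
    (HasFDerivAt.space_slice hvd)
  have h4 : fderiv ℝ (fun z => v (z, p.2) j) p.1 = _ := h3.fderiv
  rw [h1, h2.fderiv_eq, h4]
  rfl

lemma iteratedDeriv_two_eq (hu : IsClassicalSolution c Ω G u₀ u₁ u v w F Z) (hΩ : IsOpen Ω)
    {p : SpaceTime N} (hp : p ∈ (Ω ×ˢ Ioi 0) \ (Z ∪ ⋃ k, F k)) :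
    iteratedDeriv 2 (fun s => u (p.1, s)) p.2 = fderiv ℝ w p (timeDir N) := by
  have hO := hu.isOpen_regular hΩ
  have hwd : HasFDerivAt w (fderiv ℝ w p) p :=
    (((hu.contDiffOn_velocity hΩ).differentiableOn one_ne_zero).differentiableAt
      (hO.mem_nhds hp)).hasFDerivAt
  have hev : ∀ᶠ s in 𝓝 p.2, (p.1, s) ∈ (Ω ×ˢ Ioi 0) \ (Z ∪ ⋃ k, F k) :=
    (Continuous.tendsto' (by fun_prop) p.2 p rfl : Tendsto (fun s => (p.1, s)) _ _).eventually
      (hO.mem_nhds hp)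
  have h1 : deriv (fun s => u (p.1, s)) =ᶠ[𝓝 p.2] fun s => w (p.1, s) := by
    filter_upwards [hev] with s hs using (hu.velocity_eq _ hs).deriv
  rw [iteratedDeriv_succ, iteratedDeriv_one, h1.deriv_eq]
  exact (HasFDerivAt.time_slice hwd).deriv

/-- The field whose divergence is the wave operator. By the Hadamard condition its flux is
continuous across the fronts, which move with the speed `c`. -/
lemma isShockField_wave (hu : IsClassicalSolution c Ω G u₀ u₁ u v w F Z)
    (hc : 0 < c) (hΩ : IsOpen Ω) (hG : LocallyIntegrable ((Ω ×ˢ Ioi 0).indicator G) volume) :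
    IsShockField Ω F Z (fun p => (v p, -((c ^ 2)⁻¹ * w p))) G where
  contDiffOn := (hu.contDiffOn_gradient hΩ).prodMk
    (contDiffOn_const.mul (hu.contDiffOn_velocity hΩ)).neg
  divergence p hp := by
    have hO := (hu.isOpen_regular hΩ).mem_nhds hp
    have h1 := (((hu.contDiffOn_gradient hΩ).differentiableOn one_ne_zero).differentiableAt
      hO).hasFDerivAt
    have h2 := (((hu.contDiffOn_velocity hΩ).differentiableOn one_ne_zero).differentiableAt
      hO).hasFDerivAt
    have h4 : fderiv ℝ (fun p => (v p, -((c ^ 2)⁻¹ * w p))) p = _ :=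
      (h1.prodMk (h2.const_mul ((c ^ 2)⁻¹)).neg).fderiv
    rw [h4]
    have h3 := hu.wave_equation p hp
    rw [hu.laplacian_eq hΩ hp, hu.iteratedDeriv_two_eq hΩ hp] at h3
    rw [← h3]
    simp [sub_eq_add_neg]
  flux k p hp := by
    obtain ⟨V, g, νx, νt, vp, vm, wp, wm, hV, hpV, hg, hgF, hx, ht, hneg, hspeed, h1, h2, h3, h4,
      h5⟩ := hu.hadamard k p hp
    have hgd : HasFDerivAt g (fderiv ℝ g p) p :=
      ((hg.differentiableOn one_ne_zero).differentiableAt (hV.mem_nhds hpV)).hasFDerivAt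
    have htime : fderiv ℝ g p (0, 1) = νt := by
      rw [ht, (HasFDerivAt.time_slice hgd).deriv]
      rfl
    have hspace : ∀ ξ, fderiv ℝ g p (ξ, 0) = inner ℝ νx ξ := fun ξ => by
      have h := HasFDerivAt.space_slice hgd
      have h' := h.differentiableAt.hasGradientAt.hasFDerivAt
      have := congrArg (fun L => L ξ) (h.unique h')
      rw [hx]
      simpa using this
    refine ⟨V, g, (vp, -((c ^ 2)⁻¹ * wp)), (vm, -((c ^ 2)⁻¹ * wm)), hV, hpV, hg, hgF,
      htime ▸ hneg, h1.prodMk_nhds (h3.const_mul _).neg, h2.prodMk_nhds (h4.const_mul _).neg, ?_⟩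
    have hν : ‖νx‖ ≠ 0 := fun h0 => by
      rw [hspeed, h0] at hneg
      simp at hneg
    have hsplit : ((vp, -((c ^ 2)⁻¹ * wp)) - (vm, -((c ^ 2)⁻¹ * wm)) : SpaceTime N) =
        (vp - vm, 0) + ((c ^ 2)⁻¹ * (wm - wp)) • (0, 1) := by
      ext1
      · simp
      · simp
        ring
    rw [hsplit, map_add, map_smul, hspace, htime, hspeed, inner_sub_right, smul_eq_mul]
    rw [real_inner_smul_left, real_inner_smul_left] at h5
    have h6 : ‖νx‖ * (wp + c * (‖νx‖⁻¹ * inner ℝ νx vp)) =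
        ‖νx‖ * (wm + c * (‖νx‖⁻¹ * inner ℝ νx vm)) := by rw [h5]
    have h7 : ∀ a b : ℝ, ‖νx‖ * (a + c * (‖νx‖⁻¹ * b)) = ‖νx‖ * a + c * b := fun a b => by
      field_simp
    rw [h7, h7] at h6
    have h8 : inner ℝ νx vp - inner ℝ νx vm = c⁻¹ * (‖νx‖ * (wm - wp)) := by
      rw [eq_inv_mul_iff_mul_eq₀ hc.ne']
      linarith
    rw [h8]
    field_simp
    ring
  bounded T := by
    obtain ⟨M, hM⟩ := hu.bounded T
    refine ⟨max M ((c ^ 2)⁻¹ * M), fun p hp => ?_⟩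
    refine max_le_max (hM p hp).1 ?_
    rw [norm_neg, norm_mul, Real.norm_eq_abs, Real.norm_eq_abs, abs_of_pos (by positivity)]
    exact mul_le_mul_of_nonneg_left (hM p hp).2 (by positivity)
  continuousOn_fst := hu.gradient_continuousOn
  continuousOn_snd := ((hu.velocity_continuousOn.mono fun p hp =>
    ⟨⟨subset_closure hp.1.1, hp.1.2⟩, hp.2⟩).const_smul ((c ^ 2)⁻¹)).neg
  locallyIntegrable := hG

lemma continuousAt (hu : IsClassicalSolution c Ω G u₀ u₁ u v w F Z) (hΩ : IsOpen Ω)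
    {p : SpaceTime N} (hp : p ∈ Ω ×ˢ Ioi (0 : ℝ)) : ContinuousAt u p :=
  hu.continuousOn.continuousAt (mem_of_superset ((hΩ.prod isOpen_Ioi).mem_nhds hp)
    (prod_mono subset_closure Ioi_subset_Ici_self))

lemma exists_bound (hu : IsClassicalSolution c Ω G u₀ u₁ u v w F Z)
    (hΩ : Bornology.IsBounded Ω) (T : ℝ) : ∃ M : ℝ, ∀ p ∈ closure Ω ×ˢ Icc 0 T, |u p| ≤ M :=
  ((Metric.isCompact_of_isClosed_isBounded isClosed_closure hΩ.closure).prod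
    isCompact_Icc).exists_bound_of_continuousOn
      (hu.continuousOn.mono (prod_mono le_rfl Icc_subset_Ici_self))

/-- A field that depends continuously on the solution. The continuity of the solution makes its flux
continuous across the fronts. -/
lemma isShockField_smul (hu : IsClassicalSolution c Ω G u₀ u₁ u v w F Z)
    (hΩ : IsOpen Ω) (hb : Bornology.IsBounded Ω) (ξ : SpaceTime N) {f : SpaceTime N → ℝ}
    (hf : ∀ p ∈ (Ω ×ˢ Ioi 0) \ (Z ∪ ⋃ k, F k), fderiv ℝ u p ξ = f p)
    (hfi : LocallyIntegrable ((Ω ×ˢ Ioi 0).indicator f) volume) :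
    IsShockField Ω F Z (fun p => u p • ξ) f where
  contDiffOn := (hu.contDiffOn.of_le one_le_two).smul contDiffOn_const
  divergence p hp := by
    rw [((hu.hasFDerivAt hΩ hp).smul_const ξ).fderiv, ← hf p hp,
      continuousLinearMap_apply_eq_sum (fderiv ℝ u p) ξ]
    simp
  flux k p hp := by
    obtain ⟨V, g, νx, νt, vp, vm, wp, wm, hV, hpV, hg, hgF, hx, ht, hneg, -⟩ := hu.hadamard k p hp
    have hgd : HasFDerivAt g (fderiv ℝ g p) p :=
      ((hg.differentiableOn one_ne_zero).differentiableAt (hV.mem_nhds hpV)).hasFDerivAt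
    have htime : fderiv ℝ g p (0, 1) = νt := by
      rw [ht, (HasFDerivAt.time_slice hgd).deriv]
      rfl
    have hcont : Tendsto (fun p => u p • ξ) (𝓝 p) (𝓝 (u p • ξ)) :=
      (hu.continuousAt hΩ (hu.front_subset k hp)).tendsto.smul_const ξ
    exact ⟨V, g, u p • ξ, u p • ξ, hV, hpV, hg, hgF, htime ▸ hneg,
      hcont.mono_left nhdsWithin_le_nhds, hcont.mono_left nhdsWithin_le_nhds, by simp⟩
  bounded T := by
    obtain ⟨M, hM⟩ := hu.exists_bound hb T
    refine ⟨M * ‖ξ‖, fun p hp => ?_⟩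
    rw [norm_smul]
    exact mul_le_mul_of_nonneg_right (hM p ⟨subset_closure hp.1.1, hp.1.2.1.le, hp.1.2.2⟩)
      (norm_nonneg _)
  continuousOn_fst := (hu.continuousOn.mono fun p hp =>
    ⟨hp.1.1, (mem_Ioi.1 hp.1.2).le⟩).smul continuousOn_const
  continuousOn_snd := (hu.continuousOn.mono fun p hp =>
    ⟨subset_closure hp.1.1, hp.1.2⟩).smul continuousOn_const
  locallyIntegrable := hfi

end IsClassicalSolution

end SolutionFields

/-! ### Local integrability of the densities -/

section Densities

variable {N : ℕ} {Ω : Set (Space N)} {n : Space N → Space N} {F : ℕ → Set (SpaceTime N)}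
  {Z : Set (SpaceTime N)} {c : ℝ} {G : SpaceTime N → ℝ} {u₀ u₁ : Space N → ℝ}
  {u : SpaceTime N → ℝ} {v : SpaceTime N → Space N} {w : SpaceTime N → ℝ}

instance : IsLocallyFiniteMeasure (volume : Measure (SpaceTime N)) :=
  inferInstanceAs (IsLocallyFiniteMeasure ((volume : Measure (Space N)).prod
    (volume : Measure ℝ)))

/-- A function that is continuous on a set carried by the measure, and bounded there for bounded
times, is locally integrable. -/
lemma locallyIntegrable_of_continuousOn {μ : Measure (SpaceTime N)} [IsLocallyFiniteMeasure μ]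
    {A : Set (SpaceTime N)} (hA : MeasurableSet A) {g h : SpaceTime N → ℝ} (hg : ContinuousOn g A)
    (hb : ∀ T : ℝ, ∃ M : ℝ, ∀ p ∈ A, p.2 < T → |g p| ≤ M) (hgh : A.indicator g =ᵐ[μ] h) :
    LocallyIntegrable h μ := by
  refine LocallyIntegrable.congr ?_ hgh
  refine locallyIntegrable_of_ae_bounded ((aestronglyMeasurable_indicator_iff hA).2
    (hg.aestronglyMeasurable hA)) fun K hK => ?_
  obtain ⟨T, hT⟩ := exists_time_bound hK
  obtain ⟨M, hM⟩ := hb T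
  refine ⟨|M|, Eventually.of_forall fun p hp => ?_⟩
  by_cases hpA : p ∈ A
  · rw [indicator_of_mem hpA]
    exact (hM p hpA (hT p hp)).trans (le_abs_self M)
  · rw [indicator_of_notMem hpA, norm_zero]
    exact abs_nonneg M

lemma ae_charFn (hN : 1 ≤ N) (hΩ : IsLyapunovDomain Ω n) :
    ∀ᵐ x : Space N, charFn Ω x = Ω.indicator 1 x := by
  filter_upwards [measure_eq_zero_iff_ae_notMem.1 (hΩ.volume_frontier hN)] with x hx
  by_cases h : x ∈ Ω
  · rw [charFn, if_pos h, indicator_of_mem h, Pi.one_apply]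
  · rw [charFn, if_neg h, if_neg hx, indicator_of_notMem h]

lemma indicator_ae_eq_zeroExt (hN : 1 ≤ N) (hΩ : IsLyapunovDomain Ω n) (f : SpaceTime N → ℝ) :
    (Ω ×ˢ Ioi 0).indicator f =ᵐ[volume] zeroExt Ω f := by
  have h1 : ∀ᵐ p : SpaceTime N, charFn Ω p.1 = Ω.indicator 1 p.1 :=
    Measure.quasiMeasurePreserving_fst.ae (ae_charFn hN hΩ)
  have h0 : ∀ᵐ t : ℝ, t ≠ 0 := compl_mem_ae_iff.2 (measure_singleton 0)
  have h2 : ∀ᵐ p : SpaceTime N, p.2 ≠ 0 := Measure.quasiMeasurePreserving_snd.ae h0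
  filter_upwards [h1, h2] with p hp ht
  rw [zeroExt, hp, heaviside, if_neg ht]
  by_cases hΩp : p.1 ∈ Ω
  · by_cases htp : 0 < p.2
    · rw [indicator_of_mem (show p ∈ Ω ×ˢ Ioi (0 : ℝ) from ⟨hΩp, htp⟩), indicator_of_mem hΩp,
        if_pos htp]
      simp
    · rw [indicator_of_notMem fun h : p ∈ Ω ×ˢ Ioi (0 : ℝ) => htp h.2, if_neg htp]
      simp
  · rw [indicator_of_notMem fun h : p ∈ Ω ×ˢ Ioi (0 : ℝ) => hΩp h.1, indicator_of_notMem hΩp]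
    simp

lemma ae_initPlane : ∀ᵐ p ∂initPlane N, p.2 = 0 := by
  have h0 : ∀ᵐ s ∂(Measure.dirac (0 : ℝ)), s = 0 := by
    rw [ae_dirac_eq]
    exact eventually_pure.2 rfl
  exact Measure.quasiMeasurePreserving_snd.ae h0

lemma ae_lateralInit (hΩ : IsLyapunovDomain Ω n) :
    ∀ᵐ p ∂lateralInit Ω, p ∈ frontier Ω ×ˢ {(0 : ℝ)} := by
  have := hΩ.isFiniteMeasure_surfaceMeasure
  have h0 : ∀ᵐ s ∂(Measure.dirac (0 : ℝ)), s = 0 := by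
    rw [ae_dirac_eq]
    exact eventually_pure.2 rfl
  have h1 : ∀ᵐ p ∂lateralInit Ω, p.1 ∈ frontier Ω :=
    Measure.quasiMeasurePreserving_fst.ae
      (ae_restrict_mem isClosed_frontier.measurableSet : ∀ᵐ x ∂surfaceMeasure Ω, x ∈ frontier Ω)
  have h2 : ∀ᵐ p ∂lateralInit Ω, p.2 = 0 := Measure.quasiMeasurePreserving_snd.ae h0
  filter_upwards [h1, h2] with p a b using ⟨a, b⟩

instance : IsLocallyFiniteMeasure (initPlane N) := by
  unfold initPlane
  infer_instance

lemma IsLyapunovDomain.isLocallyFiniteMeasure_lateral (hΩ : IsLyapunovDomain Ω n) :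
    IsLocallyFiniteMeasure (lateral Ω) := by
  have := hΩ.isFiniteMeasure_surfaceMeasure
  unfold lateral
  infer_instance

lemma IsLyapunovDomain.isLocallyFiniteMeasure_lateralInit (hΩ : IsLyapunovDomain Ω n) :
    IsLocallyFiniteMeasure (lateralInit Ω) := by
  have := hΩ.isFiniteMeasure_surfaceMeasure
  unfold lateralInit
  infer_instance

lemma IsLyapunovDomain.abs_normal_le (hΩ : IsLyapunovDomain Ω n) {x : Space N}
    (hx : x ∈ frontier Ω) (j : Fin N) : |n x j| ≤ 1 := by
  have := PiLp.norm_apply_le (n x) j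
  rwa [hΩ.norm_normal hx, Real.norm_eq_abs] at this

lemma IsLyapunovDomain.continuousOn_normal_apply (hΩ : IsLyapunovDomain Ω n) (j : Fin N)
    {A : Set (SpaceTime N)} (hA : ∀ p ∈ A, p.1 ∈ frontier Ω) :
    ContinuousOn (fun p : SpaceTime N => n p.1 j) A :=
  (EuclideanSpace.proj j : Space N →L[ℝ] ℝ).continuous.comp_continuousOn
    (hΩ.continuousOn_normal.comp continuous_fst.continuousOn hA)

/-- A density carried by the bounded domain and by non-negative times. -/
lemma isForwardDensity_of_ae {μ : Measure (SpaceTime N)} {β : SpaceTime N → ℝ}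
    (hΩ : IsLyapunovDomain Ω n) (hβ : LocallyIntegrable β μ)
    (h : ∀ᵐ p ∂μ, β p ≠ 0 → p.1 ∈ closure Ω ∧ 0 ≤ p.2) : IsForwardDensity μ β := by
  obtain ⟨R, hR⟩ := (hΩ.isBounded.closure).exists_norm_le
  refine ⟨hβ, max R 0, le_max_right _ _, ?_⟩
  filter_upwards [h] with p hp h0
  exact ⟨(hR _ (hp h0).1).trans (le_max_left _ _), (hp h0).2⟩

namespace IsClassicalSolution

lemma abs_velocity_le (hu : IsClassicalSolution c Ω G u₀ u₁ u v w F Z) {T M : ℝ}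
    (hM : ∀ p ∈ (Ω ×ˢ Ioc 0 T) \ (Z ∪ ⋃ k, F k), ‖v p‖ ≤ M ∧ |w p| ≤ M) {p : SpaceTime N}
    (h : p ∈ (closure Ω ×ˢ Ici 0) \ (Z ∪ ⋃ k, F k)) (hT : p.2 < T) : |w p| ≤ M := by
  refine ContinuousWithinAt.closure_le (hu.isFrontSystem.mem_closure h.1.1 h.1.2 h.2 hT) ?_
    continuousWithinAt_const (g := fun _ => M) (f := fun p => |w p|) fun q hq => ?_
  · refine (hu.velocity_continuousOn.abs p h).mono fun q hq => ?_
    exact ⟨⟨subset_closure hq.1.1, hq.1.2.1.le⟩, hq.2⟩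
  · exact (hM q ⟨⟨hq.1.1, hq.1.2.1, hq.1.2.2.le⟩, hq.2⟩).2

lemma volume_fronts (hu : IsClassicalSolution c Ω G u₀ u₁ u v w F Z) (hc : 0 < c)
    (hΩ : IsOpen Ω) (hG : LocallyIntegrable ((Ω ×ˢ Ioi 0).indicator G) volume) :
    volume (Z ∪ ⋃ k, F k) = 0 :=
  (hu.isShockField_wave hc hΩ hG).volume_fronts hu.isFrontSystem

lemma notMem_fronts_lateral (hu : IsClassicalSolution c Ω G u₀ u₁ u v w F Z) (hΩ : IsOpen Ω)
    {p : SpaceTime N} (hp : p ∈ (frontier Ω ×ˢ Ioi (0 : ℝ)) \ Z) :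
    p ∈ (closure Ω ×ˢ Ici 0) \ (Z ∪ ⋃ k, F k) :=
  ⟨⟨frontier_subset_closure hp.1.1, (mem_Ioi.1 hp.1.2).le⟩,
    hu.isFrontSystem.notMem_fronts (fun h => frontier_notMem hΩ hp.1.1 h.1) hp.2⟩

lemma locallyIntegrable_solution (hu : IsClassicalSolution c Ω G u₀ u₁ u v w F Z)
    (hΩ : IsLyapunovDomain Ω n) : LocallyIntegrable ((Ω ×ˢ Ioi 0).indicator u) volume := by
  refine locallyIntegrable_of_continuousOn (hΩ.isOpen.measurableSet.prod measurableSet_Ioi)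
    (hu.continuousOn.mono (prod_mono subset_closure Ioi_subset_Ici_self)) (fun T => ?_)
    EventuallyEq.rfl
  obtain ⟨M, hM⟩ := hu.exists_bound hΩ.isBounded T
  exact ⟨M, fun p hp hT => hM p ⟨subset_closure hp.1, (mem_Ioi.1 hp.2).le, hT.le⟩⟩

lemma indicator_regular_ae_eq (hu : IsClassicalSolution c Ω G u₀ u₁ u v w F Z) (hc : 0 < c)
    (hΩ : IsOpen Ω) (hG : LocallyIntegrable ((Ω ×ˢ Ioi 0).indicator G) volume)
    (f : SpaceTime N → ℝ) : ((Ω ×ˢ Ioi 0) \ (Z ∪ ⋃ k, F k)).indicator f =ᵐ[volume]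
      (Ω ×ˢ Ioi 0).indicator f := by
  filter_upwards [measure_eq_zero_iff_ae_notMem.1 (hu.volume_fronts hc hΩ hG)] with p hp
  by_cases hpQ : p ∈ Ω ×ˢ Ioi (0 : ℝ)
  · rw [indicator_of_mem hpQ, indicator_of_mem (show p ∈ _ \ _ from ⟨hpQ, hp⟩)]
  · rw [indicator_of_notMem hpQ, indicator_of_notMem fun h => hpQ h.1]

lemma locallyIntegrable_gradient (hu : IsClassicalSolution c Ω G u₀ u₁ u v w F Z) (hc : 0 < c)
    (hΩ : IsOpen Ω) (hG : LocallyIntegrable ((Ω ×ˢ Ioi 0).indicator G) volume) (j : Fin N) :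
    LocallyIntegrable ((Ω ×ˢ Ioi 0).indicator fun p => v p j) volume := by
  refine locallyIntegrable_of_continuousOn (hu.isOpen_regular hΩ).measurableSet
    ((EuclideanSpace.proj j : Space N →L[ℝ] ℝ).continuous.comp_continuousOn
      (hu.contDiffOn_gradient hΩ).continuousOn) (fun T => ?_)
    (hu.indicator_regular_ae_eq hc hΩ hG _)
  obtain ⟨M, hM⟩ := hu.bounded T
  exact ⟨M, fun p hp hT => (PiLp.norm_apply_le (v p) j).trans
    (hM p ⟨⟨hp.1.1, hp.1.2, hT.le⟩, hp.2⟩).1⟩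

lemma locallyIntegrable_velocity (hu : IsClassicalSolution c Ω G u₀ u₁ u v w F Z) (hc : 0 < c)
    (hΩ : IsOpen Ω) (hG : LocallyIntegrable ((Ω ×ˢ Ioi 0).indicator G) volume) :
    LocallyIntegrable ((Ω ×ˢ Ioi 0).indicator w) volume := by
  refine locallyIntegrable_of_continuousOn (hu.isOpen_regular hΩ).measurableSet
    (hu.contDiffOn_velocity hΩ).continuousOn (fun T => ?_)
    (hu.indicator_regular_ae_eq hc hΩ hG _)
  obtain ⟨M, hM⟩ := hu.bounded T
  exact ⟨M, fun p hp hT => (hM p ⟨⟨hp.1.1, hp.1.2, hT.le⟩, hp.2⟩).2⟩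

lemma locallyIntegrable_velocity_lateral (hu : IsClassicalSolution c Ω G u₀ u₁ u v w F Z)
    (hN : 1 ≤ N) (hΩ : IsLyapunovDomain Ω n) (j : Fin N) :
    LocallyIntegrable (fun p => w p * n p.1 j) (lateral Ω) := by
  have := hΩ.isLocallyFiniteMeasure_lateral
  refine locallyIntegrable_of_continuousOn (A := (frontier Ω ×ˢ Ioi (0 : ℝ)) \ Z)
    (g := fun p => w p * n p.1 j)
    ((isClosed_frontier.measurableSet.prod measurableSet_Ioi).diff
      hu.isClosed_exceptional.measurableSet) ((hu.velocity_continuousOn.mono fun p hp =>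
        hu.notMem_fronts_lateral hΩ.isOpen hp).mul
        (hΩ.continuousOn_normal_apply j fun p hp => hp.1.1)) (fun T => ?_) ?_
  · obtain ⟨M, hM⟩ := hu.bounded T
    refine ⟨M, fun p hp hT => ?_⟩
    rw [abs_mul, ← mul_one M]
    have h1 := hu.abs_velocity_le hM (hu.notMem_fronts_lateral hΩ.isOpen hp) hT
    exact mul_le_mul h1 (hΩ.abs_normal_le hp.1.1 j) (abs_nonneg _) ((abs_nonneg _).trans h1)
  · filter_upwards [ae_lateral hN hΩ hu.isFrontSystem] with p hp
    rw [indicator_of_mem hp]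

lemma locallyIntegrable_solution_lateral (hu : IsClassicalSolution c Ω G u₀ u₁ u v w F Z)
    (hN : 1 ≤ N) (hΩ : IsLyapunovDomain Ω n) (j : Fin N) :
    LocallyIntegrable (fun p => u p * n p.1 j) (lateral Ω) := by
  have := hΩ.isLocallyFiniteMeasure_lateral
  refine locallyIntegrable_of_continuousOn (A := frontier Ω ×ˢ Ici (0 : ℝ))
    (g := fun p => u p * n p.1 j)
    (isClosed_frontier.measurableSet.prod measurableSet_Ici)
    ((hu.continuousOn.mono (prod_mono frontier_subset_closure le_rfl)).mul
        (hΩ.continuousOn_normal_apply j fun p hp => hp.1)) (fun T => ?_) ?_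
  · obtain ⟨M, hM⟩ := hu.exists_bound hΩ.isBounded T
    refine ⟨M, fun p hp hT => ?_⟩
    rw [abs_mul, ← mul_one M]
    have h1 := hM p ⟨frontier_subset_closure hp.1, hp.2, hT.le⟩
    exact mul_le_mul h1 (hΩ.abs_normal_le hp.1 j) (abs_nonneg _) ((abs_nonneg _).trans h1)
  · filter_upwards [ae_lateral hN hΩ hu.isFrontSystem] with p hp
    rw [indicator_of_mem (show p ∈ frontier Ω ×ˢ Ici (0 : ℝ) from
      ⟨hp.1.1, (mem_Ioi.1 hp.1.2).le⟩)]

lemma locallyIntegrable_lateralInit (hu : IsClassicalSolution c Ω G u₀ u₁ u v w F Z)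
    (hΩ : IsLyapunovDomain Ω n) (j : Fin N) :
    LocallyIntegrable (fun p => u₀ p.1 * n p.1 j) (lateralInit Ω) := by
  have := hΩ.isLocallyFiniteMeasure_lateralInit
  refine locallyIntegrable_of_continuousOn (A := frontier Ω ×ˢ {(0 : ℝ)})
    (g := fun p => u p * n p.1 j)
    (isClosed_frontier.measurableSet.prod (measurableSet_singleton 0))
    ((hu.continuousOn.mono (prod_mono frontier_subset_closure
      (singleton_subset_iff.2 self_mem_Ici))).mul
        (hΩ.continuousOn_normal_apply j fun p hp => hp.1)) (fun T => ?_) ?_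
  · obtain ⟨M, hM⟩ := hu.exists_bound hΩ.isBounded T
    refine ⟨M, fun p hp hT => ?_⟩
    rw [abs_mul, ← mul_one M]
    have h1 := hM p ⟨frontier_subset_closure hp.1, (mem_singleton_iff.1 hp.2).ge, hT.le⟩
    exact mul_le_mul h1 (hΩ.abs_normal_le hp.1 j) (abs_nonneg _) ((abs_nonneg _).trans h1)
  · filter_upwards [ae_lateralInit hΩ] with p hp
    rw [indicator_of_mem hp, ← hu.initial_value p.1 (frontier_subset_closure hp.1),
      ← mem_singleton_iff.1 hp.2]

lemma locallyIntegrable_initial_value (hu : IsClassicalSolution c Ω G u₀ u₁ u v w F Z)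
    (hN : 1 ≤ N) (hΩ : IsLyapunovDomain Ω n) :
    LocallyIntegrable (fun p => charFn Ω p.1 * u₀ p.1) (initPlane N) := by
  refine locallyIntegrable_of_continuousOn (A := Ω ×ˢ {(0 : ℝ)}) (g := u)
    (hΩ.isOpen.measurableSet.prod (measurableSet_singleton 0))
    (hu.continuousOn.mono (prod_mono subset_closure (singleton_subset_iff.2 self_mem_Ici)))
    (fun T => ?_) ?_
  · obtain ⟨M, hM⟩ := hu.exists_bound hΩ.isBounded T
    exact ⟨M, fun p hp hT => hM p ⟨subset_closure hp.1, (mem_singleton_iff.1 hp.2).ge, hT.le⟩⟩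
  · have h1 : ∀ᵐ p ∂initPlane N, charFn Ω p.1 = Ω.indicator 1 p.1 :=
      Measure.quasiMeasurePreserving_fst.ae (ae_charFn hN hΩ)
    filter_upwards [h1, ae_initPlane] with p hp h0
    rw [hp]
    by_cases hpΩ : p.1 ∈ Ω
    · rw [indicator_of_mem hpΩ, indicator_of_mem (show p ∈ Ω ×ˢ {(0 : ℝ)} from ⟨hpΩ, h0⟩),
        ← hu.initial_value p.1 (subset_closure hpΩ), ← h0, Pi.one_apply, one_mul]
    · rw [indicator_of_notMem hpΩ, indicator_of_notMem fun h : p ∈ Ω ×ˢ {(0 : ℝ)} => hpΩ h.1,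
        zero_mul]

lemma ae_initial_velocity (hu : IsClassicalSolution c Ω G u₀ u₁ u v w F Z) :
    ∀ᵐ x : Space N, x ∈ Ω → (x, (0 : ℝ)) ∉ (Z ∪ ⋃ k, F k) ∧ w (x, 0) = u₁ x := by
  filter_upwards [ae_forall_notMem_of_hausdorffMeasure hu.exceptional_null] with x hx hxΩ
  have h1 := hu.isFrontSystem.notMem_fronts (p := (x, 0)) (fun h => lt_irrefl (0 : ℝ) h.2) (hx 0)
  exact ⟨h1, hu.initial_velocity x hxΩ h1⟩

lemma locallyIntegrable_initial_velocity (hu : IsClassicalSolution c Ω G u₀ u₁ u v w F Z)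
    (hN : 1 ≤ N) (hΩ : IsLyapunovDomain Ω n) :
    LocallyIntegrable (fun p => charFn Ω p.1 * u₁ p.1) (initPlane N) := by
  refine locallyIntegrable_of_continuousOn (A := (Ω ×ˢ {(0 : ℝ)}) \ (Z ∪ ⋃ k, F k)) (g := w)
    ((hΩ.isOpen.measurableSet.prod (measurableSet_singleton 0)).diff
      hu.isClosed_fronts.measurableSet)
    (hu.velocity_continuousOn.mono (sdiff_subset_sdiff_left
      (prod_mono subset_closure (singleton_subset_iff.2 self_mem_Ici))))
    (fun T => ?_) ?_
  · obtain ⟨M, hM⟩ := hu.bounded T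
    exact ⟨M, fun p hp hT => hu.abs_velocity_le hM
      ⟨⟨subset_closure hp.1.1, (mem_singleton_iff.1 hp.1.2).ge⟩, hp.2⟩ hT⟩
  · have h1 : ∀ᵐ p ∂initPlane N, charFn Ω p.1 = Ω.indicator 1 p.1 :=
      Measure.quasiMeasurePreserving_fst.ae (ae_charFn hN hΩ)
    have h2 : ∀ᵐ p ∂initPlane N, p.1 ∈ Ω → (p.1, (0 : ℝ)) ∉ (Z ∪ ⋃ k, F k) ∧
        w (p.1, 0) = u₁ p.1 := Measure.quasiMeasurePreserving_fst.ae hu.ae_initial_velocity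
    filter_upwards [h1, h2, ae_initPlane] with p hp hpw h0
    rw [hp]
    by_cases hpΩ : p.1 ∈ Ω
    · obtain ⟨h3, h4⟩ := hpw hpΩ
      rw [← h0] at h3 h4
      rw [indicator_of_mem hpΩ, indicator_of_mem (show p ∈ (Ω ×ˢ {(0 : ℝ)}) \ _ from
        ⟨⟨hpΩ, h0⟩, h3⟩), ← h4, Pi.one_apply, one_mul]
    · rw [indicator_of_notMem hpΩ, indicator_of_notMem
        fun h : p ∈ (Ω ×ˢ {(0 : ℝ)}) \ _ => hpΩ h.1.1, zero_mul]

end IsClassicalSolution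

end Densities

/-! ### The Green identity -/

section GreenFormula

variable {N : ℕ} {Ω : Set (Space N)} {n : Space N → Space N} {F : ℕ → Set (SpaceTime N)}
  {Z : Set (SpaceTime N)} {c : ℝ} {G : SpaceTime N → ℝ} {u₀ u₁ : Space N → ℝ}
  {u : SpaceTime N → ℝ} {v : SpaceTime N → Space N} {w : SpaceTime N → ℝ}

lemma TestFn.isC1Test (φ : TestFn N) : IsC1Test φ :=
  ⟨φ.contDiff.of_le (by simp), φ.hasCompactSupport⟩

lemma IsC1Test.integrableOn_mul {φ : SpaceTime N → ℝ} (hφ : IsC1Test φ) (hΩ : IsOpen Ω)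
    {β : SpaceTime N → ℝ} (hβ : LocallyIntegrable ((Ω ×ˢ Ioi 0).indicator β) volume) :
    IntegrableOn (fun p => φ p * β p) (Ω ×ˢ Ioi 0) := by
  have h := hφ.integrable_mul hβ
  rw [← integrable_indicator_iff (hΩ.measurableSet.prod measurableSet_Ioi)]
  refine h.congr (Eventually.of_forall fun p => ?_)
  by_cases hp : p ∈ Ω ×ˢ Ioi (0 : ℝ)
  · simp only [indicator_of_mem hp]
  · simp only [indicator_of_notMem hp, mul_zero]

lemma layer_zeroExt_apply (hN : 1 ≤ N) (hΩ : IsLyapunovDomain Ω n) {f : SpaceTime N → ℝ}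
    (hf : LocallyIntegrable (zeroExt Ω f) volume) (φ : TestFn N) :
    layer volume (zeroExt Ω f) φ = ∫ p in Ω ×ˢ Ioi (0 : ℝ), φ p * f p := by
  rw [layer_apply hf, ← integral_indicator (hΩ.isOpen.measurableSet.prod measurableSet_Ioi)]
  refine integral_congr_ae ?_
  filter_upwards [indicator_ae_eq_zeroExt hN hΩ f] with p hp
  rw [← hp]
  by_cases hpQ : p ∈ Ω ×ˢ Ioi (0 : ℝ)
  · simp only [indicator_of_mem hpQ]
  · simp only [indicator_of_notMem hpQ, mul_zero]

lemma layer_initPlane_apply (hN : 1 ≤ N) (hΩ : IsLyapunovDomain Ω n) {g : Space N → ℝ}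
    (hg : LocallyIntegrable (fun p => charFn Ω p.1 * g p.1) (initPlane N)) (φ : TestFn N) :
    layer (initPlane N) (fun p => charFn Ω p.1 * g p.1) φ = ∫ x in Ω, φ (x, 0) * g x := by
  rw [layer_apply hg, initPlane, Measure.prod_dirac,
    (measurableEmbedding_prod_mk_right (0 : ℝ)).integral_map,
    ← integral_indicator hΩ.isOpen.measurableSet]
  refine integral_congr_ae ?_
  filter_upwards [ae_charFn hN hΩ] with x hx
  rw [hx]
  by_cases hxΩ : x ∈ Ω
  · simp [indicator_of_mem hxΩ]
  · simp [indicator_of_notMem hxΩ]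

namespace IsClassicalSolution

/-- The divergence theorem for the field `u` times the unit vector of the `j`-th axis. -/
lemma integral_fderiv_space (hu : IsClassicalSolution c Ω G u₀ u₁ u v w F Z) (hN : 1 ≤ N)
    (hc : 0 < c) (hΩ : IsLyapunovDomain Ω n)
    (hG : LocallyIntegrable ((Ω ×ˢ Ioi 0).indicator G) volume) {φ : SpaceTime N → ℝ}
    (hφ : IsC1Test φ) (j : Fin N) :
    (∫ p in Ω ×ˢ Ioi (0 : ℝ), fderiv ℝ φ p (spaceDir j) * u p) =
      ∫ p, φ p * (u p * n p.1 j) ∂lateral Ω - ∫ p in Ω ×ˢ Ioi (0 : ℝ), φ p * v p j := by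
  have hv := hu.locallyIntegrable_gradient hc hΩ.isOpen hG j
  have hY := hu.isShockField_smul hΩ.isOpen hΩ.isBounded (spaceDir j)
    (f := fun p => v p j) (fun p hp => by
      rw [spaceDir, hu.fderiv_apply_space hΩ.isOpen hp, inner_single_one_right]) hv
  have h1 := hY.integral_divergence hN hΩ hu.isFrontSystem hφ
  have hi : IntegrableOn (fun p => fderiv ℝ φ p (spaceDir j) * u p) (Ω ×ˢ Ioi 0) := by
    have h2 := hφ.integrable_fderiv_apply (hY.locallyIntegrable_indicator hΩ.isOpen
      hu.isFrontSystem)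
    rw [← integrable_indicator_iff (hΩ.isOpen.measurableSet.prod measurableSet_Ioi)]
    refine h2.congr (Eventually.of_forall fun p => ?_)
    by_cases hp : p ∈ Ω ×ˢ Ioi (0 : ℝ)
    · simp only [indicator_of_mem hp, map_smul, smul_eq_mul]
      ring
    · simp only [indicator_of_notMem hp, map_zero]
  have e1 : (∫ p in Ω ×ˢ Ioi (0 : ℝ), (fderiv ℝ φ p (u p • spaceDir j) + φ p * v p j)) =
      (∫ p in Ω ×ˢ Ioi (0 : ℝ), fderiv ℝ φ p (spaceDir j) * u p) +
        ∫ p in Ω ×ˢ Ioi (0 : ℝ), φ p * v p j := by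
    rw [← integral_add hi (hφ.integrableOn_mul hΩ.isOpen hv)]
    refine integral_congr_ae (Eventually.of_forall fun p => ?_)
    simp only [map_smul, smul_eq_mul]
    ring
  have e2 : ∀ p : SpaceTime N, inner ℝ (u p • spaceDir j).1 (n p.1) = u p * n p.1 j := fun p => by
    rw [Prod.smul_fst, real_inner_smul_left, spaceDir, real_inner_comm, inner_single_one_right]
  simp only [e1, e2] at h1
  simp only [spaceDir, Prod.smul_snd, smul_zero, mul_zero, integral_zero] at h1
  simp only [spaceDir]
  linarith

/-- The divergence theorem for the field `u` times the unit vector of the time axis. -/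
lemma integral_fderiv_time (hu : IsClassicalSolution c Ω G u₀ u₁ u v w F Z) (hN : 1 ≤ N)
    (hc : 0 < c) (hΩ : IsLyapunovDomain Ω n)
    (hG : LocallyIntegrable ((Ω ×ˢ Ioi 0).indicator G) volume) {φ : SpaceTime N → ℝ}
    (hφ : IsC1Test φ) :
    (∫ p in Ω ×ˢ Ioi (0 : ℝ), fderiv ℝ φ p (timeDir N) * u p) =
      -(∫ x in Ω, φ (x, 0) * u₀ x) - ∫ p in Ω ×ˢ Ioi (0 : ℝ), φ p * w p := by
  have hw := hu.locallyIntegrable_velocity hc hΩ.isOpen hG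
  have hY := hu.isShockField_smul hΩ.isOpen hΩ.isBounded (timeDir N)
    (fun p hp => hu.fderiv_apply_time hΩ.isOpen hp) hw
  have h1 := hY.integral_divergence hN hΩ hu.isFrontSystem hφ
  have hi : IntegrableOn (fun p => fderiv ℝ φ p (timeDir N) * u p) (Ω ×ˢ Ioi 0) := by
    have h2 := hφ.integrable_fderiv_apply (hY.locallyIntegrable_indicator hΩ.isOpen
      hu.isFrontSystem)
    rw [← integrable_indicator_iff (hΩ.isOpen.measurableSet.prod measurableSet_Ioi)]
    refine h2.congr (Eventually.of_forall fun p => ?_)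
    by_cases hp : p ∈ Ω ×ˢ Ioi (0 : ℝ)
    · simp only [indicator_of_mem hp, map_smul, smul_eq_mul]
      ring
    · simp only [indicator_of_notMem hp, map_zero]
  have e1 : (∫ p in Ω ×ˢ Ioi (0 : ℝ), (fderiv ℝ φ p (u p • timeDir N) + φ p * w p)) =
      (∫ p in Ω ×ˢ Ioi (0 : ℝ), fderiv ℝ φ p (timeDir N) * u p) +
        ∫ p in Ω ×ˢ Ioi (0 : ℝ), φ p * w p := by
    rw [← integral_add hi (hφ.integrableOn_mul hΩ.isOpen hw)]
    refine integral_congr_ae (Eventually.of_forall fun p => ?_)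
    simp only [map_smul, smul_eq_mul]
    ring
  have e2 : ∀ p : SpaceTime N, inner ℝ (u p • timeDir N).1 (n p.1) = 0 := fun p => by
    rw [Prod.smul_fst, timeDir, smul_zero, inner_zero_left]
  have e3 : (∫ x in Ω, φ (x, 0) * (u (x, 0) • timeDir N).2) = ∫ x in Ω, φ (x, 0) * u₀ x := by
    refine setIntegral_congr_fun hΩ.isOpen.measurableSet fun x hx => ?_
    simp only [timeDir, Prod.smul_snd, smul_eq_mul, mul_one,
      hu.initial_value x (subset_closure hx)]
  rw [e1, e3] at h1
  simp only [e2, mul_zero, integral_zero] at h1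
  linarith

/-- The divergence theorem for the field `(∇u, -c⁻² ∂u/∂t)`, whose divergence is the wave operator. -/
lemma integral_wave (hu : IsClassicalSolution c Ω G u₀ u₁ u v w F Z) (hN : 1 ≤ N)
    (hc : 0 < c) (hΩ : IsLyapunovDomain Ω n)
    (hG : LocallyIntegrable ((Ω ×ˢ Ioi 0).indicator G) volume) {φ : SpaceTime N → ℝ}
    (hφ : IsC1Test φ) (hφ' : ∀ ξ, IsC1Test fun p => fderiv ℝ φ p ξ) :
    (∑ j : Fin N, ∫ p in Ω ×ˢ Ioi (0 : ℝ), fderiv ℝ φ p (spaceDir j) * v p j) -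
      (c ^ 2)⁻¹ * (∫ p in Ω ×ˢ Ioi (0 : ℝ), fderiv ℝ φ p (timeDir N) * w p) +
      (∫ p in Ω ×ˢ Ioi (0 : ℝ), φ p * G p) - (c ^ 2)⁻¹ * (∫ x in Ω, φ (x, 0) * u₁ x) -
      ∫ p, φ p * inner ℝ (v p) (n p.1) ∂lateral Ω = 0 := by
  have hY := hu.isShockField_wave hc hΩ.isOpen hG
  have h1 := hY.integral_divergence hN hΩ hu.isFrontSystem hφ
  have hv := fun j => (hφ' (spaceDir j)).integrableOn_mul hΩ.isOpen
    (hu.locallyIntegrable_gradient hc hΩ.isOpen hG j)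
  have hw := (hφ' (timeDir N)).integrableOn_mul hΩ.isOpen
    (hu.locallyIntegrable_velocity hc hΩ.isOpen hG)
  have e1 : (∫ p in Ω ×ˢ Ioi (0 : ℝ), (fderiv ℝ φ p (v p, -((c ^ 2)⁻¹ * w p)) + φ p * G p)) =
      (∑ j : Fin N, ∫ p in Ω ×ˢ Ioi (0 : ℝ), fderiv ℝ φ p (spaceDir j) * v p j) -
      (c ^ 2)⁻¹ * (∫ p in Ω ×ˢ Ioi (0 : ℝ), fderiv ℝ φ p (timeDir N) * w p) +
      ∫ p in Ω ×ˢ Ioi (0 : ℝ), φ p * G p := by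
    have hs : IntegrableOn (fun p => (∑ j : Fin N, fderiv ℝ φ p (spaceDir j) * v p j) -
        (c ^ 2)⁻¹ * (fderiv ℝ φ p (timeDir N) * w p)) (Ω ×ˢ Ioi 0) :=
      (integrable_finsetSum _ fun j _ => hv j).sub (hw.const_mul _)
    rw [← integral_const_mul, ← integral_finsetSum _ fun j _ => hv j,
      ← integral_sub (integrable_finsetSum _ fun j _ => hv j) (hw.const_mul _),
      ← integral_add hs (hφ.integrableOn_mul hΩ.isOpen hG)]
    refine integral_congr_ae (Eventually.of_forall fun p => ?_)
    simp only
    rw [continuousLinearMap_apply_eq_sum (fderiv ℝ φ p)]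
    simp only
    ring
  have e2 : (∫ x in Ω, φ (x, 0) * -((c ^ 2)⁻¹ * w (x, 0))) =
      -((c ^ 2)⁻¹ * ∫ x in Ω, φ (x, 0) * u₁ x) := by
    rw [← integral_const_mul, ← integral_neg]
    refine setIntegral_congr_ae hΩ.isOpen.measurableSet ?_
    filter_upwards [hu.ae_initial_velocity] with x hx hxΩ
    rw [(hx hxΩ).2]
    ring
  simp only at h1
  rw [e1, e2] at h1
  linarith

/-- The Green identity: the wave operator applied to the extension by zero of the solution, as a sum of
layers. The factor `1/2` on the boundary in that extension is irrelevant, since the boundary is a null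
set. -/
theorem layer_waveTest (hu : IsClassicalSolution c Ω G u₀ u₁ u v w F Z) (hN : 1 ≤ N)
    (hc : 0 < c) (hΩ : IsLyapunovDomain Ω n)
    (hG : LocallyIntegrable (zeroExt Ω G) volume) (φ : TestFn N) :
    layer volume (zeroExt Ω u) (waveTest c φ) = layer volume (zeroExt Ω G) φ -
      layer (lateral Ω) (fun p => inner ℝ (v p) (n p.1)) φ +
      (∑ j, layer (lateral Ω) (fun p => u p * n p.1 j) (∂_{spaceDir j} φ)) +
      (c ^ 2)⁻¹ * layer (initPlane N) (fun p => charFn Ω p.1 * u₀ p.1) (∂_{timeDir N} φ) -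
      (c ^ 2)⁻¹ * layer (initPlane N) (fun p => charFn Ω p.1 * u₁ p.1) φ := by
  have hG' := hG.congr (indicator_ae_eq_zeroExt hN hΩ G).symm
  have hul := hu.locallyIntegrable_solution hΩ
  have hF := hu.isFrontSystem
  have hD : ∀ (ψ : TestFn N) (ξ : SpaceTime N), IsC1Test fun p => fderiv ℝ ψ p ξ := fun ψ ξ => by
    simp only [← testFn_lineDeriv_apply]
    exact TestFn.isC1Test _
  have hDD : ∀ ξ p, (∂_{ξ} (∂_{ξ} φ)) p = fderiv ℝ (fun q => fderiv ℝ φ q ξ) p ξ := fun ξ p => by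
    rw [testFn_lineDeriv_apply]
    congr 2
  have hI : ∀ ξ, IntegrableOn (fun p => fderiv ℝ (fun q => fderiv ℝ φ q ξ) p ξ * u p)
      (Ω ×ˢ Ioi 0) := fun ξ => by
    simp only [← hDD]
    exact (TestFn.isC1Test _).integrableOn_mul hΩ.isOpen hul
  rw [layer_zeroExt_apply hN hΩ (hul.congr (indicator_ae_eq_zeroExt hN hΩ u)),
    layer_zeroExt_apply hN hΩ hG, layer_initPlane_apply hN hΩ (hu.locallyIntegrable_initial_value
      hN hΩ), layer_initPlane_apply hN hΩ (hu.locallyIntegrable_initial_velocity hN hΩ),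
    layer_apply ((hu.isShockField_wave hc hΩ.isOpen hG').locallyIntegrable_flux_lateral hN hΩ hF)]
  simp only [layer_apply (hu.locallyIntegrable_solution_lateral hN hΩ _), testFn_lineDeriv_apply]
  have e1 : (∫ p in Ω ×ˢ Ioi (0 : ℝ), waveTest c φ p * u p) =
      (∑ j, ∫ p in Ω ×ˢ Ioi (0 : ℝ),
        fderiv ℝ (fun q => fderiv ℝ φ q (spaceDir j)) p (spaceDir j) * u p) -
      (c ^ 2)⁻¹ * ∫ p in Ω ×ˢ Ioi (0 : ℝ),
        fderiv ℝ (fun q => fderiv ℝ φ q (timeDir N)) p (timeDir N) * u p := by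
    rw [← integral_const_mul, ← integral_finsetSum _ fun j _ => hI _,
      ← integral_sub (integrable_finsetSum _ fun j _ => hI _) ((hI _).const_mul _)]
    refine integral_congr_ae (Eventually.of_forall fun p => ?_)
    simp only [waveTest_apply, hDD, sub_mul, Finset.sum_mul]
    ring
  have h2 := fun j => hu.integral_fderiv_space hN hc hΩ hG' (hD φ (spaceDir j)) j
  have h3 := hu.integral_fderiv_time hN hc hΩ hG' (hD φ (timeDir N))
  have h4 := hu.integral_wave hN hc hΩ hG' (TestFn.isC1Test φ) (hD φ)
  rw [e1, h3]
  simp only [h2, Finset.sum_sub_distrib]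
  linarith

end IsClassicalSolution

end GreenFormula

/-! ### Regularity in time on the lateral boundary -/

lemma Set.countable_of_eventually_notMem {A : Set ℝ} (h : ∀ t ∈ A, ∀ᶠ s in 𝓝[≠] t, s ∉ A) :
    A.Countable := by
  have : DiscreteTopology A := discreteTopology_subtype_iff.2 fun t ht =>
    inf_principal_eq_bot.2 (h t ht)
  exact countable_coe_iff.1 (separableSpace_iff_countable.1 inferInstance)

section TimeRegularity

variable {N : ℕ} {Ω : Set (Space N)} {n : Space N → Space N} {F : ℕ → Set (SpaceTime N)}
  {Z : Set (SpaceTime N)} {c : ℝ} {G : SpaceTime N → ℝ} {u₀ u₁ : Space N → ℝ}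
  {u : SpaceTime N → ℝ} {v : SpaceTime N → Space N} {w : SpaceTime N → ℝ}

namespace IsClassicalSolution

/-- A line parallel to the time axis crosses the fronts transversally, hence in a countable set. -/
lemma countable_front_times (hu : IsClassicalSolution c Ω G u₀ u₁ u v w F Z) (x : Space N) :
    {t | (x, t) ∈ ⋃ k, F k}.Countable := by
  have h1 : {t | (x, t) ∈ ⋃ k, F k} = ⋃ k, {t | (x, t) ∈ F k} := by
    ext t
    simp
  rw [h1]
  refine countable_iUnion fun k => countable_of_eventually_notMem fun t ht => ?_
  obtain ⟨V, g, νx, νt, vp, vm, wp, wm, hV, hpV, hg, hgF, hx, hνt, hneg, -⟩ := hu.hadamard k _ ht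
  have hd : HasDerivAt (fun s => g (x, s)) νt t := by
    rw [hνt]
    refine DifferentiableAt.hasDerivAt (differentiableAt_of_deriv_ne_zero ?_)
    rw [← hνt]
    exact hneg.ne
  have hVt : ∀ᶠ s in 𝓝[≠] t, (x, s) ∈ V :=
    nhdsWithin_le_nhds ((Continuous.tendsto' (by fun_prop) t (x, t) rfl :
      Tendsto (fun s => (x, s)) _ _).eventually (hV.mem_nhds hpV))
  filter_upwards [hd.eventually_ne (c := 0) hneg.ne, hVt] with s hs hsV hsF
  exact hs ((hgF _ hsV).1 hsF)

/-- On a vertical line that avoids `Z` the solution is continuous, and differentiable with bounded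
derivative off a countable set of times. -/
lemma abs_sub_le_of_line (hu : IsClassicalSolution c Ω G u₀ u₁ u v w F Z) {T M : ℝ}
    (hM : ∀ p ∈ (Ω ×ˢ Ioc 0 T) \ (Z ∪ ⋃ k, F k), ‖v p‖ ≤ M ∧ |w p| ≤ M) {x : Space N}
    (hx : x ∈ Ω) (hxZ : ∀ t, (x, t) ∉ Z) {s t : ℝ} (hs : s ∈ Icc 0 T) (ht : t ∈ Icc 0 T) :
    |u (x, t) - u (x, s)| ≤ M * |t - s| := by
  have hA := hu.countable_front_times x
  have hsub : uIcc s t ⊆ Icc 0 T := uIcc_subset_Icc hs ht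
  have hc : ContinuousOn (fun r => u (x, r)) (uIcc s t) :=
    hu.continuousOn.comp (by fun_prop) fun r hr => ⟨subset_closure hx, (hsub hr).1⟩
  have hW : ∀ r, r ∉ {t | (x, t) ∈ ⋃ k, F k} → (x, r) ∉ Z ∪ ⋃ k, F k := by
    rintro r hr (h | h)
    · exact hxZ r h
    · exact hr h
  have hd : ∀ r ∈ Ioo 0 T \ {t | (x, t) ∈ ⋃ k, F k}, HasDerivAt (fun r => u (x, r)) (w (x, r)) r :=
    fun r hr => hu.velocity_eq (x, r) ⟨⟨hx, hr.1.1⟩, hW r hr.2⟩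
  have hIoo : ∀ r ∈ Ioo (min s t) (max s t), r ∈ Ioo 0 T := fun r hr =>
    ⟨(le_min hs.1 ht.1).trans_lt hr.1, hr.2.trans_le (max_le hs.2 ht.2)⟩
  have hbd : ∀ᵐ r, r ∈ Set.uIoc s t → ‖deriv (fun r => u (x, r)) r‖ ≤ M := by
    have h0 : ∀ᵐ r : ℝ, r ≠ max s t := compl_mem_ae_iff.2 (measure_singleton _)
    filter_upwards [hA.ae_notMem volume, h0] with r hr hr0 hrI
    have h1 := hIoo r ⟨hrI.1, lt_of_le_of_ne hrI.2 hr0⟩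
    rw [(hd r ⟨h1, hr⟩).deriv]
    exact (hM _ ⟨⟨hx, h1.1, h1.2.le⟩, hW r hr⟩).2
  have hi : IntervalIntegrable (deriv fun r => u (x, r)) volume s t := by
    rw [intervalIntegrable_iff]
    exact Measure.integrableOn_of_bounded (by simp [uIoc]) (measurable_deriv _).aestronglyMeasurable
      ((ae_restrict_iff' measurableSet_uIoc).2 hbd)
  have h1 := integral_eq_of_hasDerivAt_off_countable _ _ hA hc
    (fun r hr => (hd r ⟨hIoo r hr.1, hr.2⟩).differentiableAt.hasDerivAt) hi
  rw [← h1]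
  exact intervalIntegral.norm_integral_le_of_norm_le_const_ae hbd

/-- The solution is Lipschitz in time, on the closed domain: almost every vertical line avoids `Z`, and
the estimate extends to the other ones by continuity. -/
lemma abs_sub_le (hu : IsClassicalSolution c Ω G u₀ u₁ u v w F Z) (hΩ : IsOpen Ω) {T M : ℝ}
    (hM : ∀ p ∈ (Ω ×ˢ Ioc 0 T) \ (Z ∪ ⋃ k, F k), ‖v p‖ ≤ M ∧ |w p| ≤ M) {x : Space N}
    (hx : x ∈ closure Ω) {s t : ℝ} (hs : s ∈ Icc 0 T) (ht : t ∈ Icc 0 T) :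
    |u (x, t) - u (x, s)| ≤ M * |t - s| := by
  have hd : Dense {x : Space N | ∀ t, (x, t) ∉ Z} :=
    Measure.dense_of_ae (μ := volume) (ae_forall_notMem_of_hausdorffMeasure hu.exceptional_null)
  have hx' : x ∈ closure (Ω ∩ {x : Space N | ∀ t, (x, t) ∉ Z}) :=
    closure_minimal (hd.open_subset_closure_inter hΩ) isClosed_closure hx
  have hc : ∀ r ∈ Icc 0 T, ContinuousOn (fun y => u (y, r)) (closure Ω) := fun r hr =>
    hu.continuousOn.comp (by fun_prop) fun y hy => ⟨hy, hr.1⟩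
  refine ContinuousWithinAt.closure_le hx' (f := fun y => |u (y, t) - u (y, s)|)
    (g := fun _ => M * |t - s|) ?_ continuousWithinAt_const fun y hy => ?_
  · exact ((((hc t ht).sub (hc s hs)).abs) x hx).mono (inter_subset_left.trans subset_closure)
  · exact hu.abs_sub_le_of_line hM hy.1 hy.2 hs ht

/-- Off the exceptional set, the boundary values of the velocity are the time derivative of the
boundary values of the solution. -/
lemma hasDerivAt_lateral (hu : IsClassicalSolution c Ω G u₀ u₁ u v w F Z) (hΩ : IsOpen Ω)
    {p : SpaceTime N} (hp : p ∈ (frontier Ω ×ˢ Ioi (0 : ℝ)) \ Z) :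
    HasDerivAt (fun s => u (p.1, s)) (w p) p.2 := by
  have hpW := hu.notMem_fronts_lateral hΩ hp
  rw [hasDerivAt_iff_isLittleO, Asymptotics.isLittleO_iff]
  intro ε hε
  have h1 : ∀ᶠ q in 𝓝 p, q ∈ (closure Ω ×ˢ Ici 0) \ (Z ∪ ⋃ k, F k) → |w q - w p| < ε :=
    eventually_nhdsWithin_iff.1 ((hu.velocity_continuousOn p hpW).eventually
      (Metric.ball_mem_nhds _ hε))
  have h2 : ∀ᶠ q in 𝓝 p, q ∉ Z ∪ ⋃ k, F k := hu.isClosed_fronts.isOpen_compl.mem_nhds hpW.2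
  have h3 : ∀ᶠ q : SpaceTime N in 𝓝 p, 0 < q.2 :=
    (isOpen_lt continuous_const continuous_snd).mem_nhds hp.1.2
  obtain ⟨δ, hδ, hball⟩ := Metric.eventually_nhds_iff_ball.1 (h1.and (h2.and h3))
  filter_upwards [Metric.ball_mem_nhds p.2 hδ] with s hs
  have hx' : p.1 ∈ closure (Ω ∩ Metric.ball p.1 δ) := by
    rw [inter_comm]
    exact Metric.isOpen_ball.inter_closure ⟨Metric.mem_ball_self hδ, frontier_subset_closure hp.1.1⟩
  have hs0 : ∀ r ∈ Metric.ball p.2 δ, ∀ y ∈ Metric.ball p.1 δ, (y, r) ∈ Metric.ball p δ :=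
    fun r hr y hy => by
      rw [← ball_prod_same]
      exact ⟨hy, hr⟩
  have hc : ∀ r ∈ Metric.ball p.2 δ, ContinuousOn (fun y => u (y, r)) (closure Ω) := fun r hr =>
    hu.continuousOn.comp (by fun_prop) fun y hy =>
      ⟨hy, (hball _ (hs0 r hr p.1 (Metric.mem_ball_self hδ))).2.2.le⟩
  -- the mean value inequality on vertical lines inside the domain passes to the limit at the boundary
  refine ContinuousWithinAt.closure_le hx'
    (f := fun y => ‖u (y, s) - u (y, p.2) - (s - p.2) • w p‖)
    (g := fun _ => ε * ‖s - p.2‖) ?_ continuousWithinAt_const fun y hy => ?_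
  · have h4 : ContinuousOn (fun y => ‖u (y, s) - u (y, p.2) - (s - p.2) • w p‖) (closure Ω) :=
      (((hc s hs).sub (hc p.2 (Metric.mem_ball_self hδ))).sub continuousOn_const).norm
    exact (h4 p.1 (frontier_subset_closure hp.1.1)).mono (inter_subset_left.trans subset_closure)
  · have h5 : ∀ r ∈ Metric.ball p.2 δ,
        HasDerivWithinAt (fun r => u (y, r) - (r - p.2) * w p) (w (y, r) - w p)
          (Metric.ball p.2 δ) r := fun r hr => by
      obtain ⟨-, hW, h0⟩ := hball _ (hs0 r hr y hy.2)
      have h6 := hu.velocity_eq (y, r) ⟨⟨hy.1, h0⟩, hW⟩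
      have h7 := ((hasDerivAt_id r).sub_const p.2).mul_const (w p)
      rw [one_mul] at h7
      exact (h6.sub h7).hasDerivWithinAt
    have h8 := (convex_ball p.2 δ).norm_image_sub_le_of_norm_hasDerivWithin_le (C := ε) h5
      (fun r hr => by
        obtain ⟨hw, hW, h0⟩ := hball _ (hs0 r hr y hy.2)
        exact (hw ⟨⟨subset_closure hy.1, h0.le⟩, hW⟩).le)
      (Metric.mem_ball_self hδ) hs
    refine le_trans (le_of_eq ?_) h8
    congr 1
    simp only [smul_eq_mul]
    ring

/-- Integration by parts on a vertical line of the lateral boundary, along which the solution is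
Lipschitz. -/
lemma integral_line_lateral (hu : IsClassicalSolution c Ω G u₀ u₁ u v w F Z) (hΩ : IsOpen Ω)
    {φ : SpaceTime N → ℝ} (hφ : IsC1Test φ) {x : Space N} (hx : x ∈ frontier Ω)
    (hxZ : ∀ᵐ t ∂volume.restrict (Ici (0 : ℝ)), (x, t) ∉ Z) :
    (∫ t in Ici (0 : ℝ), φ (x, t) * w (x, t)) + φ (x, 0) * u₀ x =
      -∫ t in Ici (0 : ℝ), fderiv ℝ φ (x, t) (timeDir N) * u (x, t) := by
  obtain ⟨T', hT'⟩ := exists_time_bound hφ.hasCompactSupport.isCompact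
  set T := max T' 0 with hT
  have hT0 : 0 ≤ T := le_max_right _ _
  have hout : ∀ t, T ≤ t → (x, t) ∉ tsupport φ := fun t ht h =>
    absurd (hT' _ h) (not_lt.2 ((le_max_left _ _).trans ht))
  obtain ⟨M, hM⟩ := hu.bounded T
  have hxc := frontier_subset_closure hx
  have hLip : LipschitzOnWith M.toNNReal (fun t => u (x, t)) (uIcc 0 T) := by
    rw [uIcc_of_le hT0]
    refine LipschitzOnWith.of_dist_le_mul fun s hs t ht => ?_
    refine (hu.abs_sub_le hΩ hM hxc ht hs).trans ?_
    exact mul_le_mul_of_nonneg_right (Real.le_coe_toNNReal M) (abs_nonneg _)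
  have hφd : ∀ t, HasDerivAt (fun t => φ (x, t)) (fderiv ℝ φ (x, t) (timeDir N)) t := fun t =>
    HasFDerivAt.time_slice (p := (x, t)) (hφ.differentiable (x, t)).hasFDerivAt
  have hφc : ContDiff ℝ 1 fun t => φ (x, t) := hφ.contDiff.comp (by fun_prop)
  have hac := hLip.absolutelyContinuousOnInterval.integral_deriv_mul_eq_sub
    hφc.contDiffOn.absolutelyContinuousOnInterval
  have hIci : ∀ h : ℝ → ℝ, (∀ t, T ≤ t → h t = 0) → ∫ t in Ici (0 : ℝ), h t = ∫ t in 0..T, h t := by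
    intro h h0
    rw [intervalIntegral.integral_of_le hT0, integral_Ici_eq_integral_Ioi]
    refine setIntegral_eq_of_subset_of_forall_sdiff_eq_zero measurableSet_Ioi
      Ioc_subset_Ioi_self fun t ht => h0 t ?_
    by_contra hlt
    exact ht.2 ⟨ht.1, (not_le.1 hlt).le⟩
  have hw : ∀ᵐ t, t ∈ Set.uIoc 0 T → deriv (fun t => u (x, t)) t = w (x, t) := by
    filter_upwards [(ae_restrict_iff' measurableSet_Ici).1 hxZ] with t ht htI
    rw [uIoc_of_le hT0] at htI
    exact (hu.hasDerivAt_lateral hΩ (p := (x, t)) ⟨⟨hx, htI.1⟩, ht htI.1.le⟩).deriv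
  have hz : ∀ t, T ≤ t → φ (x, t) = 0 := fun t ht => image_eq_zero_of_notMem_tsupport (hout t ht)
  have hz' : ∀ t, T ≤ t → fderiv ℝ φ (x, t) (timeDir N) = 0 := fun t ht => by
    rw [image_eq_zero_of_notMem_tsupport fun h => hout t ht (tsupport_fderiv_subset ℝ h)]
    rfl
  rw [hIci _ fun t ht => by rw [hz t ht, zero_mul], hIci _ fun t ht => by rw [hz' t ht, zero_mul]]
  have i1 : IntervalIntegrable (fun t => deriv (fun t => u (x, t)) t * φ (x, t)) volume 0 T :=
    hLip.absolutelyContinuousOnInterval.intervalIntegrable_deriv.mul_continuousOn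
      hφc.continuous.continuousOn
  have i2 : IntervalIntegrable (fun t => u (x, t) * deriv (fun t => φ (x, t)) t) volume 0 T :=
    hφc.contDiffOn.absolutelyContinuousOnInterval.intervalIntegrable_deriv.continuousOn_mul
      hLip.continuousOn
  rw [intervalIntegral.integral_add i1 i2, hz T le_rfl, mul_zero, zero_sub,
    hu.initial_value x hxc] at hac
  have e1 : ∫ t in 0..T, deriv (fun t => u (x, t)) t * φ (x, t) =
      ∫ t in 0..T, φ (x, t) * w (x, t) := by
    refine intervalIntegral.integral_congr_ae ?_
    filter_upwards [hw] with t ht htI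
    rw [ht htI, mul_comm]
  have e2 : ∫ t in 0..T, u (x, t) * deriv (fun t => φ (x, t)) t =
      ∫ t in 0..T, fderiv ℝ φ (x, t) (timeDir N) * u (x, t) :=
    intervalIntegral.integral_congr fun t _ => by
      simp only [(hφd t).deriv]
      ring
  rw [e1, e2] at hac
  linarith

/-- The layer of the velocity, together with the initial layer, is the time derivative of the layer of
the boundary values. -/
theorem layer_velocity_add_lateralInit (hu : IsClassicalSolution c Ω G u₀ u₁ u v w F Z)
    (hN : 1 ≤ N) (hΩ : IsLyapunovDomain Ω n) (j : Fin N) (φ : TestFn N) :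
    layer (lateral Ω) (fun p => w p * n p.1 j) φ +
      layer (lateralInit Ω) (fun p => u₀ p.1 * n p.1 j) φ =
      -layer (lateral Ω) (fun p => u p * n p.1 j) (∂_{timeDir N} φ) := by
  have := hΩ.isFiniteMeasure_surfaceMeasure
  have hb := hu.locallyIntegrable_velocity_lateral hN hΩ j
  have he := hu.locallyIntegrable_lateralInit hΩ j
  have hd := hu.locallyIntegrable_solution_lateral hN hΩ j
  rw [layer_apply hb, layer_apply he, layer_apply hd]
  have := hΩ.isLocallyFiniteMeasure_lateral
  have := hΩ.isLocallyFiniteMeasure_lateralInit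
  have ib := (TestFn.isC1Test φ).integrable_mul hb
  have ie := (TestFn.isC1Test φ).integrable_mul he
  have id := (TestFn.isC1Test (∂_{timeDir N} φ)).integrable_mul hd
  have e1 : ∫ p, φ p * (u₀ p.1 * n p.1 j) ∂lateralInit Ω =
      ∫ x, φ (x, 0) * (u₀ x * n x j) ∂surfaceMeasure Ω := by
    rw [lateralInit, Measure.prod_dirac, (measurableEmbedding_prod_mk_right (0 : ℝ)).integral_map]
  have ie' : Integrable (fun x => φ (x, 0) * (u₀ x * n x j)) (surfaceMeasure Ω) := by
    rw [lateralInit, Measure.prod_dirac,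
      (measurableEmbedding_prod_mk_right (0 : ℝ)).integrable_map_iff] at ie
    exact ie
  rw [e1]
  unfold lateral at ib id ⊢
  rw [integral_prod _ ib, integral_prod _ id, ← integral_add ib.integral_prod_left ie',
    ← integral_neg]
  have hae : ∀ᵐ p ∂lateral Ω, p ∈ (frontier Ω ×ˢ Ioi (0 : ℝ)) \ Z :=
    ae_lateral hN hΩ hu.isFrontSystem
  have hfr : ∀ᵐ x ∂surfaceMeasure Ω, x ∈ frontier Ω :=
    ae_restrict_mem isClosed_frontier.measurableSet
  refine integral_congr_ae ?_
  filter_upwards [hfr, Measure.ae_ae_of_ae_prod hae] with x hx hxt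
  have h1 := hu.integral_line_lateral hΩ.isOpen (TestFn.isC1Test φ) hx (hxt.mono fun t ht => ht.2)
  have h2 : ∀ g h : ℝ → ℝ, ∫ t in Ici (0 : ℝ), g t * (h t * n x j) =
      n x j * ∫ t in Ici (0 : ℝ), g t * h t := fun g h => by
    rw [← integral_const_mul]
    refine integral_congr_ae (Eventually.of_forall fun t => ?_)
    simp only
    ring
  simp only [testFn_lineDeriv_apply]
  rw [h2 (fun t => φ (x, t)) fun t => w (x, t),
    h2 (fun t => fderiv ℝ φ (x, t) (timeDir N)) fun t => u (x, t)]
  linear_combination n x j * h1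

end IsClassicalSolution

end TimeRegularity

/-! ### The densities as forward layers -/

section ForwardDensities

variable {N : ℕ} {Ω : Set (Space N)} {n : Space N → Space N}

lemma isForwardDensity_lateral (hΩ : IsLyapunovDomain Ω n) {β : SpaceTime N → ℝ}
    (hβ : LocallyIntegrable β (lateral Ω)) : IsForwardDensity (lateral Ω) β := by
  have := hΩ.isFiniteMeasure_surfaceMeasure
  refine isForwardDensity_of_ae hΩ hβ ?_
  have h1 : ∀ᵐ p ∂lateral Ω, p.1 ∈ frontier Ω :=
    Measure.quasiMeasurePreserving_fst.ae
      (ae_restrict_mem isClosed_frontier.measurableSet : ∀ᵐ x ∂surfaceMeasure Ω, x ∈ frontier Ω)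
  have h2 : ∀ᵐ p ∂lateral Ω, p.2 ∈ Ici (0 : ℝ) :=
    Measure.quasiMeasurePreserving_snd.ae (ae_restrict_mem measurableSet_Ici)
  filter_upwards [h1, h2] with p a b _ using ⟨frontier_subset_closure a, b⟩

lemma isForwardDensity_lateralInit (hΩ : IsLyapunovDomain Ω n) {β : SpaceTime N → ℝ}
    (hβ : LocallyIntegrable β (lateralInit Ω)) : IsForwardDensity (lateralInit Ω) β := by
  refine isForwardDensity_of_ae hΩ hβ ?_
  filter_upwards [ae_lateralInit hΩ] with p hp _ using
    ⟨frontier_subset_closure hp.1, (mem_singleton_iff.1 hp.2).ge⟩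

lemma mem_closure_of_charFn_ne_zero {x : Space N} (h : charFn Ω x ≠ 0) : x ∈ closure Ω := by
  by_contra hx
  refine h ?_
  rw [charFn, if_neg fun h => hx (subset_closure h), if_neg fun h => hx (frontier_subset_closure h)]

lemma isForwardDensity_initPlane (hΩ : IsLyapunovDomain Ω n) {g : Space N → ℝ}
    (hg : LocallyIntegrable (fun p => charFn Ω p.1 * g p.1) (initPlane N)) :
    IsForwardDensity (initPlane N) fun p => charFn Ω p.1 * g p.1 := by
  refine isForwardDensity_of_ae hΩ hg ?_
  filter_upwards [ae_initPlane] with p hp h0 using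
    ⟨mem_closure_of_charFn_ne_zero (left_ne_zero_of_mul h0), hp.ge⟩

lemma isForwardDensity_zeroExt (hΩ : IsLyapunovDomain Ω n) {f : SpaceTime N → ℝ}
    (hf : LocallyIntegrable (zeroExt Ω f) volume) : IsForwardDensity volume (zeroExt Ω f) := by
  refine isForwardDensity_of_ae hΩ hf (Eventually.of_forall fun p h0 => ?_)
  have h1 := right_ne_zero_of_mul h0
  refine ⟨mem_closure_of_charFn_ne_zero (left_ne_zero_of_mul h1), ?_⟩
  by_contra ht
  refine right_ne_zero_of_mul h1 ?_
  rw [heaviside, if_neg fun h => ht h.le, if_neg fun h => ht h.ge]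

end ForwardDensities

end

theorem theorem3p1 (N : ℕ) (hN : 1 ≤ N) (c : ℝ) (hc : 0 < c)
    (Ω : Set (Space N)) (n : Space N → Space N) (hΩ : IsLyapunovDomain Ω n)
    (G : SpaceTime N → ℝ) (hG : LocallyIntegrable (zeroExt Ω G) volume)
    (u₀ u₁ : Space N → ℝ) (u : SpaceTime N → ℝ)
    (v : SpaceTime N → Space N) (w : SpaceTime N → ℝ)
    (F : ℕ → Set (SpaceTime N)) (Z : Set (SpaceTime N))
    (hu : IsClassicalSolution c Ω G u₀ u₁ u v w F Z)
    (U : GenFn N) (hU : IsGreenFunction c U) :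
    -- every density below is locally integrable, so that the generalized functions are defined
    (LocallyIntegrable (zeroExt Ω u) volume ∧
      LocallyIntegrable (fun p => inner ℝ (v p) (n p.1)) (lateral Ω) ∧
      (∀ j, LocallyIntegrable (fun p => w p * n p.1 j) (lateral Ω)) ∧
      (∀ j, LocallyIntegrable (fun p => u₀ p.1 * n p.1 j) (lateralInit Ω)) ∧
      LocallyIntegrable (fun p => charFn Ω p.1 * u₁ p.1) (initPlane N) ∧
      LocallyIntegrable (fun p => charFn Ω p.1 * u₀ p.1) (initPlane N) ∧
      LocallyIntegrable (fun _ => (1 : ℝ)) (pointTimes N)) ∧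
    -- all the convolutions exist, and the formula holds
    ∃ (W A : GenFn N) (B C : Fin N → GenFn N) (D E K : GenFn N),
      HasConvolution U (layer (pointTimes N) fun _ => 1) W ∧
      HasConvolution U (layer (lateral Ω) fun p => inner ℝ (v p) (n p.1)) A ∧
      (∀ j, HasConvolution (∂_{spaceDir j} W) (layer (lateral Ω) fun p => w p * n p.1 j) (B j)) ∧
      (∀ j, HasConvolution (∂_{spaceDir j} W)
        (layer (lateralInit Ω) fun p => u₀ p.1 * n p.1 j) (C j)) ∧
      HasConvolution U (layer (initPlane N) fun p => charFn Ω p.1 * u₁ p.1) D ∧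
      HasConvolution U (layer (initPlane N) fun p => charFn Ω p.1 * u₀ p.1) E ∧
      HasConvolution U (layer volume (zeroExt Ω G)) K ∧
      layer volume (zeroExt Ω u) =
        -A - (∑ j, B j) - (∑ j, C j) - (c ^ 2)⁻¹ • D - (c ^ 2)⁻¹ • ∂_{timeDir N} E + K := by
  have hf := (hu.locallyIntegrable_solution hΩ).congr (indicator_ae_eq_zeroExt hN hΩ u)
  have ha := (hu.isShockField_wave hc hΩ.isOpen (hG.congr
    (indicator_ae_eq_zeroExt hN hΩ G).symm)).locallyIntegrable_flux_lateral hN hΩ hu.isFrontSystem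
  have hb := hu.locallyIntegrable_velocity_lateral hN hΩ
  have hd := hu.locallyIntegrable_solution_lateral hN hΩ
  have he := hu.locallyIntegrable_lateralInit hΩ
  have h₁ := hu.locallyIntegrable_initial_velocity hN hΩ
  have h₀ := hu.locallyIntegrable_initial_value hN hΩ
  exact ⟨⟨hf, ha, hb, he, h₁, h₀, isForwardDensity_pointTimes.locallyIntegrable⟩,
    representation_of_green hc hU (isForwardDensity_zeroExt hΩ hf) (isForwardDensity_zeroExt hΩ hG)
      (isForwardDensity_lateral hΩ ha) (fun j => isForwardDensity_lateral hΩ (hb j))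
      (fun j => isForwardDensity_lateral hΩ (hd j))
      (fun j => isForwardDensity_lateralInit hΩ (he j)) (isForwardDensity_initPlane hΩ h₀)
      (isForwardDensity_initPlane hΩ h₁) (hu.layer_waveTest hN hc hΩ hG)
      (hu.layer_velocity_add_lateralInit hN hΩ)⟩
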